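/- Let $(\mathcal C,\otimes,I,\Phi)$ be a closed braided monoidal category with equalizers and coequalizers, with inner homs $[A,-]$ right adjoint to $A\otimes -$. Let $H\in\mathcal C$ be a Hopf algebra that is flat, i.e. $H\otimes -$ preserves equalizers. Suppose that the braiding is $H$-linear: for all left $H$-modules $M,N$ the morphism $\Phi_{M,N}\colon M\otimes N\to N\otimes M$ is $H$-linear for the diagonal actions. Then the category ${}_H\mathcal C$ of left $H$-modules is braided monoidal with the diagonal action and the braiding $\Phi$; an $H$-module algebra is an algebra in ${}_H\mathcal C$. An algebra $A$ in a braided monoidal category is *Azumaya* if it is faithfully projective, that is, it has a dual $P=[A,I]$ (so that $[A,Y]=P\otimes Y$) and evaluation induces an isomorphism $A\otimes_{[A,A]}[A,I]\cong I$, and if the two canonical morphisms $A\otimes\overline A\to[A,A]$, $a\otimes b\mapsto(c\mapsto a(cb))$ (with $b$ passing $c$ by $\Phi$), and $\overline A\otimes A\to[A,A]$, $a\otimes b\mapsto(c\mapsto(ac)b)$ (with $c$ passing $a$ by $\Phi$), are isomorphisms. An *$H$-Azumaya algebra* is an Azumaya algebra in ${}_H\mathcal C$. An *$H$-Galois object*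 is a right $H$-comodule algebra $T$ in $\mathcal C$ such that $T\otimes -$ preserves and reflects equalizers and the morphism $T\otimes T\to T\otimes H$, $x\otimes y\mapsto xy_{(0)}\otimes y_{(1)}$, is an isomorphism; isomorphisms of $H$-Galois objects are isomorphisms of $H$-comodule algebras. For an $H$-module algebra $A$, the smash product $A\# H$ is $A\otimes H$ with multiplication $(a\# h)(b\# k)=a(h_{(1)}b)\# h_{(2)}k$ (with $h_{(2)}$ passing $b$ by $\Phi$), unit $1\#1$ and right $H$-coaction $A\otimes\Delta$. For $A$ $H$-Azumaya, $(A\# H)^A$ is the equalizer of the two morphisms $A\# H\to[A,A\# H]$ adjoint to $a\otimes m\mapsto (a\#1)m$ and to $A\otimes (A\# H)\xrightarrow{\Phi}(A\# H)\otimes A\to A\# H$, $m\otimes a\mapsto m(a\#1)$; it is an $H$-comodule subalgebra of $A\# H$. For right $H$-comodule algebras $S,T$, the cotensor product $S\,\Box_H\,T$ is the equalizer of $\rho_S\otimes T$ and $S\otimes\lambda_T\colon S\otimes T\to S\otimes H\otimes T$, where $\lambda_T=\Phi_{T,H}\circ\rho_T$; it is a subalgebra of $S\otimes T$, and an $H$-comodule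 algebra through $S\otimes\rho_T$. (The $H$-linearity of the braiding makes $H$ cocommutative and $\Phi_{H,X}^{-1}=\Phi_{X,H}$ for all $X$.) Suppose in addition that $\Phi_{T,X}=\Phi_{X,T}^{-1}$ for every $H$-Galois object $T$ and every $X\in\mathcal C$. If $A$ and $B$ are $H$-Azumaya algebras, then $[(A\otimes B)\# H]^{A\otimes B}$ and $(A\# H)^A\,\Box_H\,(B\# H)^B$ are $H$-Galois objects, and there is an isomorphism of $H$-Galois objects $$[(A\otimes B)\# H]^{A\otimes B}\;\cong\;(A\# H)^A\,\Box_H\,(B\# H)^B .$$ Here $A\otimes B$ is the tensor product algebra in ${}_H\mathcal C$. -/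

import Mathlib

open CategoryTheory MonoidalCategory Limits
open scoped MonObj ComonObj

universe v u

namespace BraidedHopf

variable {C : Type u} [Category.{v} C] [MonoidalCategory C] [BraidedCategory C]

/-! ### The category of left `H`-modules -/

section Modules

variable {H : C} [BimonObj H]

instance : IsMonHom (Δ[H]) where
  one_hom := BimonObj.one_comul H
  mul_hom := by rw [BimonObj.mul_comul]; rfl

instance : IsMonHom (ε[H]) where
  one_hom := by rw [BimonObj.one_counit]; rfl
  mul_hom := by rw [BimonObj.mul_counit]; rfl

/-- The action `H ⊗ M ⟶ M` of a left `H`-module. -/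
def act (M : Mod C H) : H ⊗ M.X ⟶ M.X := M.mod.smul

theorem one_act (M : Mod C H) : η[H] ▷ M.X ≫ act M = (λ_ M.X).hom := M.mod.one_smul

theorem mul_act (M : Mod C H) :
    μ[H] ▷ M.X ≫ act M = (α_ H H M.X).hom ≫ H ◁ act M ≫ act M := M.mod.mul_smul

theorem act_hom {M N : Mod C H} (f : M ⟶ N) : act M ≫ f.hom = H ◁ f.hom ≫ act N :=
  f.isModHom.smul_hom

/-- An `H`-linear morphism from its underlying morphism. -/
@[reducible]
def mkHom {M N : Mod C H} (f : M.X ⟶ N.X) (h : act M ≫ f = H ◁ f ≫ act N) : M ⟶ N :=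
  Mod.Hom.mk' f h

/-- An `H`-linear isomorphism from its underlying isomorphism. -/
@[reducible]
def mkIso {M N : Mod C H} (f : M.X ≅ N.X) (h : act M ≫ f.hom = H ◁ f.hom ≫ act N) : M ≅ N where
  hom := mkHom f.hom h
  inv := mkHom f.inv (by
    rw [Iso.comp_inv_eq, Category.assoc, h, whiskerLeft_inv_hom_assoc])
  hom_inv_id := by ext; exact f.hom_inv_id
  inv_hom_id := by ext; exact f.inv_hom_id

/-- The diagonal action of `H` on a tensor product: comultiply, let the second copy of `H` pass
`M` by the braiding, and act on both factors. -/
def diagAct {M N : C} (a : H ⊗ M ⟶ M) (b : H ⊗ N ⟶ N) : H ⊗ (M ⊗ N) ⟶ M ⊗ N :=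
  Δ[H] ▷ (M ⊗ N) ≫ tensorμ H H M N ≫ (a ⊗ₘ b)

/-- The tensor product of two left `H`-modules. -/
def diagMod (M N : Mod C H) : Mod C H where
  X := M.X ⊗ N.X
  mod :=
    { smul := diagAct (act M) (act N)
      one_smul := by
        change η[H] ▷ (M.X ⊗ N.X) ≫ diagAct (act M) (act N) = (λ_ (M.X ⊗ N.X)).hom
        rw [diagAct, ← comp_whiskerRight_assoc, BimonObj.one_comul]
        change ((λ_ (𝟙_ C)).inv ≫ (η[H] ⊗ₘ η[H])) ▷ (M.X ⊗ N.X) ≫ _ = _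
        rw [comp_whiskerRight, Category.assoc, tensorμ_natural_left_assoc,
          tensorHom_comp_tensorHom, one_act, one_act]
        exact (tensor_left_unitality M.X N.X).symm
      mul_smul := by
        change μ[H] ▷ (M.X ⊗ N.X) ≫ diagAct (act M) (act N) =
          (α_ H H (M.X ⊗ N.X)).hom ≫ H ◁ diagAct (act M) (act N) ≫ diagAct (act M) (act N)
        have h := tensor_associativity H H H H M.X N.X
        rw [diagAct, ← comp_whiskerRight_assoc, BimonObj.mul_comul]
        simp only [comp_whiskerRight, Category.assoc, tensorμ_natural_left_assoc,
          tensorHom_comp_tensorHom, mul_act, whiskerLeft_comp]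
        simp only [← tensorHom_comp_tensorHom]
        rw [reassoc_of% h, whisker_exchange_assoc, whisker_exchange_assoc,
          tensorμ_natural_right_assoc, MonoidalCategory.tensorHom_def' Δ[H] Δ[H],
          comp_whiskerRight, Category.assoc, associator_naturality_left_assoc,
          associator_naturality_middle_assoc, whisker_exchange_assoc] }

/-- An object of `C` with the trivial `H`-action, through the counit. -/
def trivMod (X : C) : Mod C H where
  X := X
  mod :=
    { smul := ε[H] ▷ X ≫ (λ_ X).hom
      one_smul := by
        change η[H] ▷ X ≫ ε[H] ▷ X ≫ (λ_ X).hom = (λ_ X).hom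
        rw [← comp_whiskerRight_assoc, BimonObj.one_counit]
        simp
      mul_smul := by
        change μ[H] ▷ X ≫ ε[H] ▷ X ≫ (λ_ X).hom =
          (α_ H H X).hom ≫ H ◁ (ε[H] ▷ X ≫ (λ_ X).hom) ≫ ε[H] ▷ X ≫ (λ_ X).hom
        rw [← comp_whiskerRight_assoc, BimonObj.mul_counit, whisker_exchange_assoc]
        change ((ε[H] ⊗ₘ ε[H]) ≫ (λ_ (𝟙_ C)).hom) ▷ X ≫ _ = _
        simp [MonoidalCategory.tensorHom_def] }

theorem diagAct_natural {M M' N N' : Mod C H} (f : M ⟶ M') (g : N ⟶ N') :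
    diagAct (act M) (act N) ≫ (f.hom ⊗ₘ g.hom) =
      H ◁ (f.hom ⊗ₘ g.hom) ≫ diagAct (act M') (act N') := by
  simp only [diagAct, Category.assoc, tensorHom_comp_tensorHom, act_hom]
  rw [whisker_exchange_assoc, tensorμ_natural_right_assoc, tensorHom_comp_tensorHom]

theorem diagAct_assoc {L M N : C} (a : H ⊗ L ⟶ L) (b : H ⊗ M ⟶ M) (c : H ⊗ N ⟶ N) :
    diagAct (diagAct a b) c ≫ (α_ L M N).hom =
      H ◁ (α_ L M N).hom ≫ diagAct a (diagAct b c) := by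
  have h := associator_monoidal H H H L M N
  have e₁ : (diagAct a b ⊗ₘ c) =
      (Δ[H] ▷ (L ⊗ M) ⊗ₘ 𝟙 H ▷ N) ≫ tensorμ H H L M ▷ (H ⊗ N) ≫ ((a ⊗ₘ b) ⊗ₘ c) := by
    simp only [diagAct, ← tensorHom_id, tensorHom_comp_tensorHom, Category.id_comp,
      id_tensorHom_id]
  have e₂ : (a ⊗ₘ diagAct b c) =
      (𝟙 H ▷ L ⊗ₘ Δ[H] ▷ (M ⊗ N)) ≫ (H ⊗ L) ◁ tensorμ H H M N ≫ (a ⊗ₘ (b ⊗ₘ c)) := by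
    simp only [diagAct, ← tensorHom_id, ← id_tensorHom, tensorHom_comp_tensorHom,
      Category.id_comp, id_tensorHom_id]
  change (Δ[H] ▷ ((L ⊗ M) ⊗ N) ≫ tensorμ H H (L ⊗ M) N ≫ (diagAct a b ⊗ₘ c)) ≫ _ =
    _ ≫ Δ[H] ▷ (L ⊗ M ⊗ N) ≫ tensorμ H H L (M ⊗ N) ≫ (a ⊗ₘ diagAct b c)
  rw [e₁, e₂, ← tensorμ_natural_left_assoc, ← tensorμ_natural_left_assoc]
  simp only [Category.assoc, associator_naturality]
  rw [reassoc_of% h, MonoidalCategory.tensorHom_def (α_ H H H).hom, Category.assoc,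
    whisker_exchange_assoc, whisker_exchange_assoc]
  have e₃ : Δ[H] ≫ (Δ[H] ⊗ₘ 𝟙 H) ≫ (α_ H H H).hom = Δ[H] ≫ (𝟙 H ⊗ₘ Δ[H]) := by simp
  simp only [← comp_whiskerRight_assoc, e₃]

theorem diagAct_leftUnitor {M : C} (a : H ⊗ M ⟶ M) :
    diagAct (ε[H] ▷ 𝟙_ C ≫ (λ_ (𝟙_ C)).hom) a ≫ (λ_ M).hom = H ◁ (λ_ M).hom ≫ a := by
  have h := leftUnitor_monoidal H M
  have e : ((ε[H] ▷ 𝟙_ C ≫ (λ_ (𝟙_ C)).hom) ⊗ₘ a) =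
      (ε[H] ▷ 𝟙_ C ⊗ₘ 𝟙 H ▷ M) ≫ (λ_ (𝟙_ C)).hom ▷ (H ⊗ M) ≫ 𝟙_ C ◁ a := by
    simp only [← tensorHom_id, ← id_tensorHom, tensorHom_comp_tensorHom, Category.id_comp,
      Category.comp_id, id_tensorHom_id]
  rw [diagAct, e, ← tensorμ_natural_left_assoc]
  simp only [Category.assoc, leftUnitor_naturality]
  rw [← reassoc_of% h, MonoidalCategory.tensorHom_def (λ_ H).hom, Category.assoc, ← comp_whiskerRight_assoc,
    ← comp_whiskerRight_assoc]
  simp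

theorem diagAct_rightUnitor {M : C} (a : H ⊗ M ⟶ M) :
    diagAct a (ε[H] ▷ 𝟙_ C ≫ (λ_ (𝟙_ C)).hom) ≫ (ρ_ M).hom = H ◁ (ρ_ M).hom ≫ a := by
  have h := rightUnitor_monoidal H M
  have e : (a ⊗ₘ (ε[H] ▷ 𝟙_ C ≫ (λ_ (𝟙_ C)).hom)) =
      (𝟙 H ▷ M ⊗ₘ ε[H] ▷ 𝟙_ C) ≫ (H ⊗ M) ◁ (λ_ (𝟙_ C)).hom ≫ a ▷ 𝟙_ C := by
    simp only [← tensorHom_id, ← id_tensorHom, tensorHom_comp_tensorHom, Category.id_comp,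
      Category.comp_id, id_tensorHom_id]
  rw [diagAct, e, ← tensorμ_natural_left_assoc]
  simp only [Category.assoc, rightUnitor_naturality]
  rw [← reassoc_of% h, MonoidalCategory.tensorHom_def (ρ_ H).hom, Category.assoc, ← comp_whiskerRight_assoc,
    ← comp_whiskerRight_assoc]
  simp

instance : MonoidalCategoryStruct (Mod C H) where
  tensorObj := diagMod
  tensorUnit := trivMod (𝟙_ C)
  whiskerLeft M _ _ f := mkHom (M.X ◁ f.hom) (by
    have := diagAct_natural (𝟙 M) f
    simp only [Mod.id_hom', id_tensorHom] at this
    exact this)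
  whiskerRight f N := mkHom (f.hom ▷ N.X) (by
    have := diagAct_natural f (𝟙 N)
    simp only [Mod.id_hom', tensorHom_id] at this
    exact this)
  tensorHom f g := mkHom (f.hom ⊗ₘ g.hom) (diagAct_natural f g)
  associator L M N := mkIso (α_ L.X M.X N.X) (diagAct_assoc (act L) (act M) (act N))
  leftUnitor M := mkIso (λ_ M.X) (diagAct_leftUnitor (act M))
  rightUnitor M := mkIso (ρ_ M.X) (diagAct_rightUnitor (act M))

instance : MonoidalCategory (Mod C H) where
  tensorHom_def f g := Mod.hom_ext _ _ (tensorHom_def f.hom g.hom)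
  id_tensorHom_id M N := Mod.hom_ext _ _ (id_tensorHom_id M.X N.X)
  tensorHom_comp_tensorHom f₁ f₂ g₁ g₂ :=
    Mod.hom_ext _ _ (tensorHom_comp_tensorHom f₁.hom f₂.hom g₁.hom g₂.hom)
  whiskerLeft_id M N := Mod.hom_ext _ _ (whiskerLeft_id M.X N.X)
  id_whiskerRight M N := Mod.hom_ext _ _ (id_whiskerRight M.X N.X)
  associator_naturality f g h := Mod.hom_ext _ _ (associator_naturality f.hom g.hom h.hom)
  leftUnitor_naturality f := Mod.hom_ext _ _ (leftUnitor_naturality f.hom)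
  rightUnitor_naturality f := Mod.hom_ext _ _ (rightUnitor_naturality f.hom)
  pentagon K L M N := Mod.hom_ext _ _ (pentagon K.X L.X M.X N.X)
  triangle M N := Mod.hom_ext _ _ (triangle M.X N.X)

variable (H) in
/-- The braiding of `C` is `H`-linear: for all left `H`-modules `M` and `N` the braiding
`M ⊗ N ⟶ N ⊗ M` commutes with the diagonal `H`-actions. -/
class HLinearBraiding : Prop where
  linear (M N : Mod C H) :
    diagAct (act M) (act N) ≫ (β_ M.X N.X).hom = H ◁ (β_ M.X N.X).hom ≫ diagAct (act N) (act M)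

instance [HLinearBraiding H] : BraidedCategory (Mod C H) where
  braiding M N := mkIso (β_ M.X N.X) (HLinearBraiding.linear M N)
  braiding_naturality_right M _ _ f :=
    Mod.hom_ext _ _ (BraidedCategory.braiding_naturality_right M.X f.hom)
  braiding_naturality_left f N :=
    Mod.hom_ext _ _ (BraidedCategory.braiding_naturality_left f.hom N.X)
  hexagon_forward L M N := Mod.hom_ext _ _ (BraidedCategory.hexagon_forward L.X M.X N.X)
  hexagon_reverse L M N := Mod.hom_ext _ _ (BraidedCategory.hexagon_reverse L.X M.X N.X)

end Modules

/-! ### Consequences of the `H`-linearity of the braiding -/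

section Linear

variable {H : C} [BimonObj H]

theorem diagAct_triv_right {M : C} (a : H ⊗ M ⟶ M) (X : C) :
    diagAct a (ε[H] ▷ X ≫ (λ_ X).hom) = (α_ H M X).inv ≫ a ▷ X := by
  have e : (a ⊗ₘ (ε[H] ▷ X ≫ (λ_ X).hom)) =
      (𝟙 H ▷ M ⊗ₘ ε[H] ▷ X) ≫ (a ⊗ₘ (λ_ X).hom) := by
    simp only [← tensorHom_id, tensorHom_comp_tensorHom, Category.id_comp,
      id_tensorHom_id]
  rw [diagAct, e, ← tensorμ_natural_left_assoc, ← comp_whiskerRight_assoc, id_tensorHom,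
    ComonObj.comul_counit]
  simp only [tensorμ, MonoidalCategory.tensorHom_def']
  simp [← whiskerLeft_comp_assoc, -whiskerLeft_comp]

theorem diagAct_triv_left {N : C} (b : H ⊗ N ⟶ N) (X : C) :
    diagAct (ε[H] ▷ X ≫ (λ_ X).hom) b =
      (α_ H X N).inv ≫ (β_ H X).hom ▷ N ≫ (α_ X H N).hom ≫ X ◁ b := by
  have e : ((ε[H] ▷ X ≫ (λ_ X).hom) ⊗ₘ b) =
      (ε[H] ▷ X ⊗ₘ 𝟙 H ▷ N) ≫ ((λ_ X).hom ⊗ₘ b) := by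
    simp only [← tensorHom_id, tensorHom_comp_tensorHom, Category.id_comp,
      id_tensorHom_id]
  rw [diagAct, e, ← tensorμ_natural_left_assoc, ← comp_whiskerRight_assoc, tensorHom_id,
    ComonObj.counit_comul]
  simp [tensorμ, MonoidalCategory.tensorHom_def]

variable [HLinearBraiding H]

/-- The braidings with `H` are inverse to each other. -/
theorem braiding_symm (X : C) : (β_ H X).hom ≫ (β_ X H).hom = 𝟙 (H ⊗ X) := by
  have h := HLinearBraiding.linear (trivMod (H := H) X) (Mod.regular H)
  change diagAct (ε[H] ▷ X ≫ (λ_ X).hom) μ[H] ≫ (β_ X H).hom =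
    H ◁ (β_ X H).hom ≫ diagAct μ[H] (ε[H] ▷ X ≫ (λ_ X).hom) at h
  rw [diagAct_triv_left, diagAct_triv_right] at h
  have hl : H ◁ ((ρ_ X).inv ≫ X ◁ η[H]) ≫
      (α_ H X H).inv ≫ (β_ H X).hom ▷ H ≫ (α_ X H H).hom ≫ X ◁ μ[H] = (β_ H X).hom := by
    rw [whiskerLeft_comp, Category.assoc, associator_inv_naturality_right_assoc,
      whisker_exchange_assoc, associator_naturality_right_assoc, ← whiskerLeft_comp,
      MonObj.mul_one]
    simp
  have hr : H ◁ ((ρ_ X).inv ≫ X ◁ η[H]) ≫ H ◁ (β_ X H).hom ≫ (α_ H H X).inv ≫ μ[H] ▷ X =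
      𝟙 (H ⊗ X) := by
    rw [← whiskerLeft_comp_assoc, Category.assoc, BraidedCategory.braiding_naturality_right,
      rightUnitor_inv_braiding_assoc, whiskerLeft_comp, Category.assoc,
      associator_inv_naturality_middle_assoc, ← comp_whiskerRight, MonObj.mul_one]
    simp
  have h' := congrArg (fun t => H ◁ ((ρ_ X).inv ≫ X ◁ η[H]) ≫ t) h
  beta_reduce at h'
  rw [hr, ← Category.assoc, hl] at h'
  exact h'

theorem cocomm : Δ[H] ≫ (β_ H H).hom = Δ[H] := by
  have h := HLinearBraiding.linear (Mod.regular H) (Mod.regular H)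
  change (Δ[H] ▷ (H ⊗ H) ≫ μ[H ⊗ H]) ≫ (β_ H H).hom =
    H ◁ (β_ H H).hom ≫ Δ[H] ▷ (H ⊗ H) ≫ μ[H ⊗ H] at h
  have e : H ◁ η[H ⊗ H] ≫ Δ[H] ▷ (H ⊗ H) ≫ μ[H ⊗ H] = (ρ_ H).hom ≫ Δ[H] := by
    rw [whisker_exchange_assoc, MonObj.mul_one, rightUnitor_naturality]
  have h' := congrArg (fun t => H ◁ η[H ⊗ H] ≫ t) h
  simp only [← Category.assoc] at h' e
  rw [e, ← whiskerLeft_comp, MonObj.one_braiding, e] at h'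
  simpa using h'

end Linear

/-! ### Flat objects -/

/-- An object is flat if tensoring with it preserves equalizers. -/
class IsFlat (X : C) : Prop where
  preserves : PreservesLimitsOfShape WalkingParallelPair (tensorLeft X)

/-- An object is faithfully flat if tensoring with it preserves and reflects equalizers. -/
class IsFaithfullyFlat (X : C) : Prop extends IsFlat X where
  reflects : ReflectsLimitsOfShape WalkingParallelPair (tensorLeft X)

theorem IsFlat.preserves_right (X : C) [IsFlat X] :
    PreservesLimitsOfShape WalkingParallelPair (tensorRight X) :=
  haveI := IsFlat.preserves (X := X)
  preservesLimitsOfShape_of_natIso (BraidedCategory.tensorLeftIsoTensorRight X)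

section Flat

variable [HasEqualizers C] {H : C} [IsFlat H]

/-- Tensoring with the flat object `H` preserves equalizers. -/
noncomputable def equalizerTensor {M N : C} (f g : M ⟶ N) :
    IsLimit (Fork.ofι (f := f ▷ H) (g := g ▷ H) (equalizer.ι f g ▷ H)
      (by rw [← comp_whiskerRight, equalizer.condition, comp_whiskerRight])) :=
  haveI := IsFlat.preserves_right H
  isLimitForkMapOfIsLimit (tensorRight H) (equalizer.condition f g) (equalizerIsEqualizer f g)

theorem mono_tensor {M N : C} (f g : M ⟶ N) : Mono (equalizer.ι f g ▷ H) :=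
  mono_of_isLimit_fork (equalizerTensor f g)

theorem mono_tensor_tensor {M N : C} (f g : M ⟶ N) : Mono (equalizer.ι f g ▷ H ▷ H) :=
  haveI := IsFlat.preserves_right H
  mono_of_isLimit_fork (isLimitForkMapOfIsLimit (tensorRight H) _ (equalizerTensor (H := H) f g))

end Flat

/-! ### Comodule algebras and Galois objects -/

section ComodAlg

/-- A right `H`-comodule algebra: an algebra with a right `H`-coaction that is an algebra
morphism. -/
structure ComodAlg (H : C) [BimonObj H] where
  /-- The underlying object. -/
  X : C
  [mon : MonObj X]
  /-- The coaction. -/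
  coact : X ⟶ X ⊗ H
  coact_counit : coact ≫ X ◁ ε[H] = (ρ_ X).inv
  coact_coassoc : coact ≫ X ◁ Δ[H] = coact ≫ coact ▷ H ≫ (α_ X H H).hom
  [isMonHom : IsMonHom coact]

attribute [instance] ComodAlg.mon ComodAlg.isMonHom

variable {H : C} [BimonObj H]

/-- A morphism of right `H`-comodule algebras. -/
@[ext]
structure ComodAlg.Hom (S T : ComodAlg H) where
  /-- The underlying morphism. -/
  hom : S.X ⟶ T.X
  [isMonHom : IsMonHom hom]
  colinear : S.coact ≫ hom ▷ H = hom ≫ T.coact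

attribute [instance] ComodAlg.Hom.isMonHom

instance : Category (ComodAlg H) where
  Hom := ComodAlg.Hom
  id S := { hom := 𝟙 S.X, colinear := by simp }
  comp f g :=
    { hom := f.hom ≫ g.hom
      colinear := by
        rw [comp_whiskerRight, ← Category.assoc, f.colinear, Category.assoc, g.colinear,
          Category.assoc] }
  id_comp f := by apply ComodAlg.Hom.ext; exact Category.id_comp f.hom
  comp_id f := by apply ComodAlg.Hom.ext; exact Category.comp_id f.hom
  assoc f g h := by apply ComodAlg.Hom.ext; exact Category.assoc f.hom g.hom h.hom

/-- The canonical morphism `T ⊗ T ⟶ T ⊗ H`, `x ⊗ y ↦ x y₀ ⊗ y₁`. -/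
def ComodAlg.can (T : ComodAlg H) : T.X ⊗ T.X ⟶ T.X ⊗ H :=
  T.X ◁ T.coact ≫ (α_ T.X T.X H).inv ≫ μ[T.X] ▷ H

/-- An `H`-Galois object is a faithfully flat right `H`-comodule algebra whose canonical morphism
is an isomorphism. -/
structure IsGaloisObj (T : ComodAlg H) : Prop where
  faithfullyFlat : IsFaithfullyFlat T.X
  isIso_can : IsIso T.can

section Sub

/-- The comodule algebra structure on a subobject `j : E ⟶ M` of a comodule algebra `M` to which
the unit, the multiplication and the coaction restrict. -/
@[reducible]
def ComodAlg.ofMono (M : ComodAlg H) {E : C} (j : E ⟶ M.X) [Mono j] [Mono (j ▷ H)]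
    [Mono (j ▷ H ▷ H)] (one : 𝟙_ C ⟶ E) (mul : E ⊗ E ⟶ E) (ρ : E ⟶ E ⊗ H)
    (h₁ : one ≫ j = η[M.X]) (h₂ : mul ≫ j = (j ⊗ₘ j) ≫ μ[M.X])
    (h₃ : ρ ≫ j ▷ H = j ≫ M.coact) : ComodAlg H :=
  letI mon : MonObj E :=
    { one := one
      mul := mul
      one_mul := by
        rw [← cancel_mono j, Category.assoc, h₂, MonoidalCategory.tensorHom_def',
          Category.assoc, whisker_exchange_assoc, ← comp_whiskerRight_assoc, h₁,
          ← whisker_exchange_assoc, MonObj.one_mul, leftUnitor_naturality]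
      mul_one := by
        rw [← cancel_mono j, Category.assoc, h₂, MonoidalCategory.tensorHom_def,
          Category.assoc, ← whisker_exchange_assoc, ← whiskerLeft_comp_assoc, h₁,
          whisker_exchange_assoc, MonObj.mul_one, rightUnitor_naturality]
      mul_assoc := by
        rw [← cancel_mono j]
        have e₁ : mul ▷ E ≫ (j ⊗ₘ j) = ((j ⊗ₘ j) ⊗ₘ j) ≫ μ[M.X] ▷ M.X := by
          simp only [← tensorHom_id, tensorHom_comp_tensorHom, h₂, Category.id_comp,
            Category.comp_id]
        have e₂ : E ◁ mul ≫ (j ⊗ₘ j) = (j ⊗ₘ (j ⊗ₘ j)) ≫ M.X ◁ μ[M.X] := by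
          simp only [← id_tensorHom, tensorHom_comp_tensorHom, h₂, Category.id_comp,
            Category.comp_id]
        simp only [Category.assoc, h₂]
        rw [reassoc_of% e₁, reassoc_of% e₂, MonObj.mul_assoc, associator_naturality_assoc] }
  haveI hj : IsMonHom j := ⟨h₁, h₂⟩
  { X := E
    coact := ρ
    coact_counit := by
      rw [← cancel_mono (ρ_ E).hom, ← cancel_mono j]
      have h := M.coact_counit
      rw [← cancel_mono (ρ_ M.X).hom, Iso.inv_hom_id] at h
      simp only [Category.assoc, Iso.inv_hom_id, Category.id_comp] at h ⊢
      rw [← rightUnitor_naturality, whisker_exchange_assoc, reassoc_of% h₃, h, Category.comp_id]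
    coact_coassoc := by
      rw [← cancel_mono (α_ E H H).inv, ← cancel_mono (j ▷ H ▷ H)]
      have h := M.coact_coassoc
      rw [← cancel_mono (α_ M.X H H).inv] at h
      simp only [Category.assoc, Iso.hom_inv_id, Category.comp_id] at h ⊢
      rw [← associator_inv_naturality_left, whisker_exchange_assoc, reassoc_of% h₃, h,
        ← comp_whiskerRight, h₃, comp_whiskerRight, reassoc_of% h₃]
    isMonHom :=
      { one_hom := by
          rw [← cancel_mono (j ▷ H), Category.assoc, h₃, IsMonHom.one_hom,
            IsMonHom.one_hom]
        mul_hom := by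
          rw [← cancel_mono (j ▷ H), Category.assoc, Category.assoc, h₃, IsMonHom.mul_hom (j ▷ H),
            ← Category.assoc, IsMonHom.mul_hom, Category.assoc, IsMonHom.mul_hom,
            tensorHom_comp_tensorHom_assoc, tensorHom_comp_tensorHom_assoc, h₃] } }

variable [HasEqualizers C] [IsFlat H]

/-- The equalizer of two morphisms out of a comodule algebra `M`, as a comodule subalgebra of `M`,
provided that it contains the unit and is closed under the multiplication and the coaction. -/
noncomputable def subComodAlg (M : ComodAlg H) {N : C} (f g : M.X ⟶ N)
    (h₁ : η[M.X] ≫ f = η[M.X] ≫ g)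
    (h₂ : (equalizer.ι f g ⊗ₘ equalizer.ι f g) ≫ μ[M.X] ≫ f =
      (equalizer.ι f g ⊗ₘ equalizer.ι f g) ≫ μ[M.X] ≫ g)
    (h₃ : equalizer.ι f g ≫ M.coact ≫ f ▷ H = equalizer.ι f g ≫ M.coact ≫ g ▷ H) :
    ComodAlg H :=
  haveI := mono_tensor (H := H) f g
  haveI := mono_tensor_tensor (H := H) f g
  M.ofMono (equalizer.ι f g) (equalizer.lift η[M.X] h₁)
    (equalizer.lift ((equalizer.ι f g ⊗ₘ equalizer.ι f g) ≫ μ[M.X]) (by simpa using h₂))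
    (Fork.IsLimit.lift (equalizerTensor f g) (equalizer.ι f g ≫ M.coact) (by simpa using h₃))
    (equalizer.lift_ι _ _) (equalizer.lift_ι _ _) (Fork.IsLimit.lift_ι' _ _ _)

end Sub

end ComodAlg

/-! ### The smash product -/

section Smash

variable {H : C} [BimonObj H]

/-- The underlying algebra in `C` of an `H`-module algebra, that is, of an algebra in the monoidal
category of left `H`-modules. -/
instance underlyingMon (A : Mod C H) [MonObj A] : MonObj A.X where
  one := η[A].hom
  mul := μ[A].hom
  one_mul := congrArg Mod.Hom.hom (MonObj.one_mul A)
  mul_one := congrArg Mod.Hom.hom (MonObj.mul_one A)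
  mul_assoc := congrArg Mod.Hom.hom (MonObj.mul_assoc A)

variable (A : Mod C H) [MonObj A]

/-- The diagonal action of `H` on `A ⊗ H`, `h ⊗ (b ⊗ k) ↦ h₁ b ⊗ h₂ k`. -/
def smashAct : H ⊗ (A.X ⊗ H) ⟶ A.X ⊗ H := diagAct (act A) μ[H]

/-- Left multiplication of `A` on `A ⊗ H`. -/
def smashLeft : A.X ⊗ (A.X ⊗ H) ⟶ A.X ⊗ H := (α_ A.X A.X H).inv ≫ μ[A.X] ▷ H

/-- The multiplication of the smash product, `(a # h)(b # k) = a (h₁ b) # h₂ k`. -/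
def smashMul : (A.X ⊗ H) ⊗ (A.X ⊗ H) ⟶ A.X ⊗ H :=
  (α_ A.X H (A.X ⊗ H)).hom ≫ A.X ◁ smashAct A ≫ smashLeft A

/-- The unit of the smash product, `1 # 1`. -/
def smashOne : 𝟙_ C ⟶ A.X ⊗ H := (λ_ (𝟙_ C)).inv ≫ (η[A.X] ⊗ₘ η[H])

theorem smashAct_left :
    H ◁ smashLeft A ≫ smashAct A = diagAct (act A) (smashAct A) ≫ smashLeft A :=
  (act_hom ((α_ A A (Mod.regular H)).inv ≫ μ[A] ▷ Mod.regular H)).symm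

theorem smashAct_unit :
    H ◁ ((λ_ H).inv ≫ η[A.X] ▷ H) ≫ smashAct A = μ[H] ≫ (λ_ H).inv ≫ η[A.X] ▷ H :=
  (act_hom ((λ_ (Mod.regular H)).inv ≫ η[A] ▷ Mod.regular H)).symm

theorem smashAct_one : η[H] ▷ (A.X ⊗ H) ≫ smashAct A = (λ_ (A.X ⊗ H)).hom :=
  one_act (A ⊗ Mod.regular H)

theorem smashAct_mul : μ[H] ▷ (A.X ⊗ H) ≫ smashAct A =
    (α_ H H (A.X ⊗ H)).hom ≫ H ◁ smashAct A ≫ smashAct A :=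
  mul_act (A ⊗ Mod.regular H)

theorem smashLeft_assoc : μ[A.X] ▷ (A.X ⊗ H) ≫ smashLeft A =
    (α_ A.X A.X (A.X ⊗ H)).hom ≫ A.X ◁ smashLeft A ≫ smashLeft A := by
  have h : (μ[A.X] ▷ A.X ≫ μ[A.X]) ▷ H =
      ((α_ A.X A.X A.X).hom ≫ A.X ◁ μ[A.X] ≫ μ[A.X]) ▷ H := by rw [MonObj.mul_assoc]
  simp only [comp_whiskerRight] at h
  rw [smashLeft, associator_inv_naturality_left_assoc, h]
  monoidal

theorem smashLeft_mul : smashLeft A ▷ (A.X ⊗ H) ≫ smashMul A =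
    (α_ A.X (A.X ⊗ H) (A.X ⊗ H)).hom ≫ A.X ◁ smashMul A ≫ smashLeft A := by
  rw [smashMul]
  nth_rw 1 [smashLeft]
  rw [comp_whiskerRight, Category.assoc, associator_naturality_left_assoc,
    ← whisker_exchange_assoc, smashLeft_assoc]
  generalize smashAct A = d
  generalize smashLeft A = l
  monoidal

theorem smashAct_smashMul : smashAct A ▷ (A.X ⊗ H) ≫ smashMul A =
    (α_ H (A.X ⊗ H) (A.X ⊗ H)).hom ≫ H ◁ smashMul A ≫ smashAct A := by
  have e₁ : H ◁ (A.X ◁ smashAct A) ≫ diagAct (act A) (smashAct A) =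
      Δ[H] ▷ (A.X ⊗ H ⊗ A.X ⊗ H) ≫ tensorμ H H A.X (H ⊗ A.X ⊗ H) ≫
        (H ⊗ A.X) ◁ ((α_ H H (A.X ⊗ H)).inv ≫ μ[H] ▷ (A.X ⊗ H) ≫ smashAct A) ≫
          act A ▷ (A.X ⊗ H) := by
    rw [smashAct_mul, Iso.inv_hom_id_assoc, diagAct, whisker_exchange_assoc, ← id_tensorHom A.X,
      tensorμ_natural_right_assoc]
    simp only [← tensorHom_id, ← id_tensorHom, tensorHom_comp_tensorHom, Category.id_comp,
      Category.comp_id, id_tensorHom_id]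
  have e₂ : smashAct A = Δ[H] ▷ (A.X ⊗ H) ≫ tensorμ H H A.X H ≫ (H ⊗ A.X) ◁ μ[H] ≫
      act A ▷ H := by
    simp only [smashAct, diagAct, ← tensorHom_id, ← id_tensorHom, tensorHom_comp_tensorHom,
      Category.id_comp, Category.comp_id]
  have e₃ : (tensorμ H H A.X H) ▷ (A.X ⊗ H) ≫ (α_ (H ⊗ A.X) (H ⊗ H) (A.X ⊗ H)).hom =
      (α_ (H ⊗ H) (A.X ⊗ H) (A.X ⊗ H)).hom ≫ (H ⊗ H) ◁ (α_ A.X H (A.X ⊗ H)).hom ≫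
        tensorμ H H A.X (H ⊗ A.X ⊗ H) ≫ (H ⊗ A.X) ◁ (α_ H H (A.X ⊗ H)).inv := by
    simp only [tensorμ]
    monoidal
  have e₄ : smashAct A ▷ (A.X ⊗ H) ≫ (α_ A.X H (A.X ⊗ H)).hom ≫ A.X ◁ smashAct A =
      (α_ H (A.X ⊗ H) (A.X ⊗ H)).hom ≫ H ◁ (α_ A.X H (A.X ⊗ H)).hom ≫
        H ◁ (A.X ◁ smashAct A) ≫ diagAct (act A) (smashAct A) := by
    rw [e₁]
    nth_rw 1 [e₂]
    simp only [comp_whiskerRight, Category.assoc, whiskerLeft_comp]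
    rw [whisker_exchange_assoc, ← associator_naturality_left_assoc, ← reassoc_of% e₃,
      associator_naturality_left_assoc, ← whisker_exchange, associator_naturality_middle_assoc]
  rw [smashMul]
  simp only [whiskerLeft_comp, Category.assoc]
  rw [smashAct_left, reassoc_of% e₄]

/-- The smash product algebra `A # H`, with underlying object `A ⊗ H`. -/
@[reducible]
def smashMon : MonObj (A.X ⊗ H) where
  one := smashOne A
  mul := smashMul A
  one_mul := by
    have e : smashOne A = η[A.X] ≫ (ρ_ A.X).inv ≫ A.X ◁ η[H] := by
      simp [smashOne, MonoidalCategory.tensorHom_def, unitors_inv_equal]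
    rw [e, smashMul]
    simp only [comp_whiskerRight, Category.assoc]
    rw [associator_naturality_middle_assoc, ← whiskerLeft_comp_assoc, smashAct_one, smashLeft]
    have h : (η[A.X] ▷ A.X ≫ μ[A.X]) ▷ H = (λ_ A.X).hom ▷ H := by rw [MonObj.one_mul]
    rw [comp_whiskerRight] at h
    have h' : (ρ_ A.X).inv ▷ (A.X ⊗ H) ≫ (α_ A.X (𝟙_ C) (A.X ⊗ H)).hom ≫
      A.X ◁ (λ_ (A.X ⊗ H)).hom = 𝟙 _ := by monoidal
    rw [reassoc_of% h', associator_inv_naturality_left_assoc, h]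
    monoidal
  mul_one := by
    have e : smashOne A = η[H] ≫ (λ_ H).inv ≫ η[A.X] ▷ H := by
      simp [smashOne, MonoidalCategory.tensorHom_def']
    have h := congrArg (fun t => H ◁ η[H] ≫ t) (smashAct_unit A)
    simp only [MonObj.mul_one_assoc] at h
    rw [e, smashMul, associator_naturality_right_assoc, ← whiskerLeft_comp_assoc,
      whiskerLeft_comp H η[H], Category.assoc, h, smashLeft]
    have h' : (A.X ◁ η[A.X] ≫ μ[A.X]) ▷ H = (ρ_ A.X).hom ▷ H := by rw [MonObj.mul_one]
    rw [comp_whiskerRight] at h'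
    simp only [whiskerLeft_comp, Category.assoc]
    rw [associator_inv_naturality_middle_assoc, h']
    monoidal
  mul_assoc := by
    have e₁ : smashMul A ▷ (A.X ⊗ H) = (α_ A.X H (A.X ⊗ H)).hom ▷ (A.X ⊗ H) ≫
        (A.X ◁ smashAct A) ▷ (A.X ⊗ H) ≫ smashLeft A ▷ (A.X ⊗ H) := by
      rw [smashMul, comp_whiskerRight, comp_whiskerRight]
    have e₂ : (A.X ⊗ H) ◁ smashMul A ≫ smashMul A =
        (α_ A.X H _).hom ≫ A.X ◁ (H ◁ smashMul A) ≫ A.X ◁ smashAct A ≫ smashLeft A := by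
      rw [← associator_naturality_right_assoc, ← smashMul]
    have h := congrArg (fun t => A.X ◁ t ≫ smashLeft A) (smashAct_smashMul A)
    simp only [whiskerLeft_comp, Category.assoc] at h
    rw [e₁, e₂, Category.assoc, Category.assoc, smashLeft_mul, associator_naturality_middle_assoc,
      h, pentagon_assoc]

/-- The coaction `A ⊗ Δ` on the smash product. -/
def smashCoact : A.X ⊗ H ⟶ (A.X ⊗ H) ⊗ H := A.X ◁ Δ[H] ≫ (α_ A.X H H).inv

/-- The comultiplication as a morphism of left `H`-modules. -/
def comulHom : Mod.regular H ⟶ Mod.regular H ⊗ Mod.regular H :=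
  mkHom (M := Mod.regular H) (N := Mod.regular H ⊗ Mod.regular H) Δ[H] (by
    change μ[H] ≫ Δ[H] = H ◁ Δ[H] ≫ Δ[H] ▷ (H ⊗ H) ≫ tensorμ H H H H ≫ (μ[H] ⊗ₘ μ[H])
    rw [BimonObj.mul_comul, MonoidalCategory.tensorHom_def' Δ[H] Δ[H], Category.assoc])

theorem smashAct_coact :
    smashAct A ≫ smashCoact A = H ◁ smashCoact A ≫ diagAct (smashAct A) μ[H] :=
  act_hom (A ◁ comulHom ≫ (α_ A (Mod.regular H) (Mod.regular H)).inv)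

theorem smashLeft_coact : smashLeft A ≫ smashCoact A =
    A.X ◁ smashCoact A ≫ (α_ A.X (A.X ⊗ H) H).inv ≫ smashLeft A ▷ H := by
  rw [smashLeft, smashCoact, Category.assoc, ← whisker_exchange_assoc]
  monoidal

theorem smashMul_coact : smashMul A ≫ smashCoact A =
    (smashCoact A ⊗ₘ smashCoact A) ≫ tensorμ (A.X ⊗ H) H (A.X ⊗ H) H ≫
      (smashMul A ⊗ₘ μ[H]) := by
  have e₁ : (α_ A.X (H ⊗ H) ((A.X ⊗ H) ⊗ H)).hom ≫ A.X ◁ tensorμ H H (A.X ⊗ H) H ≫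
      (α_ A.X (H ⊗ A.X ⊗ H) (H ⊗ H)).inv =
      (α_ A.X H H).inv ▷ ((A.X ⊗ H) ⊗ H) ≫ tensorμ (A.X ⊗ H) H (A.X ⊗ H) H ≫
        (α_ A.X H (A.X ⊗ H)).hom ▷ (H ⊗ H) := by
    simp only [tensorμ]
    monoidal
  have e₂ : (smashMul A ⊗ₘ μ[H]) = (α_ A.X H (A.X ⊗ H)).hom ▷ (H ⊗ H) ≫
      (A.X ◁ smashAct A ⊗ₘ μ[H]) ≫ smashLeft A ▷ H := by
    simp only [smashMul, ← tensorHom_id, tensorHom_comp_tensorHom, Category.id_comp,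
      Category.comp_id]
  have e₃ : A.X ◁ (smashAct A ⊗ₘ μ[H]) ≫ (α_ A.X (A.X ⊗ H) H).inv =
      (α_ A.X (H ⊗ A.X ⊗ H) (H ⊗ H)).inv ≫ (A.X ◁ smashAct A ⊗ₘ μ[H]) := by
    rw [← id_tensorHom, associator_inv_naturality, id_tensorHom]
  have e₄ : smashMul A ≫ smashCoact A = (A.X ⊗ H) ◁ smashCoact A ≫
      (α_ A.X H ((A.X ⊗ H) ⊗ H)).hom ≫ A.X ◁ diagAct (smashAct A) μ[H] ≫
        (α_ A.X (A.X ⊗ H) H).inv ≫ smashLeft A ▷ H := by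
    rw [smashMul, Category.assoc, Category.assoc, smashLeft_coact, ← whiskerLeft_comp_assoc,
      smashAct_coact, whiskerLeft_comp, Category.assoc, associator_naturality_right_assoc]
  rw [e₄, e₂, MonoidalCategory.tensorHom_def' (smashCoact A), Category.assoc, diagAct]
  have e₅ : smashCoact A ▷ ((A.X ⊗ H) ⊗ H) =
      (A.X ◁ Δ[H]) ▷ ((A.X ⊗ H) ⊗ H) ≫ (α_ A.X H H).inv ▷ ((A.X ⊗ H) ⊗ H) := by
    rw [smashCoact, comp_whiskerRight]
  rw [e₅]
  simp only [whiskerLeft_comp, comp_whiskerRight, Category.assoc]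
  rw [reassoc_of% e₃, ← reassoc_of% e₁, associator_naturality_middle_assoc]

/-- The smash product `A # H` as a right `H`-comodule algebra, with coaction `A ⊗ Δ`. -/
def smash : ComodAlg H where
  X := A.X ⊗ H
  mon := smashMon A
  coact := smashCoact A
  coact_counit := by
    rw [smashCoact, Category.assoc, ← associator_inv_naturality_right, ← whiskerLeft_comp_assoc,
      ComonObj.comul_counit]
    monoidal
  coact_coassoc := by
    have h := congrArg (fun t => A.X ◁ t) (ComonObj.comul_assoc H)
    simp only [whiskerLeft_comp] at h
    rw [smashCoact, Category.assoc, ← associator_inv_naturality_right, reassoc_of% h,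
      comp_whiskerRight]
    monoidal
  isMonHom :=
    letI := smashMon A
    { one_hom := by
        change smashOne A ≫ smashCoact A = (λ_ (𝟙_ C)).inv ≫ (smashOne A ⊗ₘ η[H])
        have h : η[H] ≫ Δ[H] = (λ_ (𝟙_ C)).inv ≫ (η[H] ⊗ₘ η[H]) := BimonObj.one_comul H
        have e : (η[A.X] ⊗ₘ η[H]) ≫ A.X ◁ Δ[H] =
            𝟙_ C ◁ (λ_ (𝟙_ C)).inv ≫ (η[A.X] ⊗ₘ (η[H] ⊗ₘ η[H])) := by
          simp only [← id_tensorHom, tensorHom_comp_tensorHom, h, Category.id_comp,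
            Category.comp_id]
        have e' : (smashOne A ⊗ₘ η[H]) =
            (λ_ (𝟙_ C)).inv ▷ 𝟙_ C ≫ ((η[A.X] ⊗ₘ η[H]) ⊗ₘ η[H]) := by
          simp only [smashOne, ← tensorHom_id, tensorHom_comp_tensorHom, Category.id_comp]
        rw [e', smashOne, smashCoact, Category.assoc, reassoc_of% e, associator_inv_naturality]
        monoidal
      mul_hom := by
        exact smashMul_coact A }

/-- The embedding `a ↦ a # 1` of `A` into the smash product. -/
def smashIncl : A.X ⟶ (smash A).X := (ρ_ A.X).inv ≫ A.X ◁ η[H]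

theorem smashIncl_coact :
    smashIncl A ≫ (smash A).coact = (ρ_ A.X).inv ≫ (smashIncl A ⊗ₘ η[H]) := by
  change ((ρ_ A.X).inv ≫ A.X ◁ η[H]) ≫ A.X ◁ Δ[H] ≫ (α_ A.X H H).inv =
    (ρ_ A.X).inv ≫ (((ρ_ A.X).inv ≫ A.X ◁ η[H]) ⊗ₘ η[H])
  have h : η[H] ≫ Δ[H] = (λ_ (𝟙_ C)).inv ≫ (η[H] ⊗ₘ η[H]) := BimonObj.one_comul H
  rw [Category.assoc, ← whiskerLeft_comp_assoc, h]
  simp only [MonoidalCategory.tensorHom_def]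
  monoidal

end Smash

/-! ### Invariants -/

section Invariants

/-- An object `X` is finite if `X ⊗ -` has the right adjoint `P ⊗ -` for some object `P`,
that is, if `X` has a dual object `P`. -/
def IsFinite (X : C) : Prop := ∃ P : C, Nonempty (ExactPairing P X)

theorem IsFinite.tensor {X Y : C} (hX : IsFinite X) (hY : IsFinite Y) : IsFinite (X ⊗ Y) := by
  obtain ⟨P, ⟨p⟩⟩ := hX
  obtain ⟨Q, ⟨q⟩⟩ := hY
  exact ⟨Q ⊗ P, ⟨inferInstance⟩⟩

section Commutant

variable {M : C} [MonObj M] {A : C} (i : A ⟶ M)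

/-- Left multiplication by `A` through `i : A ⟶ M`. -/
def leftMul : A ⊗ M ⟶ M := i ▷ M ≫ μ[M]

/-- Right multiplication by `A` through `i : A ⟶ M`, preceded by the braiding. -/
def rightMul : A ⊗ M ⟶ M := (β_ A M).hom ≫ M ◁ i ≫ μ[M]

theorem one_leftMul : A ◁ η[M] ≫ leftMul i = A ◁ η[M] ≫ rightMul i := by
  have h₁ : A ◁ η[M] ≫ leftMul i = (ρ_ A).hom ≫ i := by
    rw [leftMul, whisker_exchange_assoc, MonObj.mul_one, rightUnitor_naturality]
  have h₂ : A ◁ η[M] ≫ rightMul i = (ρ_ A).hom ≫ i := by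
    rw [rightMul, BraidedCategory.braiding_naturality_right_assoc, ← whisker_exchange_assoc,
      MonObj.one_mul, leftUnitor_naturality, braiding_leftUnitor_assoc]
  rw [h₁, h₂]

theorem mul_leftMul : A ◁ μ[M] ≫ leftMul i = (α_ A M M).inv ≫ leftMul i ▷ M ≫ μ[M] := by
  rw [leftMul, whisker_exchange_assoc, comp_whiskerRight, Category.assoc, MonObj.mul_assoc,
    associator_naturality_left_assoc, Iso.inv_hom_id_assoc]

theorem mul_rightMul : A ◁ μ[M] ≫ rightMul i =
    (α_ A M M).inv ≫ (β_ A M).hom ▷ M ≫ (α_ M A M).hom ≫ M ◁ rightMul i ≫ μ[M] := by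
  have h := MonObj.mul_assoc M
  rw [rightMul, BraidedCategory.braiding_naturality_right_assoc, ← whisker_exchange_assoc,
    MonObj.mul_assoc, associator_naturality_right_assoc, BraidedCategory.braiding_tensor_right_hom]
  simp

theorem rightMul_mul : rightMul i ▷ M ≫ μ[M] =
    (β_ A M).hom ▷ M ≫ (α_ M A M).hom ≫ M ◁ leftMul i ≫ μ[M] := by
  simp [rightMul, leftMul]

theorem leftMul_comm {E : C} (j : E ⟶ M) (h : A ◁ j ≫ leftMul i = A ◁ j ≫ rightMul i) :
    A ◁ ((j ⊗ₘ j) ≫ μ[M]) ≫ leftMul i = A ◁ ((j ⊗ₘ j) ≫ μ[M]) ≫ rightMul i := by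
  rw [whiskerLeft_comp, Category.assoc, Category.assoc, mul_leftMul, mul_rightMul]
  have e₁ : A ◁ (j ⊗ₘ j) ≫ (α_ A M M).inv ≫ leftMul i ▷ M ≫ μ[M] =
      A ◁ (j ⊗ₘ j) ≫ (α_ A M M).inv ≫ rightMul i ▷ M ≫ μ[M] := by
    have e (t : A ⊗ M ⟶ M) : A ◁ (j ⊗ₘ j) ≫ (α_ A M M).inv ≫ t ▷ M ≫ μ[M] =
        (α_ A E E).inv ≫ (A ◁ j ≫ t) ▷ E ≫ M ◁ j ≫ μ[M] := by
      simp only [MonoidalCategory.tensorHom_def', whiskerLeft_comp, comp_whiskerRight,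
        Category.assoc]
      rw [associator_inv_naturality_middle_assoc, associator_inv_naturality_right_assoc,
        whisker_exchange_assoc, whisker_exchange_assoc]
    rw [e, e, h]
  have e₂ : A ◁ (j ⊗ₘ j) ≫ (α_ A M M).inv ≫ (β_ A M).hom ▷ M ≫ (α_ M A M).hom ≫
      M ◁ leftMul i ≫ μ[M] = A ◁ (j ⊗ₘ j) ≫ (α_ A M M).inv ≫ (β_ A M).hom ▷ M ≫
        (α_ M A M).hom ≫ M ◁ rightMul i ≫ μ[M] := by
    have e (t : A ⊗ M ⟶ M) : A ◁ (j ⊗ₘ j) ≫ (α_ A M M).inv ≫ (β_ A M).hom ▷ M ≫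
        (α_ M A M).hom ≫ M ◁ t ≫ μ[M] = (α_ A E E).inv ≫ (β_ A E).hom ▷ E ≫
          (α_ E A E).hom ≫ E ◁ (A ◁ j ≫ t) ≫ j ▷ M ≫ μ[M] := by
      have e' : A ◁ (j ⊗ₘ j) ≫ (α_ A M M).inv ≫ (β_ A M).hom ▷ M ≫ (α_ M A M).hom =
          (α_ A E E).inv ≫ (β_ A E).hom ▷ E ≫ (α_ E A E).hom ≫ E ◁ (A ◁ j) ≫
            j ▷ (A ⊗ M) := by
        simp only [MonoidalCategory.tensorHom_def, whiskerLeft_comp, Category.assoc]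
        rw [associator_inv_naturality_right_assoc, whisker_exchange_assoc,
          associator_naturality_right, associator_inv_naturality_middle_assoc,
          ← comp_whiskerRight_assoc, BraidedCategory.braiding_naturality_right, comp_whiskerRight,
          Category.assoc, associator_naturality_left_assoc, whisker_exchange]
      rw [reassoc_of% e', ← whisker_exchange_assoc, whiskerLeft_comp, Category.assoc]
    rw [e, e, h]
  rw [e₁, rightMul_mul, e₂]

end Commutant

theorem curry_cancel_aux {A P : C} [ExactPairing P A] {M W H X : C} (ev : A ⊗ W ⟶ M)
    (θ : P ⊗ M ⟶ W)
    (hθ : (λ_ W).inv ≫ (η_ P A) ▷ W ≫ (α_ P A W).hom ≫ P ◁ ev ≫ θ = 𝟙 W) (z : X ⟶ W ⊗ H) :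
    (λ_ X).inv ≫ (η_ P A) ▷ X ≫ (α_ P A X).hom ≫
      P ◁ (A ◁ z ≫ (α_ A W H).inv ≫ ev ▷ H) ≫ (α_ P M H).inv ≫ θ ▷ H = z := by
  have h' := congrArg (fun t => t ▷ H) hθ
  simp only [comp_whiskerRight, id_whiskerRight] at h'
  simp only [whiskerLeft_comp, Category.assoc]
  rw [← associator_naturality_right_assoc, ← whisker_exchange_assoc,
    ← leftUnitor_inv_naturality_assoc]
  conv_rhs => rw [← Category.comp_id z, ← h']
  monoidal

theorem curry_cancel [MonoidalClosed C] {A : C} (hA : IsFinite A) {M H X : C}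
    (x y : X ⟶ (ihom A).obj M ⊗ H)
    (h : A ◁ x ≫ (α_ A _ H).inv ≫ (ihom.ev A).app M ▷ H =
      A ◁ y ≫ (α_ A _ H).inv ≫ (ihom.ev A).app M ▷ H) : x = y := by
  obtain ⟨P, ⟨p⟩⟩ := hA
  have hθ : (λ_ _).inv ≫ (η_ P A) ▷ _ ≫ (α_ P A _).hom ≫ P ◁ (ihom.ev A).app M ≫
      MonoidalClosed.curry ((α_ A P M).inv ≫ (ε_ P A) ▷ M ≫ (λ_ M).hom) =
      𝟙 ((ihom A).obj M) := by
    apply MonoidalClosed.uncurry_injective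
    rw [MonoidalClosed.uncurry_natural_left, MonoidalClosed.uncurry_natural_left,
      MonoidalClosed.uncurry_natural_left, MonoidalClosed.uncurry_natural_left,
      MonoidalClosed.uncurry_curry, MonoidalClosed.uncurry_id_eq_ev]
    have gen {W : C} (ev : A ⊗ W ⟶ M) : A ◁ (λ_ W).inv ≫ A ◁ (η_ P A ▷ W) ≫
        A ◁ (α_ P A W).hom ≫ A ◁ (P ◁ ev) ≫ (α_ A P M).inv ≫ (ε_ P A) ▷ M ≫ (λ_ M).hom =
        ev := by
      have e := congrArg (fun t => t ▷ W) (ExactPairing.coevaluation_evaluation P A)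
      simp only [comp_whiskerRight] at e
      rw [associator_inv_naturality_right_assoc, whisker_exchange_assoc, leftUnitor_naturality]
      calc _ = A ◁ (λ_ W).inv ≫ (α_ A (𝟙_ C) W).inv ≫ ((A ◁ η_ P A) ▷ W ≫
            (α_ A P A).inv ▷ W ≫ (ε_ P A ▷ A) ▷ W) ≫ (α_ _ A W).hom ≫ (λ_ _).hom ≫ ev := by
              monoidal
        _ = ev := by
            rw [e]
            monoidal
    exact gen _
  rw [← curry_cancel_aux _ _ hθ x, ← curry_cancel_aux _ _ hθ y]
  exact congrArg (fun t => (λ_ X).inv ≫ (η_ P A) ▷ X ≫ (α_ P A X).hom ≫ P ◁ t ≫ _) h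

section

variable {H : C} [BimonObj H] [HLinearBraiding H]

theorem leftMul_coact (M : ComodAlg H) {A : C} (i : A ⟶ M.X)
    (hi : i ≫ M.coact = (ρ_ A).inv ≫ (i ⊗ₘ η[H])) :
    leftMul i ≫ M.coact = A ◁ M.coact ≫ (α_ A M.X H).inv ≫ leftMul i ▷ H := by
  have e : i ▷ M.X ≫ (M.coact ⊗ₘ M.coact) =
      A ◁ M.coact ≫ (ρ_ A).inv ▷ (M.X ⊗ H) ≫ (i ⊗ₘ η[H]) ▷ (M.X ⊗ H) := by
    rw [← comp_whiskerRight, ← hi, MonoidalCategory.tensorHom_def, comp_whiskerRight,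
      whisker_exchange_assoc, whisker_exchange]
  rw [leftMul, Category.assoc, IsMonHom.mul_hom, reassoc_of% e, MonObj.tensorObj.mul_def,
    tensorμ_natural_left_assoc, tensorHom_comp_tensorHom, MonObj.one_mul]
  simp only [tensorμ, MonoidalCategory.tensorHom_def', braiding_tensorUnit_left]
  monoidal

theorem rightMul_coact (M : ComodAlg H) {A : C} (i : A ⟶ M.X)
    (hi : i ≫ M.coact = (ρ_ A).inv ≫ (i ⊗ₘ η[H])) :
    rightMul i ≫ M.coact = A ◁ M.coact ≫ (α_ A M.X H).inv ≫ rightMul i ▷ H := by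
  have e : (β_ A M.X).hom ≫ M.X ◁ i ≫ (M.coact ⊗ₘ M.coact) =
      A ◁ M.coact ≫ (β_ A (M.X ⊗ H)).hom ≫ (M.X ⊗ H) ◁ (ρ_ A).inv ≫
        (M.X ⊗ H) ◁ (i ⊗ₘ η[H]) := by
    rw [← whiskerLeft_comp, ← hi, MonoidalCategory.tensorHom_def', whiskerLeft_comp,
      BraidedCategory.braiding_naturality_right_assoc, whisker_exchange,
      whisker_exchange_assoc]
  rw [rightMul, Category.assoc, Category.assoc, IsMonHom.mul_hom, reassoc_of% e,
    MonObj.tensorObj.mul_def,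
    tensorμ_natural_right_assoc, tensorHom_comp_tensorHom, MonObj.mul_one,
    BraidedCategory.braiding_tensor_right_hom]
  have e₁ : (M.X ⊗ H) ◁ (ρ_ A).inv ≫ tensorμ M.X H A (𝟙_ C) ≫
      (M.X ◁ i ≫ μ[M.X] ⊗ₘ (ρ_ H).hom) = (α_ M.X H A).hom ≫ M.X ◁ (β_ H A).hom ≫
        (α_ M.X A H).inv ≫ (M.X ◁ i ≫ μ[M.X]) ▷ H := by
    simp [tensorμ, MonoidalCategory.tensorHom_def']
  have e₂ : (β_ A H).hom ≫ (β_ H A).hom = 𝟙 _ := by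
    rw [← cancel_epi (β_ H A).hom, ← Category.assoc, braiding_symm]
    simp
  simp only [e₁, Category.assoc, Iso.inv_hom_id_assoc]
  rw [← whiskerLeft_comp_assoc M.X, e₂]
  simp

variable [MonoidalClosed C] [HasEqualizers C] [IsFlat H]

/-- The subalgebra `M^A` of a comodule algebra `M`, for a morphism `i : A ⟶ M` with coinvariant
image: the equalizer of the two morphisms from `M` to the inner hom object `[A, M]` that correspond
to left multiplication by `A` and to right multiplication by `A` preceded by the braiding. -/
noncomputable def commutant (M : ComodAlg H) {A : C} (hA : IsFinite A) (i : A ⟶ M.X)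
    (hi : i ≫ M.coact = (ρ_ A).inv ≫ (i ⊗ₘ η[H])) : ComodAlg H :=
  have h : A ◁ equalizer.ι (MonoidalClosed.curry (leftMul i)) (MonoidalClosed.curry (rightMul i)) ≫
        leftMul i =
      A ◁ equalizer.ι (MonoidalClosed.curry (leftMul i)) (MonoidalClosed.curry (rightMul i)) ≫
        rightMul i := by
    apply MonoidalClosed.curry_injective
    rw [MonoidalClosed.curry_natural_left, MonoidalClosed.curry_natural_left, equalizer.condition]
  subComodAlg M (MonoidalClosed.curry (leftMul i)) (MonoidalClosed.curry (rightMul i))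
    (by rw [← MonoidalClosed.curry_natural_left, one_leftMul, MonoidalClosed.curry_natural_left])
    (by
      rw [← Category.assoc, ← MonoidalClosed.curry_natural_left, leftMul_comm i _ h,
        MonoidalClosed.curry_natural_left, Category.assoc])
    (by
      apply curry_cancel hA
      have e (t : A ⊗ M.X ⟶ M.X) : A ◁ (MonoidalClosed.curry t) ▷ H ≫ (α_ A _ H).inv ≫
          (ihom.ev A).app M.X ▷ H = (α_ A M.X H).inv ≫ t ▷ H := by
        rw [associator_inv_naturality_middle_assoc, ← comp_whiskerRight,
          ← MonoidalClosed.uncurry_eq, MonoidalClosed.uncurry_curry]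
      simp only [whiskerLeft_comp, Category.assoc]
      rw [e, e, ← leftMul_coact M i hi, ← rightMul_coact M i hi, reassoc_of% h])

/-- The comodule algebra `(A # H)^A` of an `H`-module algebra `A` that is finite in `C`. -/
noncomputable def smashCommutant (A : Mod C H) [MonObj A] (hA : IsFinite A.X) : ComodAlg H :=
  commutant (smash A) hA (smashIncl A) (smashIncl_coact A)

end

end Invariants

/-! ### The cotensor product -/

section Cotensor

variable {H : C} [BimonObj H]

/-- The tensor product of two comodule algebras, with the coaction of the second factor. -/
@[reducible]
def tensorComodAlg (S T : ComodAlg H) : ComodAlg H where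
  X := S.X ⊗ T.X
  coact := S.X ◁ T.coact ≫ (α_ S.X T.X H).inv
  coact_counit := by
    rw [Category.assoc, ← associator_inv_naturality_right, ← whiskerLeft_comp_assoc,
      T.coact_counit]
    monoidal
  coact_coassoc := by
    rw [Category.assoc, ← associator_inv_naturality_right, ← whiskerLeft_comp_assoc,
      T.coact_coassoc]
    monoidal

/-- The left coaction `T ⟶ H ⊗ T` obtained from the right coaction by the braiding. -/
def leftCoact (T : ComodAlg H) : T.X ⟶ H ⊗ T.X := T.coact ≫ (β_ T.X H).hom

variable [HLinearBraiding H]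

instance isMonHom_braiding (T : C) [MonObj T] : IsMonHom (β_ T H).hom where
  one_hom := MonObj.one_braiding T H
  mul_hom := by
    dsimp [MonObj.tensorObj.mul_def]
    simp only [tensorμ, Category.assoc, BraidedCategory.braiding_naturality,
      BraidedCategory.braiding_tensor_right_hom, BraidedCategory.braiding_tensor_left_hom,
      comp_whiskerRight, whisker_assoc, whiskerLeft_comp, pentagon_assoc,
      pentagon_inv_hom_hom_hom_inv_assoc, Iso.inv_hom_id_assoc, whiskerLeft_hom_inv_assoc]
    rw [← whiskerLeft_comp_assoc T ((β_ H T).hom ▷ H), ← comp_whiskerRight, braiding_symm]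
    simp only [id_whiskerRight, whiskerLeft_id, Category.id_comp, Category.assoc,
      pentagon_inv_assoc, Iso.hom_inv_id_assoc]
    rw [← associator_inv_naturality_left_assoc, Iso.inv_hom_id_assoc,
      ← associator_naturality_right_assoc, ← MonoidalCategory.tensorHom_def_assoc]

instance (T : ComodAlg H) : IsMonHom (leftCoact T) := by
  unfold leftCoact
  infer_instance

theorem leftCoact_coact (T : ComodAlg H) :
    leftCoact T ≫ H ◁ T.coact = T.coact ≫ leftCoact T ▷ H ≫ (α_ H T.X H).hom := by
  have h := T.coact_coassoc
  have h' : T.coact ≫ T.coact ▷ H = T.coact ≫ T.X ◁ Δ[H] ≫ (α_ T.X H H).inv := by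
    rw [reassoc_of% h, Iso.hom_inv_id, Category.comp_id]
  rw [leftCoact, Category.assoc, ← BraidedCategory.braiding_naturality_left,
    comp_whiskerRight, Category.assoc, reassoc_of% h', reassoc_of% h',
    BraidedCategory.braiding_tensor_left_hom]
  simp only [Iso.inv_hom_id_assoc]
  rw [← whiskerLeft_comp_assoc, cocomm]

variable [HasEqualizers C] [IsFlat H]

/-- The cotensor product `S □ T` over `H`: the equalizer of `ρ ⊗ T` and `S ⊗ λ` on `S ⊗ T`, where
`ρ` is the right coaction on `S` and `λ` the left coaction on `T`. It is a subalgebra of the tensor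
product algebra, with the coaction of `T`. -/
noncomputable def cotensor (S T : ComodAlg H) : ComodAlg H :=
  subComodAlg (tensorComodAlg S T) (S.coact ▷ T.X) (S.X ◁ leftCoact T ≫ (α_ S.X H T.X).inv)
    (by rw [IsMonHom.one_hom, IsMonHom.one_hom])
    (by
      rw [IsMonHom.mul_hom, IsMonHom.mul_hom, tensorHom_comp_tensorHom_assoc,
        tensorHom_comp_tensorHom_assoc, equalizer.condition])
    (by
      have e₁ : (tensorComodAlg S T).coact ≫ (S.coact ▷ T.X) ▷ H =
          S.coact ▷ T.X ≫ (S.X ⊗ H) ◁ T.coact ≫ (α_ _ T.X H).inv := by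
        rw [← whisker_exchange_assoc, Category.assoc]
        simp
      have e₂ : (tensorComodAlg S T).coact ≫ (S.X ◁ leftCoact T ≫ (α_ S.X H T.X).inv) ▷ H =
          (S.X ◁ leftCoact T ≫ (α_ S.X H T.X).inv) ≫ (S.X ⊗ H) ◁ T.coact ≫
            (α_ _ T.X H).inv := by
        have h := congrArg (fun t => S.X ◁ t) (leftCoact_coact T)
        simp only [whiskerLeft_comp] at h
        rw [Category.assoc, Category.assoc, ← associator_inv_naturality_right_assoc, reassoc_of% h]
        monoidal
      rw [e₁, e₂, equalizer.condition_assoc])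

end Cotensor

/-! ### Azumaya algebras -/

section Azumaya

/-- The morphism `X ⟶ P ⊗ Y` adjoint to `f : A ⊗ X ⟶ Y`, where `P` is dual to `A`, so that
`P ⊗ Y` is the inner hom object `[A, Y]`. -/
def transposeDual {A P X Y : C} [ExactPairing P A] (f : A ⊗ X ⟶ Y) : X ⟶ P ⊗ Y :=
  (λ_ X).inv ≫ (η_ P A) ▷ X ≫ (α_ P A X).hom ≫ P ◁ f

/-- Evaluation `A ⊗ P ⟶ 𝟙`, with `P = [A, 𝟙]`, coequalizes the two morphisms
`A ⊗ [A, A] ⊗ P ⟶ A ⊗ P` given by the actions of `[A, A] = P ⊗ A` on `A` and on `P`. -/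
theorem evaluation_balanced (A P : C) [ExactPairing P A] :
    (ε_ P A ▷ (A ⊗ P) ≫ (λ_ (A ⊗ P)).hom) ≫ ε_ P A =
      ((A ⊗ P) ◁ ε_ P A ≫ (ρ_ (A ⊗ P)).hom) ≫ ε_ P A := by
  rw [Category.assoc, Category.assoc, ← leftUnitor_naturality, ← rightUnitor_naturality,
    ← whisker_exchange_assoc, unitors_equal]

/-- The object `A` with dual `P` is a progenerator: evaluation induces an isomorphism from
`A ⊗_{[A, A]} P` to the unit object. -/
def IsProgenerator (A P : C) [ExactPairing P A] : Prop :=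
  Nonempty (IsColimit (Cofork.ofπ (ε_ P A) (evaluation_balanced A P)))

/-- The canonical morphism from `A ⊗ Aᵒᵖ` to `[A, A] = P ⊗ A`, adjoint to
`a ⊗ b ⊗ c ↦ a (c b)`, where `b` passes `c` by the braiding. -/
def azumayaLeft (A P : C) [MonObj A] [ExactPairing P A] : A ⊗ A ⟶ P ⊗ A :=
  transposeDual ((β_ A (A ⊗ A)).hom ≫ (α_ A A A).hom ≫ A ◁ (β_ A A).hom ≫ A ◁ μ[A] ≫ μ[A])

/-- The canonical morphism from `Aᵒᵖ ⊗ A` to `[A, A] = P ⊗ A`, adjoint to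
`c ⊗ a ⊗ b ↦ (a c) b`, where `c` passes `a` by the braiding. -/
def azumayaRight (A P : C) [MonObj A] [ExactPairing P A] : A ⊗ A ⟶ P ⊗ A :=
  transposeDual ((α_ A A A).inv ≫ (β_ A A).hom ▷ A ≫ μ[A] ▷ A ≫ μ[A])

/-- An algebra `A` in a braided monoidal category is Azumaya if it is faithfully projective and the
canonical morphisms from `A ⊗ Aᵒᵖ` and `Aᵒᵖ ⊗ A` to `[A, A]` are isomorphisms. -/
def IsAzumayaAlg (A : C) [MonObj A] : Prop :=
  ∃ (P : C) (_ : ExactPairing P A),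
    IsProgenerator A P ∧ IsIso (azumayaLeft A P) ∧ IsIso (azumayaRight A P)

/-- The underlying object of an `H`-Azumaya algebra, that is, of an Azumaya algebra in the braided
monoidal category of left `H`-modules, is finite in `C`. -/
theorem IsAzumayaAlg.isFinite {H : C} [BimonObj H] [HLinearBraiding H] {A : Mod C H} [MonObj A]
    (hA : IsAzumayaAlg A) : IsFinite A.X := by
  obtain ⟨P, p, -⟩ := hA
  exact ⟨P.X, ⟨{
    coevaluation' := (η_ P A).hom
    evaluation' := (ε_ P A).hom
    coevaluation_evaluation' :=
      congrArg Mod.Hom.hom (ExactPairing.coevaluation_evaluation P A)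
    evaluation_coevaluation' :=
      congrArg Mod.Hom.hom (ExactPairing.evaluation_coevaluation P A) }⟩⟩

/-- The underlying object of the tensor product of two `H`-Azumaya algebras is finite in `C`. -/
theorem IsAzumayaAlg.isFinite_tensor {H : C} [BimonObj H] [HLinearBraiding H] {A B : Mod C H}
    [MonObj A] [MonObj B] (hA : IsAzumayaAlg A) (hB : IsAzumayaAlg B) : IsFinite (A ⊗ B).X :=
  hA.isFinite.tensor hB.isFinite

end Azumaya

end BraidedHopf

open BraidedHopf

/-! An algebra `M` with an algebra morphism `i : A ⟶ M` is a module over `A ⊗ Aᵒᵖ` through `m ↦ a m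
b`. If `A` is Azumaya with dual `P`, then `A ⊗ Aᵒᵖ` is `[A, A] = P ⊗ A`, so for each `p` in `P` it
contains an element `e_p` (`rankOne`) acting on `A` by `c ↦ p(c) 1`. As `A ⊗ Aᵒᵖ` acts faithfully on
`A`, two identities can be checked there: multiplying `e_p` by `a` in the first or in the second
factor gives the same result, and `∑ aᵢ e_{pᵢ} = 1 ⊗ 1` for dual bases. The first puts `e_p m` in
the commutant of `A`, and the second gives `m = ∑ aᵢ (e_{pᵢ} m)`. Hence `A ⊗ M^A ≅ M`
(`isIso_of_commutant`).

For `S = A # H` and `T = S^A` this says that `T` and `H` are both bases of `S` as a left `A`-module.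
Thus `S ⊗ T` and `S ⊗ H` are two forms of `S ⊗_A S`, and the canonical morphism of `S` restricted to
`S ⊗ T` becomes `s ⊗ h ↦ s h₁ ⊗ h₂`, which the antipode inverts. It is also `A ⊗ can_T` up to
isomorphism. Since `A` is faithfully projective, `A ⊗ -` reflects isomorphisms, so `can_T` is
invertible (`isIso_can_of_bases`); faithful flatness of `T` descends along `A ⊗ T ≅ A ⊗ H` in the
same way. So `T` is Galois (`isGaloisObj_smashCommutant`).

For two algebras, `(a ⊗ b) # h ↦ (a # h₁) ⊗ (b # h₂)` identifies `(A ⊗ B) # H` with the cotensor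
product of `A # H` and `B # H`, by cocommutativity. A morphism into `(A # H) ⊗ (B # H)` commutes
with `A ⊗ B` exactly when it factors through `(A # H)^A ⊗ (B # H)^B`; here `A` passes `(B # H)^B`
and comes back, which is harmless because the braiding with this Galois object is symmetric.
Intersecting both descriptions shows that the two comodule algebras are the same subobject of `(A #
H) ⊗ (B # H)` (`commutant_iso_cotensor`).

That they are Galois does not need `A ⊗ B` to be Azumaya. The decompositions for `A` and `B` combine
to `(A ⊗ B) ⊗ (T □ T') ≅ (A ⊗ B) # H` (`isIso_of_cotensor`), and the descent argument then applies
with `A ⊗ B` in place of `A` (`isGaloisObj_of_smash`). -/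

set_option linter.unusedSectionVars false

namespace BraidedHopf

variable {C : Type u} [Category.{v} C] [MonoidalCategory C] [BraidedCategory C]

/-! ### Left and right multiplication as commuting actions -/

section BimoduleActions

variable {A M : C} [MonObj A] [MonObj M] (i : A ⟶ M) [IsMonHom i]

theorem one_leftMul_act : η[A] ▷ M ≫ leftMul i = (λ_ M).hom := by
  rw [leftMul, ← comp_whiskerRight_assoc, IsMonHom.one_hom, MonObj.one_mul]

theorem one_rightMul_act : η[A] ▷ M ≫ rightMul i = (λ_ M).hom := by
  rw [rightMul, BraidedCategory.braiding_naturality_left_assoc, ← whiskerLeft_comp_assoc,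
    IsMonHom.one_hom, MonObj.mul_one, braiding_rightUnitor]

theorem leftMul_leftMul : A ◁ leftMul i ≫ leftMul i =
    (α_ A A M).inv ≫ μ[A] ▷ M ≫ leftMul i := by
  have h := MonObj.mul_assoc M
  simp only [leftMul]
  rw [← comp_whiskerRight_assoc, IsMonHom.mul_hom]
  simp only [comp_whiskerRight, Category.assoc, whiskerLeft_comp, MonoidalCategory.tensorHom_def]
  rw [whisker_exchange_assoc, whisker_exchange_assoc, h]
  simp

/-- By `mul_rightMul`, right multiplication of a product acts on its second factor alone, so it
commutes with left multiplication once the two copies of `A` have been braided. -/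
theorem rightMul_leftMul : A ◁ leftMul i ≫ rightMul i =
    (α_ A A M).inv ≫ (β_ A A).hom ▷ M ≫ (α_ A A M).hom ≫ A ◁ rightMul i ≫ leftMul i := by
  have h := mul_rightMul i
  simp only [leftMul, whiskerLeft_comp, Category.assoc]
  rw [h, associator_inv_naturality_middle_assoc, ← comp_whiskerRight_assoc,
    BraidedCategory.braiding_naturality_right, whisker_exchange_assoc]
  simp

/-- Successive right multiplications arrive in reversed order, so this is an action of the opposite
algebra, whose product is `(β_ A A).hom ≫ μ[A]`. -/
theorem rightMul_rightMul : A ◁ rightMul i ≫ rightMul i =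
    (α_ A A M).inv ≫ ((β_ A A).hom ≫ μ[A]) ▷ M ≫ rightMul i := by
  have e : A ◁ i ≫ rightMul i = (β_ A A).hom ≫ μ[A] ≫ i := by
    rw [rightMul, BraidedCategory.braiding_naturality_right_assoc, IsMonHom.mul_hom,
      MonoidalCategory.tensorHom_def, Category.assoc]
  have e' : A ◁ rightMul i ≫ rightMul i = A ◁ (β_ A M).hom ≫ (α_ A M A).inv ≫
      (β_ A M).hom ▷ A ≫ (α_ M A A).hom ≫ M ◁ (A ◁ i ≫ rightMul i) ≫ μ[M] := by
    nth_rw 1 [rightMul]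
    simp only [whiskerLeft_comp, Category.assoc]
    rw [mul_rightMul, associator_inv_naturality_right_assoc, whisker_exchange_assoc,
      associator_naturality_right_assoc]
  rw [e', e, rightMul, BraidedCategory.braiding_naturality_left_assoc,
    BraidedCategory.braiding_tensor_left_hom]
  simp only [whiskerLeft_comp, Category.assoc, Iso.inv_hom_id_assoc]

end BimoduleActions

/-! ### The action of the enveloping algebra -/

section EnvelopingAction

variable {A M : C} [MonObj A] [MonObj M]

/-- The action of `A ⊗ Aᵒᵖ` on `M`, `(a ⊗ b) ⊗ m ↦ a (m b)`, where `b` passes `m` by the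
braiding. -/
def envAct (i : A ⟶ M) : (A ⊗ A) ⊗ M ⟶ M := (α_ A A M).hom ≫ A ◁ rightMul i ≫ leftMul i

variable (A) in
/-- Multiplication by `A` on the first factor of `A ⊗ Aᵒᵖ`. -/
def envLeft : A ⊗ (A ⊗ A) ⟶ A ⊗ A := (α_ A A A).inv ≫ μ[A] ▷ A

variable (A) in
/-- Multiplication by `Aᵒᵖ` on the second factor of `A ⊗ Aᵒᵖ`. -/
def envRight : A ⊗ (A ⊗ A) ⟶ A ⊗ A :=
  (α_ A A A).inv ≫ (β_ A A).hom ▷ A ≫ (α_ A A A).hom ≫ A ◁ ((β_ A A).hom ≫ μ[A])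

variable (i : A ⟶ M) [IsMonHom i]

theorem envLeft_act : envLeft A ▷ M ≫ envAct i =
    (α_ A (A ⊗ A) M).hom ≫ A ◁ envAct i ≫ leftMul i := by
  simp only [envAct, whiskerLeft_comp, Category.assoc, leftMul_leftMul, envLeft,
    comp_whiskerRight]
  rw [associator_naturality_left_assoc, ← whisker_exchange_assoc,
    associator_inv_naturality_right_assoc]
  monoidal

theorem envRight_act : envRight A ▷ M ≫ envAct i =
    (α_ A (A ⊗ A) M).hom ≫ A ◁ envAct i ≫ rightMul i := by
  simp only [envAct, whiskerLeft_comp, Category.assoc, rightMul_leftMul, envRight]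
  rw [associator_inv_naturality_right_assoc, whisker_exchange_assoc,
    associator_naturality_right_assoc, ← whiskerLeft_comp_assoc A (A ◁ rightMul i),
    rightMul_rightMul]
  simp

theorem envAct_one : ((λ_ (𝟙_ C)).inv ≫ (η[A] ⊗ₘ η[A])) ▷ M ≫ envAct i =
    (λ_ M).hom := by
  rw [envAct, MonoidalCategory.tensorHom_def']
  simp only [comp_whiskerRight, Category.assoc]
  rw [associator_naturality_left_assoc, ← whisker_exchange_assoc, one_leftMul_act,
    associator_naturality_middle_assoc, ← whiskerLeft_comp_assoc, one_rightMul_act]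
  monoidal

/-- If `j : T ⟶ M` commutes with `A` then `a ⊗ t ↦ a j(t)` is linear over `A ⊗ Aᵒᵖ`. -/
theorem envAct_linear {T : C} (j : T ⟶ M) (h : A ◁ j ≫ leftMul i = A ◁ j ≫ rightMul i) :
    (A ⊗ A) ◁ (A ◁ j ≫ leftMul i) ≫ envAct i =
      (α_ (A ⊗ A) A T).inv ≫ envAct (𝟙 A) ▷ T ≫ A ◁ j ≫ leftMul i := by
  -- Since `t` commutes with `A`, one has `(a t) b = (a b) t`: right multiplication reaches only the
  -- factor `a`.
  have e₁ : A ◁ (A ◁ j ≫ leftMul i) ≫ rightMul i =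
      (α_ A A T).inv ≫ rightMul (𝟙 A) ▷ T ≫ A ◁ j ≫ leftMul i := by
    rw [whiskerLeft_comp, Category.assoc, rightMul_leftMul,
      associator_inv_naturality_right_assoc, whisker_exchange_assoc,
      associator_naturality_right_assoc, ← whiskerLeft_comp_assoc, ← h, whiskerLeft_comp,
      Category.assoc, leftMul_leftMul, associator_inv_naturality_right_assoc,
      Iso.hom_inv_id_assoc, whisker_exchange_assoc, rightMul]
    simp
  have e₂ : A ◁ (A ◁ j ≫ leftMul i) ≫ leftMul i =
      (α_ A A T).inv ≫ leftMul (𝟙 A) ▷ T ≫ A ◁ j ≫ leftMul i := by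
    rw [whiskerLeft_comp, Category.assoc, leftMul_leftMul,
      associator_inv_naturality_right_assoc, whisker_exchange_assoc, leftMul]
    simp [leftMul]
  rw [envAct, associator_naturality_right_assoc, ← whiskerLeft_comp_assoc, e₁]
  generalize A ◁ j ≫ leftMul i = t at *
  simp only [whiskerLeft_comp, Category.assoc]
  rw [e₂, envAct]
  simp

end EnvelopingAction

/-! ### Rank one elements of the enveloping algebra -/

section Azumaya

variable {A P : C} [MonObj A] [ExactPairing P A]

theorem comp_transposeDual {X X' Y : C} (x : X' ⟶ X) (f : A ⊗ X ⟶ Y) :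
    x ≫ transposeDual (P := P) f = transposeDual (A ◁ x ≫ f) := by
  simp only [transposeDual, whiskerLeft_comp]
  rw [leftUnitor_inv_naturality_assoc, whisker_exchange_assoc, associator_naturality_right_assoc]

theorem transposeDual_eval {X Y : C} (f : A ⊗ X ⟶ Y) :
    A ◁ transposeDual (P := P) f ≫ (α_ A P Y).inv ≫ ε_ P A ▷ Y ≫ (λ_ Y).hom = f := by
  have e := congrArg (fun t => t ▷ X) (ExactPairing.coevaluation_evaluation P A)
  simp only [comp_whiskerRight] at e
  simp only [transposeDual, whiskerLeft_comp, Category.assoc]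
  rw [associator_inv_naturality_right_assoc, whisker_exchange_assoc, leftUnitor_naturality]
  calc _ = A ◁ (λ_ X).inv ≫ (α_ A (𝟙_ C) X).inv ≫ ((A ◁ η_ P A) ▷ X ≫
        (α_ A P A).inv ▷ X ≫ (ε_ P A ▷ A) ▷ X) ≫ (α_ _ A X).hom ≫ (λ_ _).hom ≫ f := by
          monoidal
    _ = f := by
        rw [e]
        monoidal

/-- The transpose takes its argument on the left and `envAct` on the right. The braiding that
reconciles them is the source of the inverse braidings below. -/
theorem azumayaLeft_eq : azumayaLeft A P =
    transposeDual ((β_ A (A ⊗ A)).hom ≫ envAct (𝟙 A)) := by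
  simp [azumayaLeft, envAct, rightMul, leftMul]

variable (P) in
/-- If `A` is Azumaya then `A ⊗ Aᵒᵖ` acts faithfully on `A`. -/
theorem envAct_faithful [IsIso (azumayaLeft A P)] {X : C} {x y : X ⟶ A ⊗ A}
    (h : x ▷ A ≫ envAct (𝟙 A) = y ▷ A ≫ envAct (𝟙 A)) : x = y := by
  rw [← cancel_mono (azumayaLeft A P), azumayaLeft_eq, comp_transposeDual, comp_transposeDual,
    BraidedCategory.braiding_naturality_right_assoc,
    BraidedCategory.braiding_naturality_right_assoc, h]

variable (A P) in
/-- The element of `A ⊗ Aᵒᵖ` that acts on `A` by `c ↦ p(c) 1`, for `p` in the dual of `A`. -/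
noncomputable def rankOne [IsIso (azumayaLeft A P)] : P ⟶ A ⊗ A :=
  (ρ_ P).inv ≫ P ◁ η[A] ≫ inv (azumayaLeft A P)

/-- By construction `azumayaLeft` sends `e_p` to `p ⊗ 1` in `P ⊗ A`, which evaluates to `c ↦ p(c)
1`; the inverse braiding brings `c` in front of `p`. -/
theorem rankOne_act [IsIso (azumayaLeft A P)] :
    rankOne A P ▷ A ≫ envAct (𝟙 A) = (β_ A P).inv ≫ ε_ P A ≫ η[A] := by
  have h := transposeDual_eval (P := P) ((β_ A (A ⊗ A)).hom ≫ envAct (𝟙 A))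
  rw [← azumayaLeft_eq, ← Iso.inv_comp_eq] at h
  have e : rankOne A P ≫ azumayaLeft A P = (ρ_ P).inv ≫ P ◁ η[A] := by simp [rankOne]
  rw [← h, BraidedCategory.braiding_inv_naturality_left_assoc, ← whiskerLeft_comp_assoc, e]
  simp only [Category.assoc, whiskerLeft_comp]
  rw [associator_inv_naturality_right_assoc, whisker_exchange_assoc, leftUnitor_naturality]
  monoidal

/-- The dual pairing with `A` on the other side, obtained from the inverse of the braiding. -/
@[reducible]
def swapPairing (P A : C) [ExactPairing P A] : ExactPairing A P :=
  letI := reverseBraiding C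
  BraidedCategory.exactPairing_swap P A

end Azumaya

/-! ### Splitting off an Azumaya algebra -/

section Decomposition

variable {A P : C} [MonObj A] [ExactPairing P A] [IsIso (azumayaLeft A P)]

/-- By faithfulness it is enough to act on `c` in `A`. Both sides then multiply the scalar `p(c)` by
`a`, on the left or on the right of the unit, which agree by `one_leftMul`. -/
theorem rankOne_left_eq_right : A ◁ rankOne A P ≫ envLeft A = A ◁ rankOne A P ≫ envRight A := by
  apply envAct_faithful P
  rw [comp_whiskerRight, comp_whiskerRight, Category.assoc, Category.assoc, envLeft_act,
    envRight_act, associator_naturality_middle_assoc, associator_naturality_middle_assoc,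
    ← whiskerLeft_comp_assoc, ← whiskerLeft_comp_assoc, rankOne_act]
  simp only [whiskerLeft_comp, Category.assoc, one_leftMul]

/-- The coevaluation of the swapped pairing plays the role of dual bases `∑ aᵢ ⊗ pᵢ`. Acting on `c`,
the left side gives `∑ aᵢ pᵢ(c) = c`, which is the action of `1 ⊗ 1`. -/
theorem rankOne_sum : ((swapPairing P A).coevaluation' ≫ A ◁ rankOne A P ≫ envLeft A) =
    (λ_ (𝟙_ C)).inv ≫ (η[A] ⊗ₘ η[A]) := by
  -- The evaluation of the swapped pairing is by definition `(β_ A P).inv ≫ ε_ P A`, exactly the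
  -- pairing found in `rankOne_act`.
  have e : (swapPairing P A).coevaluation' ▷ A ≫ (α_ A P A).hom ≫ A ◁ ((β_ A P).inv ≫ ε_ P A) =
    (λ_ A).hom ≫ (ρ_ A).inv := (swapPairing P A).evaluation_coevaluation'
  apply envAct_faithful P
  rw [envAct_one, comp_whiskerRight, comp_whiskerRight, Category.assoc, Category.assoc,
    envLeft_act, associator_naturality_middle_assoc, ← whiskerLeft_comp_assoc, rankOne_act,
    ← Category.assoc (β_ A P).inv, whiskerLeft_comp, Category.assoc, reassoc_of% e]
  simp [leftMul]

end Decomposition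

/-- The subalgebra of elements commuting with an Azumaya algebra `A` splits off: if `j : T ⟶ M`
is universal among the morphisms that commute with `A`, then multiplication `A ⊗ T ⟶ M` is an
isomorphism. -/
theorem isIso_of_commutant {A M : C} (P : C) [MonObj A] [MonObj M] [ExactPairing P A]
    [IsIso (azumayaLeft A P)] (i : A ⟶ M) [IsMonHom i] {T : C} (j : T ⟶ M) [Mono j]
    (h : A ◁ j ≫ leftMul i = A ◁ j ≫ rightMul i)
    (hT : ∀ {X : C} (x : X ⟶ M), A ◁ x ≫ leftMul i = A ◁ x ≫ rightMul i → ∃ y, y ≫ j = x) :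
    IsIso (A ◁ j ≫ leftMul i) := by
  -- The identity between the left and right multiples of `e_p` in `A ⊗ Aᵒᵖ`, applied to `m`, says
  -- that `e_p m` commutes with `A`; so `p ⊗ m ↦ e_p m` factors through `T`.
  obtain ⟨y, hy⟩ := hT (rankOne A P ▷ M ≫ envAct i) (by
    have e := congrArg (fun t => (α_ A P M).inv ≫ t ▷ M ≫ envAct i)
      (rankOne_left_eq_right (A := A) (P := P))
    simp only [comp_whiskerRight, Category.assoc, envLeft_act, envRight_act] at e
    simpa using e)
  -- On a product, `e_p (a t) = (e_p a) t = p(a) t`.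
  have e₁ : P ◁ (A ◁ j ≫ leftMul i) ≫ y = (α_ P A T).inv ≫ ((β_ A P).inv ≫ ε_ P A) ▷ T ≫
      (λ_ T).hom := by
    rw [← cancel_mono j, Category.assoc, hy, whisker_exchange_assoc, envAct_linear i j h,
      associator_inv_naturality_left_assoc, ← comp_whiskerRight_assoc, rankOne_act]
    simp only [comp_whiskerRight, Category.assoc]
    rw [← whisker_exchange_assoc, one_leftMul_act, leftUnitor_naturality]
  have e₂ := congrArg (fun t => (λ_ M).inv ≫ t ▷ M ≫ envAct i) (rankOne_sum (A := A) (P := P))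
  simp only [envAct_one] at e₂
  -- The inverse is `m ↦ ∑ aᵢ ⊗ e_{pᵢ} m`. One composite is a zigzag identity of the swapped
  -- pairing, the other is `rankOne_sum`.
  refine ⟨(λ_ M).inv ≫ (swapPairing P A).coevaluation' ▷ M ≫ (α_ A P M).hom ≫ A ◁ y, ?_, ?_⟩
  · rw [leftUnitor_inv_naturality_assoc, whisker_exchange_assoc,
      associator_naturality_right_assoc, ← whiskerLeft_comp, e₁]
    have e : (swapPairing P A).coevaluation' ▷ A ≫ (α_ A P A).hom ≫ A ◁ ((β_ A P).inv ≫ ε_ P A) =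
      (λ_ A).hom ≫ (ρ_ A).inv := (swapPairing P A).evaluation_coevaluation'
    have e' := congrArg (fun t => t ▷ T) e
    simp only [comp_whiskerRight] at e'
    generalize (β_ A P).inv ≫ ε_ P A = q at *
    calc _ = (λ_ (A ⊗ T)).inv ≫ (α_ _ _ _).inv ≫
          ((swapPairing P A).coevaluation' ▷ A ▷ T ≫ (α_ A P A).hom ▷ T ≫ (A ◁ q) ▷ T) ≫
            (α_ _ _ _).hom ≫ A ◁ (λ_ T).hom := by monoidal
      _ = _ := by
        rw [e']
        monoidal
  · simp only [Category.assoc]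
    rw [← whiskerLeft_comp_assoc, hy]
    simp only [comp_whiskerRight, Category.assoc, envLeft_act, Iso.inv_hom_id] at e₂
    rw [← e₂]
    simp

/-! ### Flat objects and objects that reflect isomorphisms -/

section Flatness

/-- With the dual on the other side, `A ⊗ -` is also a right adjoint, of `P ⊗ -`. -/
theorem isFlat_of_exactPairing (P A : C) [ExactPairing P A] : IsFlat A :=
  letI := swapPairing P A
  ⟨(tensorLeftAdjunction A P).rightAdjoint_preservesLimits.preservesLimitsOfShape⟩

theorem IsFlat.tensor (X Y : C) [IsFlat X] [IsFlat Y] : IsFlat (X ⊗ Y) where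
  preserves :=
    have := IsFlat.preserves (X := X)
    have := IsFlat.preserves (X := Y)
    preservesLimitsOfShape_of_natIso (tensorLeftTensor X Y).symm

/-- Tensoring with `X` reflects isomorphisms. -/
abbrev IsConservative (X : C) : Prop := (tensorLeft X).ReflectsIsomorphisms

theorem isIso_of_whiskerLeft (X : C) [IsConservative X] {Y Z : C} (f : Y ⟶ Z) [IsIso (X ◁ f)] :
    IsIso f :=
  have : IsIso ((tensorLeft X).map f) := ‹IsIso (X ◁ f)›
  isIso_of_reflects_iso f (tensorLeft X)

theorem isFaithfullyFlat_of_isConservative [HasEqualizers C] (X : C) [IsFlat X]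
    [IsConservative X] : IsFaithfullyFlat X where
  reflects :=
    have := IsFlat.preserves (X := X)
    reflectsLimitsOfShape_of_reflectsIsomorphisms

theorem isIso_tensor_whiskerLeft_iff (X Y : C) {Z W : C} (f : Z ⟶ W) :
    IsIso ((X ⊗ Y) ◁ f) ↔ IsIso (X ◁ Y ◁ f) := by
  rw [tensor_whiskerLeft]
  simp

theorem IsConservative.tensor (X Y : C) [IsConservative X] [IsConservative Y] :
    IsConservative (X ⊗ Y) where
  reflects f h :=
    have : IsIso (X ◁ Y ◁ f) := (isIso_tensor_whiskerLeft_iff X Y f).1 h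
    have := isIso_of_whiskerLeft X (Y ◁ f)
    isIso_of_whiskerLeft Y f

/-- The unit object is a retract of `X`, so `f` is a retract of `X ◁ f`. -/
theorem isConservative_of_retract {X : C} (s : 𝟙_ C ⟶ X) (r : X ⟶ 𝟙_ C) (h : s ≫ r = 𝟙 _) :
    IsConservative X where
  reflects {Y Z} f hf := by
    have : IsIso (X ◁ f) := hf
    refine ⟨(λ_ Z).inv ≫ s ▷ Z ≫ inv (X ◁ f) ≫ r ▷ Y ≫ (λ_ Y).hom, ?_, ?_⟩
    · rw [leftUnitor_inv_naturality_assoc, whisker_exchange_assoc, IsIso.hom_inv_id_assoc,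
        ← comp_whiskerRight_assoc, h]
      simp
    · simp only [Category.assoc]
      rw [← leftUnitor_naturality, ← whisker_exchange_assoc, IsIso.inv_hom_id_assoc,
        ← comp_whiskerRight_assoc, h]
      simp

instance isConservative_bimon (H : C) [BimonObj H] : IsConservative H :=
  isConservative_of_retract η[H] ε[H] (BimonObj.one_counit H)

/-- Flatness and conservativity descend along `A ⊗ T ≅ A ⊗ Y`. -/
theorem isFaithfullyFlat_of_iso [HasEqualizers C] {A T Y : C} [IsFlat A] [IsConservative A]
    [IsFlat Y] [IsConservative Y] (e : A ⊗ T ≅ A ⊗ Y) : IsFaithfullyFlat T := by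
  -- `A ⊗ T ⊗ -` is isomorphic to `A ⊗ Y ⊗ -` and preserves equalizers, and `A ⊗ -` reflects them.
  have : IsFlat T := ⟨by
    have := (IsFlat.tensor A Y).preserves
    have := (isFaithfullyFlat_of_isConservative A).reflects
    have : PreservesLimitsOfShape WalkingParallelPair (tensorLeft T ⋙ tensorLeft A) :=
      preservesLimitsOfShape_of_natIso
        (((curriedTensor C).mapIso e.symm : tensorLeft (A ⊗ Y) ≅ tensorLeft (A ⊗ T)) ≪≫
          tensorLeftTensor A T)
    exact preservesLimitsOfShape_of_reflects_of_preserves (tensorLeft T) (tensorLeft A)⟩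
  have : IsConservative T := ⟨fun {Z W} f hf => by
    have : IsIso (T ◁ f) := hf
    have : IsIso ((A ⊗ T) ◁ f) := (isIso_tensor_whiskerLeft_iff A T f).2 inferInstance
    have : IsIso (A ◁ Y ◁ f) := by
      rw [← isIso_tensor_whiskerLeft_iff]
      have : (A ⊗ Y) ◁ f = e.inv ▷ Z ≫ (A ⊗ T) ◁ f ≫ e.hom ▷ W := by
        rw [whisker_exchange, inv_hom_whiskerRight_assoc]
      rw [this]
      infer_instance
    have := isIso_of_whiskerLeft A (Y ◁ f)
    exact isIso_of_whiskerLeft Y f⟩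
  exact isFaithfullyFlat_of_isConservative T

/-- If `A ◁ f` is invertible then so is `(A ⊗ P) ◁ f`, and naturality of evaluation carries
information from it down to `f`. Strength of the epimorphism is needed at the end, since `C` need
not be balanced. -/
theorem isConservative_of_strongEpi {P A : C} [ExactPairing P A]
    (h : ∀ X : C, StrongEpi (ε_ P A ▷ X)) : IsConservative A where
  reflects {Y Z} f hf := by
    have : IsIso (A ◁ f) := hf
    have nat {W W' : C} (u : W ⟶ W') : (A ⊗ P) ◁ u ≫ ε_ P A ▷ W' ≫ (λ_ W').hom =
        ε_ P A ▷ W ≫ (λ_ W).hom ≫ u := by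
      rw [whisker_exchange_assoc, leftUnitor_naturality]
    -- `A` passes `P ⊗ W` and returns over `W` alone, so `A ⊗ P ⊗ -` is naturally isomorphic to `P ⊗
    -- A ⊗ -`.
    have conj {W W' : C} (u : W ⟶ W') : (A ⊗ P) ◁ u =
        (α_ A P W).hom ≫ (β_ A (P ⊗ W)).hom ≫ (α_ P W A).hom ≫ P ◁ (β_ A W).inv ≫
          P ◁ (A ◁ u) ≫ P ◁ (β_ A W').hom ≫ (α_ P W' A).inv ≫ (β_ A (P ⊗ W')).inv ≫
            (α_ A P W').inv := by
      rw [← whiskerLeft_comp_assoc P (A ◁ u), BraidedCategory.braiding_naturality_right]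
      simp only [whiskerLeft_comp, whiskerLeft_inv_hom_assoc, Category.assoc]
      rw [← associator_naturality_middle_assoc,
        ← BraidedCategory.braiding_naturality_right_assoc]
      simp
    have : IsIso ((A ⊗ P) ◁ f) := by
      rw [conj]
      infer_instance
    have : Mono f := ⟨fun {W} u w huw => by
      have e : A ◁ u = A ◁ w := by
        rw [← cancel_mono (A ◁ f), ← whiskerLeft_comp, huw, whiskerLeft_comp]
      have := h W
      rw [← cancel_epi ((λ_ W).hom), ← cancel_epi (ε_ P A ▷ W), ← nat, ← nat, conj u, conj w, e]⟩
    have := h Z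
    -- By naturality the strong epimorphism `ε_ P A ▷ Z` factors through `f` up to isomorphisms,
    -- which makes `f` a strong epimorphism.
    have : StrongEpi ((inv ((A ⊗ P) ◁ f) ≫ ε_ P A ▷ Y ≫ (λ_ Y).hom) ≫ f) := by
      rw [Category.assoc, Category.assoc, ← nat, IsIso.inv_hom_id_assoc]
      infer_instance
    have := strongEpi_of_strongEpi (inv ((A ⊗ P) ◁ f) ≫ ε_ P A ▷ Y ≫ (λ_ Y).hom) f
    exact isIso_of_mono_of_strongEpi f

end Flatness

/-! ### Coequalizers of modules, computed in the base category -/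

section Coequalizers

variable [MonoidalClosed C] [HasCoequalizers C] {H : C} [BimonObj H]

/-- Tensoring with `H` preserves the coequalizer of two morphisms. -/
noncomputable def tensorCoequalizer (H : C) {M N : C} (f g : M ⟶ N) :
    IsColimit (Cofork.ofπ (f := H ◁ f) (g := H ◁ g) (H ◁ coequalizer.π f g)
      (by rw [← whiskerLeft_comp, coequalizer.condition, whiskerLeft_comp])) :=
  isColimitCoforkMapOfIsColimit (tensorLeft H) (coequalizer.condition f g)
    (coequalizerIsCoequalizer f g)

/-- The `H`-action on the coequalizer in `C` of two `H`-linear morphisms. -/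
noncomputable def coequalizerAct {M N : Mod C H} (f g : M ⟶ N) :
    H ⊗ coequalizer f.hom g.hom ⟶ coequalizer f.hom g.hom :=
  Cofork.IsColimit.desc (tensorCoequalizer H f.hom g.hom) (act N ≫ coequalizer.π f.hom g.hom) (by
    rw [← reassoc_of% act_hom f, ← reassoc_of% act_hom g, coequalizer.condition])

theorem π_coequalizerAct {M N : Mod C H} (f g : M ⟶ N) :
    H ◁ coequalizer.π f.hom g.hom ≫ coequalizerAct f g = act N ≫ coequalizer.π f.hom g.hom :=
  Cofork.IsColimit.π_desc' (tensorCoequalizer H f.hom g.hom) _ _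

/-- The coequalizer in `C` of two `H`-linear morphisms, with its induced `H`-action. -/
noncomputable def coequalizerMod {M N : Mod C H} (f g : M ⟶ N) : Mod C H :=
  have ha := π_coequalizerAct f g
  { X := coequalizer f.hom g.hom
    mod :=
      { smul := coequalizerAct f g
        one_smul := by
          change η[H] ▷ _ ≫ coequalizerAct f g = (λ_ _).hom
          have e : Epi (𝟙_ C ◁ coequalizer.π f.hom g.hom) :=
            inferInstanceAs (Epi ((tensorLeft (𝟙_ C)).map (coequalizer.π f.hom g.hom)))
          rw [← cancel_epi (𝟙_ C ◁ coequalizer.π f.hom g.hom), whisker_exchange_assoc, ha,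
            reassoc_of% one_act N, leftUnitor_naturality]
        mul_smul := by
          change μ[H] ▷ _ ≫ coequalizerAct f g =
            (α_ H H _).hom ≫ H ◁ coequalizerAct f g ≫ coequalizerAct f g
          have e : Epi ((H ⊗ H) ◁ coequalizer.π f.hom g.hom) :=
            inferInstanceAs (Epi ((tensorLeft (H ⊗ H)).map (coequalizer.π f.hom g.hom)))
          rw [← cancel_epi ((H ⊗ H) ◁ coequalizer.π f.hom g.hom), whisker_exchange_assoc, ha,
            reassoc_of% mul_act N, associator_naturality_right_assoc, ← whiskerLeft_comp_assoc,
            ha, whiskerLeft_comp, Category.assoc, ha] } }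

/-- A coequalizer of `H`-modules is stably a strong epimorphism in the underlying category. -/
theorem strongEpi_whiskerRight_of_isColimit {M N Q : Mod C H} {f g : M ⟶ N} {π : N ⟶ Q}
    {w : f ≫ π = g ≫ π} (hπ : IsColimit (Cofork.ofπ π w)) (X : C) : StrongEpi (π.hom ▷ X) := by
  have w' : f.hom ≫ π.hom = g.hom ≫ π.hom := congrArg Mod.Hom.hom w
  have hp : act N ≫ coequalizer.π f.hom g.hom =
      H ◁ coequalizer.π f.hom g.hom ≫ act (coequalizerMod f g) :=
    (π_coequalizerAct f g).symm
  let p : N ⟶ coequalizerMod f g := mkHom (coequalizer.π f.hom g.hom) hp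
  have e : Epi (H ◁ coequalizer.π f.hom g.hom) :=
    inferInstanceAs (Epi ((tensorLeft H).map (coequalizer.π f.hom g.hom)))
  have ht : coequalizerAct f g ≫ coequalizer.desc π.hom w' =
      H ◁ coequalizer.desc π.hom w' ≫ act Q := by
    rw [← cancel_epi (H ◁ coequalizer.π f.hom g.hom), reassoc_of% π_coequalizerAct f g,
      coequalizer.π_desc,
      ← whiskerLeft_comp_assoc, coequalizer.π_desc, act_hom]
  let t : coequalizerMod f g ⟶ Q := mkHom (coequalizer.desc π.hom w') ht
  have hpt : p ≫ t = π := by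
    ext
    exact coequalizer.π_desc _ _
  -- The universal property of `π` among modules provides the inverse of `t`, so `Q` is carried by
  -- the coequalizer in `C`.
  let s : Q ⟶ coequalizerMod f g := Cofork.IsColimit.desc hπ p (by
    ext
    exact coequalizer.condition f.hom g.hom)
  have hs : π ≫ s = p := Cofork.IsColimit.π_desc' hπ _ _
  have hst : s ≫ t = 𝟙 Q := by
    apply Cofork.IsColimit.hom_ext hπ
    change π ≫ s ≫ t = π ≫ 𝟙 Q
    rw [reassoc_of% hs, hpt, Category.comp_id]
  have hts : t.hom ≫ s.hom = 𝟙 _ := by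
    apply coequalizer.hom_ext
    change p.hom ≫ t.hom ≫ s.hom = p.hom ≫ 𝟙 _
    rw [← Category.assoc, Category.comp_id]
    change (p ≫ t).hom ≫ s.hom = p.hom
    rw [hpt]
    exact congrArg Mod.Hom.hom hs
  have ht : IsIso t.hom := ⟨s.hom, hts, congrArg Mod.Hom.hom hst⟩
  -- As `C` is closed and braided, `- ⊗ X` preserves coequalizers, so the coequalizer map stays a
  -- regular, hence strong, epimorphism.
  have hreg : IsRegularEpi (p.hom ▷ X) := ⟨⟨{
    W := M.X ⊗ X
    left := f.hom ▷ X
    right := g.hom ▷ X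
    w := by
      rw [← comp_whiskerRight, ← comp_whiskerRight]
      exact congrArg (· ▷ X) (coequalizer.condition f.hom g.hom)
    isColimit := isColimitCoforkMapOfIsColimit (tensorRight X)
      (coequalizer.condition f.hom g.hom) (coequalizerIsCoequalizer f.hom g.hom) }⟩⟩
  have h : π.hom ▷ X = p.hom ▷ X ≫ t.hom ▷ X := by
    rw [← comp_whiskerRight, ← hpt]
    rfl
  rw [h]
  infer_instance

end Coequalizers

/-! ### From `H`-Azumaya algebras to their underlying algebras -/

section Azumaya

/-- The exact pairing in `C` underlying an exact pairing of `H`-modules. -/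
@[reducible]
def underlyingPairing {H : C} [BimonObj H] (P A : Mod C H) [ExactPairing P A] :
    ExactPairing P.X A.X where
  coevaluation' := (η_ P A).hom
  evaluation' := (ε_ P A).hom
  coevaluation_evaluation' := congrArg Mod.Hom.hom (ExactPairing.coevaluation_evaluation P A)
  evaluation_coevaluation' := congrArg Mod.Hom.hom (ExactPairing.evaluation_coevaluation P A)

/-- The underlying algebra of an `H`-Azumaya algebra has a dual for which the first canonical
morphism is an isomorphism, and tensoring with it reflects isomorphisms. -/
theorem IsAzumayaAlg.underlying [MonoidalClosed C] [HasCoequalizers C] {H : C} [BimonObj H]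
    [HLinearBraiding H] {A : Mod C H} [MonObj A] (hA : IsAzumayaAlg A) :
    IsConservative A.X ∧ ∃ (P : C) (_ : ExactPairing P A.X), IsIso (azumayaLeft A.X P) := by
  obtain ⟨P, p, ⟨hε⟩, hl, -⟩ := hA
  let _ := underlyingPairing P A
  refine ⟨isConservative_of_strongEpi (P := P.X)
    (fun X => strongEpi_whiskerRight_of_isColimit hε X), P.X, inferInstance, ?_⟩
  -- The tensor product and braiding of modules are those of `C` on underlying objects, so the
  -- canonical morphism of `A.X` is the underlying morphism of that of `A`.
  exact ⟨(inv (azumayaLeft A P)).hom,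
    congrArg Mod.Hom.hom (IsIso.hom_inv_id (azumayaLeft A P)),
    congrArg Mod.Hom.hom (IsIso.inv_hom_id (azumayaLeft A P))⟩

end Azumaya

/-! ### Changing the basis of a left module -/

section BaseChange

variable {A S : C} [MonObj A] [MonObj S] (i : A ⟶ S) [IsMonHom i]

/-- For bases `p : X ⟶ S` and `q : Y ⟶ S` of `S` as a left `A`-module, the morphism
`S ⊗ X ⟶ S ⊗ Y`, `s ⊗ x ↦ s a ⊗ y` where `p x = a (q y)`. -/
noncomputable def changeBasis {X Y : C} (p : X ⟶ S) (q : Y ⟶ S) [IsIso (A ◁ q ≫ leftMul i)] :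
    S ⊗ X ⟶ S ⊗ Y :=
  S ◁ (p ≫ inv (A ◁ q ≫ leftMul i)) ≫ (α_ S A Y).inv ≫ (S ◁ i ≫ μ[S]) ▷ Y

/-- Both `S ⊗ X` and `S ⊗ Y` stand for `S ⊗_A S`, and `changeBasis` compares them without forming
the relative tensor product. -/
theorem changeBasis_comp {X Y : C} (p : X ⟶ S) (q : Y ⟶ S) [IsIso (A ◁ p ≫ leftMul i)]
    [IsIso (A ◁ q ≫ leftMul i)] : changeBasis i p q ≫ changeBasis i q p = 𝟙 _ := by
  -- Expanding `x` in the basis `q` and the result in the basis `p` must return `1 ⊗ x`, because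
  -- coordinates with respect to `p` are unique.
  have hv : (p ≫ inv (A ◁ q ≫ leftMul i)) ≫ A ◁ (q ≫ inv (A ◁ p ≫ leftMul i)) ≫
      (α_ A A X).inv ≫ μ[A] ▷ X = (λ_ X).inv ≫ η[A] ▷ X := by
    have e (v : Y ⟶ A ⊗ X) : A ◁ v ≫ (α_ A A X).inv ≫ μ[A] ▷ X ≫ A ◁ p ≫ leftMul i =
        A ◁ (v ≫ A ◁ p ≫ leftMul i) ≫ leftMul i := by
      simp only [whiskerLeft_comp, Category.assoc]
      rw [leftMul_leftMul, ← whisker_exchange_assoc, associator_inv_naturality_right_assoc]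
    rw [← cancel_mono (A ◁ p ≫ leftMul i)]
    simp only [Category.assoc]
    rw [e]
    simp only [Category.assoc, IsIso.inv_hom_id, Category.comp_id]
    rw [← whisker_exchange_assoc, one_leftMul_act, leftUnitor_naturality]
    simp
  have hR : (S ◁ i ≫ μ[S]) ▷ A ≫ S ◁ i ≫ μ[S] =
      (α_ S A A).hom ≫ S ◁ μ[A] ≫ S ◁ i ≫ μ[S] := by
    rw [comp_whiskerRight, Category.assoc, ← whisker_exchange_assoc, MonObj.mul_assoc,
      ← whiskerLeft_comp_assoc S μ[A], IsMonHom.mul_hom, MonoidalCategory.tensorHom_def]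
    simp
  have hη : S ◁ η[A] ≫ S ◁ i ≫ μ[S] = (ρ_ S).hom := by
    rw [← whiskerLeft_comp_assoc, IsMonHom.one_hom, MonObj.mul_one]
  simp only [changeBasis]
  generalize p ≫ inv (A ◁ q ≫ leftMul i) = v at *
  generalize q ≫ inv (A ◁ p ≫ leftMul i) = w at *
  generalize S ◁ i ≫ μ[S] = R at *
  have hv' := congrArg (fun t => S ◁ t ≫ (α_ S A X).inv ≫ R ▷ X) hv
  have hR' := congrArg (fun t => t ▷ X) hR
  have hη' := congrArg (fun t => t ▷ X) hη
  simp only [comp_whiskerRight] at hR' hη'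
  calc (S ◁ v ≫ (α_ S A Y).inv ≫ R ▷ Y) ≫ S ◁ w ≫ (α_ S A X).inv ≫ R ▷ X
      = S ◁ v ≫ S ◁ A ◁ w ≫ (α_ S A _).inv ≫ (α_ _ A X).inv ≫ R ▷ A ▷ X ≫ R ▷ X := by
        simp only [Category.assoc]
        rw [← whisker_exchange_assoc]
        monoidal
    _ = S ◁ (v ≫ A ◁ w ≫ (α_ A A X).inv ≫ μ[A] ▷ X) ≫ (α_ S A X).inv ≫ R ▷ X := by
        rw [hR']
        simp
    _ = _ := by
        rw [hv]
        simp only [whiskerLeft_comp, Category.assoc]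
        rw [associator_inv_naturality_middle_assoc, hη']
        simp

end BaseChange

/-! ### Descent of the Galois property -/

section Galois

variable {H : C} [HopfObj H] [HLinearBraiding H]

/-- The morphism `S ⊗ H ⟶ S ⊗ H`, `s ⊗ h ↦ s κ(h₁) ⊗ h₂`. -/
def mulComul {S : C} [MonObj S] (κ : H ⟶ S) : S ⊗ H ⟶ S ⊗ H :=
  S ◁ Δ[H] ≫ (α_ S H H).inv ≫ (S ◁ κ ≫ μ[S]) ▷ H

/-- By coassociativity the composite is `s ⊗ h ↦ s κ(h₁) θ(h₂) ⊗ h₃`: `mulComul` turns convolution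
into composition. -/
theorem mulComul_comp {S : C} [MonObj S] (κ θ : H ⟶ S)
    (h : Δ[H] ≫ (κ ⊗ₘ θ) ≫ μ[S] = ε[H] ≫ η[S]) : mulComul κ ≫ mulComul θ = 𝟙 _ := by
  have hΔ := ComonObj.comul_assoc H
  have h' := congrArg (fun t => S ◁ t ≫ μ[S]) h
  simp only [whiskerLeft_comp, MonoidalCategory.tensorHom_def, Category.assoc, MonObj.mul_one] at h'
  have h'' := congrArg (fun t => (α_ S H H).inv ≫ t ▷ H) h'
  simp only [comp_whiskerRight] at h''
  have hR : (S ◁ κ ≫ μ[S]) ▷ H ≫ S ◁ θ ≫ μ[S] =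
      (α_ S H H).hom ≫ S ◁ κ ▷ H ≫ S ◁ S ◁ θ ≫ S ◁ μ[S] ≫ μ[S] := by
    rw [comp_whiskerRight, Category.assoc, ← whisker_exchange_assoc, MonObj.mul_assoc]
    simp
  have hR' := congrArg (fun t => t ▷ H) hR
  simp only [comp_whiskerRight] at hR'
  have hS := congrArg (fun t => S ◁ t) hΔ
  simp only [whiskerLeft_comp] at hS
  simp only [mulComul]
  calc _ = S ◁ Δ[H] ≫ S ◁ H ◁ Δ[H] ≫ (α_ S H (H ⊗ H)).inv ≫ (α_ (S ⊗ H) H H).inv ≫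
        (S ◁ κ ≫ μ[S]) ▷ H ▷ H ≫ (S ◁ θ ≫ μ[S]) ▷ H := by
        simp only [Category.assoc]
        rw [← whisker_exchange_assoc]
        monoidal
    _ = S ◁ Δ[H] ≫ (α_ S H H).inv ≫ (S ◁ Δ[H]) ▷ H ≫ (S ◁ κ ▷ H) ▷ H ≫ (S ◁ S ◁ θ) ▷ H ≫
        (S ◁ μ[S]) ▷ H ≫ μ[S] ▷ H := by
        simp only [comp_whiskerRight]
        simp only [Category.assoc] at hR'
        simp only [Category.assoc]
        rw [hR', reassoc_of% hS]
        simp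
    _ = _ := by
        rw [h'']
        have := congrArg (fun t => S ◁ t) (ComonObj.counit_comul H)
        simp only [whiskerLeft_comp] at this
        rw [← associator_inv_naturality_middle_assoc, reassoc_of% this]
        simp

/-- Descent of the Galois property: `T` is Galois if a comodule algebra `S` with a conservative
coinvariant subalgebra `A` has two bases over `A`, one of them the comodule subalgebra `T`
and the other one the image of an algebra morphism from `H` that is colinear. -/
theorem isIso_can_of_bases {S T : ComodAlg H} {A : C} [MonObj A] [IsConservative A]
    (i : A ⟶ S.X) [IsMonHom i] (hi : i ≫ S.coact = (ρ_ A).inv ≫ (i ⊗ₘ η[H]))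
    (j : T ⟶ S) [IsIso (A ◁ j.hom ≫ leftMul i)]
    (κ : H ⟶ S.X) [IsMonHom κ] (hκ : κ ≫ S.coact = Δ[H] ≫ κ ▷ H)
    [IsIso (A ◁ κ ≫ leftMul i)] : IsIso T.can := by
  -- An algebra morphism out of `H` has a convolution inverse, its composite with the antipode.
  have hκ₁ : Δ[H] ≫ (κ ⊗ₘ HopfObj.antipode (X := H) ≫ κ) ≫ μ[S.X] = ε[H] ≫ η[S.X] := by
    have e : (κ ⊗ₘ HopfObj.antipode (X := H) ≫ κ) = H ◁ HopfObj.antipode ≫ (κ ⊗ₘ κ) := by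
      rw [← id_tensorHom, tensorHom_comp_tensorHom, Category.id_comp]
    rw [e, Category.assoc, ← IsMonHom.mul_hom, HopfObj.antipode_right_assoc, IsMonHom.one_hom]
  have hκ₂ : Δ[H] ≫ (HopfObj.antipode (X := H) ≫ κ ⊗ₘ κ) ≫ μ[S.X] = ε[H] ≫ η[S.X] := by
    have e : (HopfObj.antipode (X := H) ≫ κ ⊗ₘ κ) = HopfObj.antipode ▷ H ≫ (κ ⊗ₘ κ) := by
      rw [← tensorHom_id, tensorHom_comp_tensorHom, Category.id_comp]
    rw [e, Category.assoc, ← IsMonHom.mul_hom, HopfObj.antipode_left_assoc, IsMonHom.one_hom]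
  have : IsIso (mulComul κ) := ⟨mulComul (HopfObj.antipode (X := H) ≫ κ),
    mulComul_comp _ _ hκ₁, mulComul_comp _ _ hκ₂⟩
  have : IsIso (changeBasis i j.hom κ) :=
    ⟨changeBasis i κ j.hom, changeBasis_comp i _ _, changeBasis_comp i _ _⟩
  -- As `A` is coinvariant and `κ` colinear, the canonical morphism sends `s ⊗ a κ(h)` to `s a κ(h₁)
  -- ⊗ h₂`.
  have e₁ : S.X ◁ (A ◁ κ ≫ leftMul i) ≫ S.can =
      (α_ S.X A H).inv ≫ (S.X ◁ i ≫ μ[S.X]) ▷ H ≫ mulComul κ := by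
    have a : (A ◁ κ ≫ leftMul i) ≫ S.coact =
        A ◁ Δ[H] ≫ A ◁ κ ▷ H ≫ (α_ A S.X H).inv ≫ leftMul i ▷ H := by
      rw [Category.assoc, leftMul_coact S i hi, ← whiskerLeft_comp_assoc, hκ, whiskerLeft_comp,
        Category.assoc]
    have b : S.X ◁ leftMul i ≫ μ[S.X] =
        (α_ S.X A S.X).inv ≫ (S.X ◁ i ≫ μ[S.X]) ▷ S.X ≫ μ[S.X] := by
      simp [leftMul]
    rw [ComodAlg.can, ← whiskerLeft_comp_assoc, a, mulComul]
    generalize S.X ◁ i ≫ μ[S.X] = R at *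
    have b' := congrArg (fun t => t ▷ H) b
    simp only [comp_whiskerRight] at b'
    simp only [whiskerLeft_comp, comp_whiskerRight, Category.assoc]
    rw [associator_inv_naturality_middle_assoc, b', ← whisker_exchange_assoc,
      associator_inv_naturality_left_assoc, ← comp_whiskerRight_assoc (R ▷ H),
      ← whisker_exchange]
    monoidal
  have e₂ : changeBasis i j.hom κ ≫ mulComul κ = S.X ◁ j.hom ≫ S.can := by
    rw [changeBasis]
    simp only [Category.assoc]
    rw [← e₁, ← whiskerLeft_comp_assoc]
    simp
  -- Under `A ⊗ T ≅ S`, the morphism `A ◁ T.can` becomes the canonical morphism of `S` restricted to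
  -- `S ⊗ T`, which `e₂` shows to be invertible.
  have e₃ : A ◁ T.can ≫ (α_ A T.X H).inv ≫ (A ◁ j.hom ≫ leftMul i) ▷ H =
      (α_ A T.X T.X).inv ≫ (A ◁ j.hom ≫ leftMul i) ▷ T.X ≫ S.X ◁ j.hom ≫ S.can := by
    have a : A ◁ μ[T.X] ≫ A ◁ j.hom ≫ leftMul i =
        (α_ A T.X T.X).inv ≫ (A ◁ j.hom ≫ leftMul i) ▷ T.X ≫ S.X ◁ j.hom ≫ μ[S.X] := by
      rw [← whiskerLeft_comp_assoc, IsMonHom.mul_hom, whiskerLeft_comp, Category.assoc,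
        mul_leftMul, MonoidalCategory.tensorHom_def, comp_whiskerRight, Category.assoc,
        ← whisker_exchange_assoc]
      simp
    rw [ComodAlg.can, ComodAlg.can, ← whiskerLeft_comp_assoc, ← j.colinear]
    generalize A ◁ j.hom ≫ leftMul i = t at *
    have a' := congrArg (fun t => t ▷ H) a
    simp only [comp_whiskerRight] at a'
    simp only [whiskerLeft_comp, Category.assoc]
    rw [associator_inv_naturality_middle_assoc, a', ← whisker_exchange_assoc]
    monoidal
  have : IsIso (A ◁ T.can) := by
    rw [← e₂] at e₃
    have : IsIso ((A ◁ T.can) ≫ (α_ A T.X H).inv ≫ (A ◁ j.hom ≫ leftMul i) ▷ H) := by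
      rw [e₃]
      infer_instance
    exact IsIso.of_isIso_comp_right _ ((α_ A T.X H).inv ≫ (A ◁ j.hom ≫ leftMul i) ▷ H)
  exact isIso_of_whiskerLeft A T.can

end Galois

/-! ### The subalgebras `A` and `H` of the smash product -/

section SmashStructure

variable {H : C} [BimonObj H] (A : Mod C H) [MonObj A]

theorem leftMul_smashIncl : leftMul (smashIncl A) = smashLeft A := by
  change ((ρ_ A.X).inv ≫ A.X ◁ η[H]) ▷ (A.X ⊗ H) ≫ smashMul A = smashLeft A
  rw [smashMul, comp_whiskerRight, Category.assoc, associator_naturality_middle_assoc,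
    ← whiskerLeft_comp_assoc, smashAct_one]
  monoidal

instance : IsMonHom (smashIncl A) where
  one_hom := by
    change η[A.X] ≫ (ρ_ A.X).inv ≫ A.X ◁ η[H] = smashOne A
    simp [smashOne, MonoidalCategory.tensorHom_def, unitors_inv_equal]
  mul_hom := by
    have h : (smashIncl A ⊗ₘ smashIncl A) ≫ μ[(smash A).X] =
        A.X ◁ smashIncl A ≫ leftMul (smashIncl A) := by
      rw [MonoidalCategory.tensorHom_def', Category.assoc]
      rfl
    rw [h, leftMul_smashIncl]
    change μ[A.X] ≫ (ρ_ A.X).inv ≫ A.X ◁ η[H] =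
      A.X ◁ ((ρ_ A.X).inv ≫ A.X ◁ η[H]) ≫ (α_ A.X A.X H).inv ≫ μ[A.X] ▷ H
    rw [whiskerLeft_comp, Category.assoc, associator_inv_naturality_right_assoc,
      whisker_exchange]
    monoidal

/-- The embedding `h ↦ 1 # h` of `H` into the smash product. -/
def smashInclH : H ⟶ (smash A).X := (λ_ H).inv ≫ η[A.X] ▷ H

theorem leftMul_smashInclH : leftMul (smashInclH A) = smashAct A := by
  change ((λ_ H).inv ≫ η[A.X] ▷ H) ▷ (A.X ⊗ H) ≫ smashMul A = smashAct A
  rw [smashMul, comp_whiskerRight, Category.assoc, associator_naturality_left_assoc,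
    ← whisker_exchange_assoc, smashLeft, associator_inv_naturality_left_assoc,
    ← comp_whiskerRight, MonObj.one_mul]
  monoidal

instance : IsMonHom (smashInclH A) where
  one_hom := by
    change η[H] ≫ (λ_ H).inv ≫ η[A.X] ▷ H = smashOne A
    simp [smashOne, MonoidalCategory.tensorHom_def']
  mul_hom := by
    have h : (smashInclH A ⊗ₘ smashInclH A) ≫ μ[(smash A).X] =
        H ◁ smashInclH A ≫ leftMul (smashInclH A) := by
      rw [MonoidalCategory.tensorHom_def', Category.assoc]
      rfl
    rw [h, leftMul_smashInclH]
    exact (smashAct_unit A).symm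

theorem smashInclH_coact : smashInclH A ≫ (smash A).coact = Δ[H] ≫ smashInclH A ▷ H := by
  change ((λ_ H).inv ≫ η[A.X] ▷ H) ≫ A.X ◁ Δ[H] ≫ (α_ A.X H H).inv =
    Δ[H] ≫ ((λ_ H).inv ≫ η[A.X] ▷ H) ▷ H
  rw [Category.assoc, ← whisker_exchange_assoc]
  monoidal

theorem smash_basis : A.X ◁ smashInclH A ≫ leftMul (smashIncl A) = 𝟙 _ := by
  rw [leftMul_smashIncl]
  change A.X ◁ ((λ_ H).inv ≫ η[A.X] ▷ H) ≫ (α_ A.X A.X H).inv ≫ μ[A.X] ▷ H = 𝟙 _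
  rw [whiskerLeft_comp, Category.assoc, associator_inv_naturality_middle_assoc,
    ← comp_whiskerRight, MonObj.mul_one]
  simp

end SmashStructure

/-- A comodule algebra `T` over `A # H` with `A ⊗ T ≅ A # H` is Galois, if `A` is faithfully
flat. -/
theorem isGaloisObj_of_smash [HasEqualizers C] {H : C} [HopfObj H] [HLinearBraiding H] [IsFlat H]
    (A : Mod C H) [MonObj A] [IsFlat A.X] [IsConservative A.X] {T : ComodAlg H} (j : T ⟶ smash A)
    [h : IsIso (A.X ◁ j.hom ≫ leftMul (smashIncl A))] : IsGaloisObj T where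
  faithfullyFlat :=
    have e : A.X ⊗ T.X ≅ (smash A).X := asIso (A.X ◁ j.hom ≫ leftMul (smashIncl A))
    isFaithfullyFlat_of_iso (Y := H) e
  isIso_can :=
    have : IsIso (A.X ◁ smashInclH A ≫ leftMul (smashIncl A)) := by
      rw [smash_basis]
      exact inferInstanceAs (IsIso (𝟙 (A.X ⊗ H)))
    isIso_can_of_bases (smashIncl A) (smashIncl_coact A) j (smashInclH A) (smashInclH_coact A)

/-! ### Splitting the smash product of a tensor product -/

section SmashTensor

/-- The morphism `a ⊗ b ⊗ h ↦ (a ⊗ h₁) ⊗ (b ⊗ h₂)`. -/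
def comulSplit (H : C) [BimonObj H] (A B : C) : (A ⊗ B) ⊗ H ⟶ (A ⊗ H) ⊗ (B ⊗ H) :=
  (A ⊗ B) ◁ Δ[H] ≫ tensorμ A B H H

variable {H : C} [BimonObj H] (A B : Mod C H)

/-- The morphism `(a ⊗ b) # h ↦ (a # h₁) ⊗ (b # h₂)`. -/
def smashSplit : (A ⊗ B).X ⊗ H ⟶ (A.X ⊗ H) ⊗ (B.X ⊗ H) :=
  comulSplit H A.X B.X

variable [HLinearBraiding H]

/-- The splitting is composed of `comulHom` and an interchange in the braided category of modules,
so it is `H`-linear. -/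
theorem smashSplit_act : diagAct (diagAct (act A) (act B)) μ[H] ≫ smashSplit A B =
    H ◁ smashSplit A B ≫ diagAct (diagAct (act A) μ[H]) (diagAct (act B) μ[H]) :=
  act_hom ((A ⊗ B) ◁ comulHom ≫ tensorμ A B (Mod.regular H) (Mod.regular H))

end SmashTensor

section SmashTensorAlg

variable {H : C} [BimonObj H] [HLinearBraiding H] (A B : Mod C H) [MonObj A] [MonObj B]

theorem smashSplit_left : smashLeft (A ⊗ B) ≫ smashSplit A B = (A.X ⊗ B.X) ◁ smashSplit A B ≫
    tensorμ A.X B.X (A.X ⊗ H) (B.X ⊗ H) ≫ (smashLeft A ⊗ₘ smashLeft B) := by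
  have h := tensor_associativity A.X B.X A.X B.X H H
  have e : (smashLeft A ⊗ₘ smashLeft B) =
      ((α_ A.X A.X H).inv ⊗ₘ (α_ B.X B.X H).inv) ≫ (μ[A.X] ▷ H ⊗ₘ μ[B.X] ▷ H) := by
    simp only [smashLeft, tensorHom_comp_tensorHom]
  change ((α_ (A.X ⊗ B.X) (A.X ⊗ B.X) H).inv ≫
    (tensorμ A.X B.X A.X B.X ≫ (μ[A.X] ⊗ₘ μ[B.X])) ▷ H) ≫ (A.X ⊗ B.X) ◁ Δ[H] ≫
      tensorμ A.X B.X H H = (A.X ⊗ B.X) ◁ ((A.X ⊗ B.X) ◁ Δ[H] ≫ tensorμ A.X B.X H H) ≫ _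
  rw [e, Category.assoc, ← whisker_exchange_assoc, comp_whiskerRight, Category.assoc,
    tensorμ_natural_left, ← associator_inv_naturality_right_assoc, whiskerLeft_comp,
    Category.assoc]
  have h' := congrArg (fun t => (α_ (A.X ⊗ B.X) (A.X ⊗ B.X) (H ⊗ H)).inv ≫ t ≫
    ((α_ A.X A.X H).inv ⊗ₘ (α_ B.X B.X H).inv)) h
  simp only [Category.assoc, Iso.inv_hom_id_assoc, tensorHom_comp_tensorHom, Iso.hom_inv_id,
    id_tensorHom_id, Category.comp_id] at h'
  rw [← reassoc_of% h']

/-- For arbitrary actions and multiplications this needs only the coherence `tensor_associativity`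
of the interchange; keeping them abstract separates it from the smash product. -/
theorem comul_tensorμ_mul {A B S T : C} (a : H ⊗ S ⟶ S) (b : H ⊗ T ⟶ T) (l : A ⊗ S ⟶ S)
    (m : B ⊗ T ⟶ T) :
    ((A ⊗ B) ◁ Δ[H] ≫ tensorμ A B H H) ▷ (S ⊗ T) ≫ tensorμ (A ⊗ H) (B ⊗ H) S T ≫
        ((α_ A H S).hom ≫ A ◁ a ≫ l ⊗ₘ (α_ B H T).hom ≫ B ◁ b ≫ m) =
      (α_ (A ⊗ B) H (S ⊗ T)).hom ≫ (A ⊗ B) ◁ diagAct a b ≫ tensorμ A B S T ≫ (l ⊗ₘ m) := by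
  have h := tensor_associativity A B H H S T
  simp only [← tensorHom_comp_tensorHom]
  rw [comp_whiskerRight, Category.assoc, reassoc_of% h, ← tensorμ_natural_right_assoc,
    associator_naturality_middle_assoc, diagAct]
  simp only [whiskerLeft_comp, Category.assoc]

theorem smashSplit_mul : smashMul (A ⊗ B) ≫ smashSplit A B =
    (smashSplit A B ⊗ₘ smashSplit A B) ≫ tensorμ (A.X ⊗ H) (B.X ⊗ H) (A.X ⊗ H) (B.X ⊗ H) ≫
      (smashMul A ⊗ₘ smashMul B) := by
  have e₂ : smashAct (A ⊗ B) ≫ smashSplit A B =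
      H ◁ smashSplit A B ≫ diagAct (smashAct A) (smashAct B) := smashSplit_act A B
  rw [MonoidalCategory.tensorHom_def', Category.assoc]
  refine Eq.trans ?_ (congrArg (fun t => (((A ⊗ B).X ⊗ H) ◁ smashSplit A B) ≫ t)
    (comul_tensorμ_mul (smashAct A) (smashAct B) (smashLeft A) (smashLeft B))).symm
  rw [smashMul, Category.assoc, Category.assoc, smashSplit_left]
  change _ ≫ (A.X ⊗ B.X) ◁ _ ≫ (A.X ⊗ B.X) ◁ _ ≫ _ = (((A.X ⊗ B.X) ⊗ H) ◁ smashSplit A B) ≫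
    _ ≫ (A.X ⊗ B.X) ◁ diagAct (smashAct A) (smashAct B) ≫ _
  rw [associator_naturality_right_assoc]
  refine congrArg (fun t => (α_ (A.X ⊗ B.X) H ((A.X ⊗ B.X) ⊗ H)).hom ≫ t) ?_
  rw [← whiskerLeft_comp_assoc, ← whiskerLeft_comp_assoc]
  exact congrArg (fun t => (A.X ⊗ B.X) ◁ t ≫ _) e₂

end SmashTensorAlg

/-! ### The splitting as a cotensor product -/

section Split

variable {H : C} [BimonObj H]

theorem comulSplit_coact (A B : C) :
    ((A ⊗ B) ◁ Δ[H] ≫ (α_ (A ⊗ B) H H).inv) ≫ comulSplit H A B ▷ H =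
      comulSplit H A B ≫ (A ⊗ H) ◁ (B ◁ Δ[H] ≫ (α_ B H H).inv) ≫ (α_ (A ⊗ H) (B ⊗ H) H).inv := by
  have h := congrArg (fun t => (A ⊗ B) ◁ t) (ComonObj.comul_assoc H)
  simp only [whiskerLeft_comp] at h
  have e : tensorμ A B H H ≫ (A ⊗ H) ◁ B ◁ Δ[H] =
      (A ⊗ B) ◁ H ◁ Δ[H] ≫ tensorμ A B H (H ⊗ H) := by
    have := tensorμ_natural_right A B (𝟙 H) Δ[H]
    simp only [id_tensorHom, whiskerLeft_id] at this
    exact this.symm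
  simp only [comulSplit, comp_whiskerRight, Category.assoc, whiskerLeft_comp]
  rw [reassoc_of% e, reassoc_of% h, ← associator_inv_naturality_middle_assoc]
  simp only [tensorμ]
  monoidal

theorem comulSplit_one {A B : C} (a : 𝟙_ C ⟶ A) (b : 𝟙_ C ⟶ B) :
    ((λ_ (𝟙_ C)).inv ≫ (((λ_ (𝟙_ C)).inv ≫ (a ⊗ₘ b)) ⊗ₘ η[H])) ≫ comulSplit H A B =
      (λ_ (𝟙_ C)).inv ≫ (((λ_ (𝟙_ C)).inv ≫ (a ⊗ₘ η[H])) ⊗ₘ ((λ_ (𝟙_ C)).inv ≫ (b ⊗ₘ η[H]))) := by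
  have h : η[H] ≫ Δ[H] = (λ_ (𝟙_ C)).inv ≫ (η[H] ⊗ₘ η[H]) := BimonObj.one_comul H
  have e : (((λ_ (𝟙_ C)).inv ≫ (a ⊗ₘ b)) ⊗ₘ η[H]) ≫ (A ⊗ B) ◁ Δ[H] =
      ((λ_ (𝟙_ C)).inv ⊗ₘ (λ_ (𝟙_ C)).inv) ≫ ((a ⊗ₘ b) ⊗ₘ (η[H] ⊗ₘ η[H])) := by
    rw [← id_tensorHom, tensorHom_comp_tensorHom, Category.comp_id, h, tensorHom_comp_tensorHom]
  have e' : tensorμ (𝟙_ C) (𝟙_ C) (𝟙_ C) (𝟙_ C) = 𝟙 _ := by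
    simp only [tensorμ, braiding_tensorUnit_left]
    monoidal
  rw [comulSplit, Category.assoc, reassoc_of% e, tensorμ_natural, e', Category.id_comp,
    tensorHom_comp_tensorHom]

theorem rightUnitor_comulSplit (A B : C) :
    ((ρ_ (A ⊗ B)).inv ≫ (A ⊗ B) ◁ η[H]) ≫ comulSplit H A B =
      ((ρ_ A).inv ≫ A ◁ η[H] ⊗ₘ (ρ_ B).inv ≫ B ◁ η[H]) := by
  have h : η[H] ≫ Δ[H] = (λ_ (𝟙_ C)).inv ≫ (η[H] ⊗ₘ η[H]) := BimonObj.one_comul H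
  have e : (ρ_ (A ⊗ B)).inv ≫ (A ⊗ B) ◁ (λ_ (𝟙_ C)).inv ≫ tensorμ A B (𝟙_ C) (𝟙_ C) =
      ((ρ_ A).inv ⊗ₘ (ρ_ B).inv) := by
    simp only [tensorμ, braiding_tensorUnit_right]
    monoidal
  rw [comulSplit, Category.assoc, ← whiskerLeft_comp_assoc, h, whiskerLeft_comp, Category.assoc,
    tensorμ_natural_right, reassoc_of% e, tensorHom_comp_tensorHom]

/-- The morphism `(a ⊗ h) ⊗ (b ⊗ k) ↦ ε(h) a ⊗ b ⊗ k`. -/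
def counitMerge (H : C) [BimonObj H] (A B : C) : (A ⊗ H) ⊗ (B ⊗ H) ⟶ (A ⊗ B) ⊗ H :=
  (A ◁ ε[H] ≫ (ρ_ A).hom) ▷ (B ⊗ H) ≫ (α_ A B H).inv

theorem comulSplit_counitMerge (A B : C) : comulSplit H A B ≫ counitMerge H A B = 𝟙 _ := by
  have e : tensorμ A B H H ≫ (A ◁ ε[H]) ▷ (B ⊗ H) =
      (A ⊗ B) ◁ ε[H] ▷ H ≫ tensorμ A B (𝟙_ C) H := by
    have := tensorμ_natural_right A B ε[H] (𝟙 H)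
    simp only [tensorHom_id, whiskerLeft_id] at this
    exact this.symm
  simp only [comulSplit, counitMerge, comp_whiskerRight, Category.assoc]
  rw [reassoc_of% e, ← whiskerLeft_comp_assoc, ComonObj.counit_comul]
  simp only [tensorμ, braiding_tensorUnit_right]
  monoidal

instance (A B : C) : Mono (comulSplit H A B) :=
  mono_of_mono_fac (comulSplit_counitMerge A B)

variable [HLinearBraiding H]

/-- The left coaction yields `h₂` before `h₁`, the splitting `h₁` before `h₂`; cocommutativity of
`H` identifies them. -/
theorem whiskerLeft_leftCoact_comul (A B : C) :
    A ◁ ((B ◁ Δ[H] ≫ (α_ B H H).inv) ≫ (β_ (B ⊗ H) H).hom) ≫ (α_ A H (B ⊗ H)).inv =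
      (α_ A B H).inv ≫ comulSplit H A B := by
  have hc := congrArg (fun t => (A ⊗ B) ◁ t) (cocomm (H := H))
  simp only [whiskerLeft_comp] at hc
  rw [BraidedCategory.braiding_tensor_left_hom, comulSplit, ← hc]
  simp only [tensorμ]
  monoidal

/-- `comulSplit` exhibits `A ⊗ B ⊗ H` as the cotensor product of `A ⊗ H` and `B ⊗ H`. -/
theorem comulSplit_fac {A B X : C} (x : X ⟶ (A ⊗ H) ⊗ (B ⊗ H))
    (h : x ≫ (A ◁ Δ[H] ≫ (α_ A H H).inv) ▷ (B ⊗ H) =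
      x ≫ (A ⊗ H) ◁ ((B ◁ Δ[H] ≫ (α_ B H H).inv) ≫ (β_ (B ⊗ H) H).hom) ≫
        (α_ (A ⊗ H) H (B ⊗ H)).inv) :
    x ≫ counitMerge H A B ≫ comulSplit H A B = x := by
  have e₁ : (A ◁ Δ[H] ≫ (α_ A H H).inv) ≫ (A ◁ ε[H] ≫ (ρ_ A).hom) ▷ H = 𝟙 _ := by
    rw [comp_whiskerRight, Category.assoc, ← associator_inv_naturality_middle_assoc,
      ← whiskerLeft_comp_assoc, ComonObj.counit_comul]
    monoidal
  -- Applying the counit to the original factor `H` beside `A` returns `x` on the left, and on the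
  -- right leaves the left coaction of `B ⊗ H`, which is the splitting.
  have h' := congrArg (fun t => t ≫ (A ◁ ε[H] ≫ (ρ_ A).hom) ▷ H ▷ (B ⊗ H)) h
  simp only [Category.assoc] at h'
  rw [← comp_whiskerRight, e₁, id_whiskerRight, Category.comp_id] at h'
  conv_rhs => rw [h']
  rw [counitMerge, Category.assoc, ← whiskerLeft_leftCoact_comul,
    ← associator_inv_naturality_left, whisker_exchange_assoc]
  simp only [Category.assoc]

end Split

section SmashSplit

variable {H : C} [BimonObj H] [HLinearBraiding H] (A B : Mod C H) [MonObj A] [MonObj B]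

/-- The morphism of comodule algebras `(a ⊗ b) # h ↦ (a # h₁) ⊗ (b # h₂)`. -/
def smashSplitHom : smash (A ⊗ B) ⟶ tensorComodAlg (smash A) (smash B) where
  hom := comulSplit H A.X B.X
  isMonHom :=
    { one_hom := comulSplit_one η[A.X] η[B.X]
      mul_hom := smashSplit_mul A B }
  colinear := comulSplit_coact A.X B.X

instance : Mono (smashSplitHom A B).hom := inferInstanceAs (Mono (comulSplit H A.X B.X))

theorem smashIncl_smashSplit : smashIncl (A ⊗ B) ≫ (smashSplitHom A B).hom =
    (smashIncl A ⊗ₘ smashIncl B) :=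
  rightUnitor_comulSplit A.X B.X

theorem smashSplitHom_fac {X : C} (x : X ⟶ (smash A).X ⊗ (smash B).X)
    (h : x ≫ (smash A).coact ▷ (smash B).X =
      x ≫ (smash A).X ◁ leftCoact (smash B) ≫ (α_ (smash A).X H (smash B).X).inv) :
    ∃ y, y ≫ (smashSplitHom A B).hom = x :=
  ⟨x ≫ counitMerge H A.X B.X, (Category.assoc _ _ _).trans (comulSplit_fac x h)⟩

end SmashSplit

/-! ### Inclusions and universal properties of commutants and cotensor products -/

section Sub

variable [HasEqualizers C] {H : C} [BimonObj H] [IsFlat H]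

/-- The inclusion of an equalizer as a comodule subalgebra. -/
noncomputable def subComodAlgHom (M : ComodAlg H) {N : C} (f g : M.X ⟶ N)
    (h₁ : η[M.X] ≫ f = η[M.X] ≫ g)
    (h₂ : (equalizer.ι f g ⊗ₘ equalizer.ι f g) ≫ μ[M.X] ≫ f =
      (equalizer.ι f g ⊗ₘ equalizer.ι f g) ≫ μ[M.X] ≫ g)
    (h₃ : equalizer.ι f g ≫ M.coact ≫ f ▷ H = equalizer.ι f g ≫ M.coact ≫ g ▷ H) :
    subComodAlg M f g h₁ h₂ h₃ ⟶ M where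
  hom := equalizer.ι f g
  isMonHom :=
    { one_hom := equalizer.lift_ι _ _
      mul_hom := equalizer.lift_ι _ _ }
  colinear := Fork.IsLimit.lift_ι' (equalizerTensor f g) _ _

end Sub

section Commutant

variable [HasEqualizers C] [MonoidalClosed C] {H : C} [BimonObj H] [IsFlat H] [HLinearBraiding H]
  (M : ComodAlg H) {A : C} (hA : IsFinite A) (i : A ⟶ M.X)
  (hi : i ≫ M.coact = (ρ_ A).inv ≫ (i ⊗ₘ η[H]))

/-- The inclusion of the commutant. -/
noncomputable def commutantHom : commutant M hA i hi ⟶ M where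
  hom := equalizer.ι (MonoidalClosed.curry (leftMul i)) (MonoidalClosed.curry (rightMul i))
  isMonHom :=
    { one_hom := equalizer.lift_ι _ _
      mul_hom := equalizer.lift_ι _ _ }
  colinear := Fork.IsLimit.lift_ι' (equalizerTensor (MonoidalClosed.curry (leftMul i))
    (MonoidalClosed.curry (rightMul i))) _ _

theorem commutantHom_comm : A ◁ (commutantHom M hA i hi).hom ≫ leftMul i =
    A ◁ (commutantHom M hA i hi).hom ≫ rightMul i := by
  apply MonoidalClosed.curry_injective
  rw [MonoidalClosed.curry_natural_left, MonoidalClosed.curry_natural_left]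
  exact equalizer.condition (MonoidalClosed.curry (leftMul i)) (MonoidalClosed.curry (rightMul i))

theorem mono_commutantHom_whiskerRight (Z : C) [IsFlat Z] :
    Mono ((commutantHom M hA i hi).hom ▷ Z) :=
  mono_tensor (MonoidalClosed.curry (leftMul i)) (MonoidalClosed.curry (rightMul i))

theorem commutantHom_fac {X : C} (x : X ⟶ M.X)
    (h : A ◁ x ≫ leftMul i = A ◁ x ≫ rightMul i) :
    ∃ y, y ≫ (commutantHom M hA i hi).hom = x :=
  ⟨equalizer.lift x (by
    rw [← MonoidalClosed.curry_natural_left, h, MonoidalClosed.curry_natural_left]),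
    equalizer.lift_ι _ _⟩

/-- Flatness of `Z` preserves the defining equalizer, and finiteness of `A` allows morphisms into
`[A, M] ⊗ Z` to be compared after evaluation (`curry_cancel`). -/
theorem commutantHom_whiskerRight_fac (Z : C) [IsFlat Z] {X : C} (x : X ⟶ M.X ⊗ Z)
    (h : A ◁ x ≫ (α_ A M.X Z).inv ≫ leftMul i ▷ Z = A ◁ x ≫ (α_ A M.X Z).inv ≫ rightMul i ▷ Z) :
    ∃ y, y ≫ (commutantHom M hA i hi).hom ▷ Z = x :=
  ⟨Fork.IsLimit.lift (equalizerTensor (H := Z) (MonoidalClosed.curry (leftMul i))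
    (MonoidalClosed.curry (rightMul i))) x (by
      apply curry_cancel hA
      have e (t : A ⊗ M.X ⟶ M.X) : A ◁ (MonoidalClosed.curry t) ▷ Z ≫ (α_ A _ Z).inv ≫
          (ihom.ev A).app M.X ▷ Z = (α_ A M.X Z).inv ≫ t ▷ Z := by
        rw [associator_inv_naturality_middle_assoc, ← comp_whiskerRight,
          ← MonoidalClosed.uncurry_eq, MonoidalClosed.uncurry_curry]
      simp only [whiskerLeft_comp, Category.assoc]
      rw [e, e, h]), Fork.IsLimit.lift_ι' _ _ _⟩

/-- The inverse braiding moves `Z` to the right, which reduces this to the preceding version. -/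
theorem commutantHom_whiskerLeft_fac (Z : C) [IsFlat Z] {X : C} (x : X ⟶ Z ⊗ M.X)
    (h : A ◁ x ≫ (α_ A Z M.X).inv ≫ (β_ A Z).hom ▷ M.X ≫ (α_ Z A M.X).hom ≫ Z ◁ leftMul i =
      A ◁ x ≫ (α_ A Z M.X).inv ≫ (β_ A Z).hom ▷ M.X ≫ (α_ Z A M.X).hom ≫ Z ◁ rightMul i) :
    ∃ y, y ≫ Z ◁ (commutantHom M hA i hi).hom = x := by
  have e (t : A ⊗ M.X ⟶ M.X) : A ◁ (x ≫ (β_ M.X Z).inv) ≫ (α_ A M.X Z).inv ≫ t ▷ Z =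
      (A ◁ x ≫ (α_ A Z M.X).inv ≫ (β_ A Z).hom ▷ M.X ≫ (α_ Z A M.X).hom ≫ Z ◁ t) ≫
        (β_ M.X Z).inv := by
    rw [Iso.eq_comp_inv]
    simp only [Category.assoc, BraidedCategory.braiding_naturality_left,
      BraidedCategory.braiding_tensor_left_hom, Iso.inv_hom_id_assoc, whiskerLeft_comp,
      whiskerLeft_inv_hom_assoc]
  obtain ⟨y, hy⟩ := commutantHom_whiskerRight_fac M hA i hi Z (x ≫ (β_ M.X Z).inv)
    (by rw [e, e, h])
  refine ⟨y ≫ (β_ _ Z).hom, ?_⟩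
  rw [Category.assoc, ← BraidedCategory.braiding_naturality_left, reassoc_of% hy]
  simp

end Commutant

section Cotensor

variable [HasEqualizers C] {H : C} [BimonObj H] [IsFlat H] [HLinearBraiding H] (S T : ComodAlg H)

/-- The inclusion of the cotensor product into the tensor product. -/
noncomputable def cotensorHom : cotensor S T ⟶ tensorComodAlg S T :=
  subComodAlgHom (tensorComodAlg S T) (S.coact ▷ T.X)
    (S.X ◁ leftCoact T ≫ (α_ S.X H T.X).inv) _ _ _

theorem cotensorHom_condition : (cotensorHom S T).hom ≫ S.coact ▷ T.X =
    (cotensorHom S T).hom ≫ S.X ◁ leftCoact T ≫ (α_ S.X H T.X).inv :=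
  equalizer.condition _ _

theorem mono_cotensorHom_whiskerRight (Z : C) [IsFlat Z] :
    Mono ((cotensorHom S T).hom ▷ Z) :=
  mono_tensor (S.coact ▷ T.X) (S.X ◁ leftCoact T ≫ (α_ S.X H T.X).inv)

theorem cotensorHom_fac {X : C} (x : X ⟶ S.X ⊗ T.X)
    (h : x ≫ S.coact ▷ T.X = x ≫ S.X ◁ leftCoact T ≫ (α_ S.X H T.X).inv) :
    ∃ y, y ≫ (cotensorHom S T).hom = x :=
  ⟨equalizer.lift x h, equalizer.lift_ι _ _⟩

/-- Tensoring with a flat object preserves the equalizer that defines the cotensor product. -/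
theorem whiskerLeft_cotensorHom_fac (Z : C) [IsFlat Z] {X : C} (x : X ⟶ Z ⊗ (S.X ⊗ T.X))
    (h : x ≫ Z ◁ S.coact ▷ T.X = x ≫ Z ◁ (S.X ◁ leftCoact T ≫ (α_ S.X H T.X).inv)) :
    ∃ y, y ≫ Z ◁ (cotensorHom S T).hom = x := by
  have := IsFlat.preserves (X := Z)
  have hl := isLimitForkMapOfIsLimit (tensorLeft Z) (equalizer.condition (S.coact ▷ T.X)
    (S.X ◁ leftCoact T ≫ (α_ S.X H T.X).inv)) (equalizerIsEqualizer _ _)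
  exact ⟨Fork.IsLimit.lift hl x h, Fork.IsLimit.lift_ι' hl _ _⟩

theorem mono_whiskerLeft_cotensorHom (Z : C) [IsFlat Z] :
    Mono (Z ◁ (cotensorHom S T).hom) := by
  have := IsFlat.preserves (X := Z)
  exact mono_of_isLimit_fork (isLimitForkMapOfIsLimit (tensorLeft Z)
    (equalizer.condition (S.coact ▷ T.X) (S.X ◁ leftCoact T ≫ (α_ S.X H T.X).inv))
      (equalizerIsEqualizer _ _))

end Cotensor

/-! ### Comparing comodule subalgebras -/

section Iso

/-- Comodule algebras that are embedded in the same way into a comodule algebra `M` are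
isomorphic. -/
theorem nonempty_iso_of_mono {H : C} [BimonObj H] {M S T : ComodAlg H} (f : S ⟶ M) (g : T ⟶ M)
    [Mono f.hom] [Mono g.hom] [Mono (g.hom ▷ H)] (u : S.X ⟶ T.X) (hu : u ≫ g.hom = f.hom)
    (v : T.X ⟶ S.X) (hv : v ≫ f.hom = g.hom) [Mono (f.hom ▷ H)] :
    ∃ e : S ≅ T, e.hom.hom = u := by
  have key {S T : ComodAlg H} (f : S ⟶ M) (g : T ⟶ M) [Mono g.hom] [Mono (g.hom ▷ H)]
      (u : S.X ⟶ T.X) (hu : u ≫ g.hom = f.hom) : ∃ e : S ⟶ T, e.hom = u := by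
    refine ⟨{
      hom := u
      isMonHom :=
        { one_hom := by
            rw [← cancel_mono g.hom, Category.assoc, hu, IsMonHom.one_hom, IsMonHom.one_hom]
          mul_hom := by
            rw [← cancel_mono g.hom, Category.assoc, Category.assoc, hu, IsMonHom.mul_hom,
              IsMonHom.mul_hom, tensorHom_comp_tensorHom_assoc, hu] }
      colinear := by
        rw [← cancel_mono (g.hom ▷ H), Category.assoc, Category.assoc, g.colinear,
          ← comp_whiskerRight, hu, f.colinear, reassoc_of% hu] }, rfl⟩
  obtain ⟨a, rfl⟩ := key f g u hu
  obtain ⟨b, rfl⟩ := key g f v hv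
  refine ⟨⟨a, b, ?_, ?_⟩, rfl⟩
  · apply ComodAlg.Hom.ext
    change a.hom ≫ b.hom = 𝟙 _
    rw [← cancel_mono f.hom, Category.assoc, hv, hu, Category.id_comp]
  · apply ComodAlg.Hom.ext
    change b.hom ≫ a.hom = 𝟙 _
    rw [← cancel_mono g.hom, Category.assoc, hu, hv, Category.id_comp]

end Iso

/-! ### Monomorphisms stable under flat tensoring -/

section FlatMono

/-- A morphism that stays a monomorphism after tensoring with any flat object. -/
def IsFlatMono {X Y : C} (f : X ⟶ Y) : Prop := ∀ (Z : C) [IsFlat Z], Mono (f ▷ Z)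

theorem IsFlatMono.comp {X Y Z : C} {f : X ⟶ Y} {g : Y ⟶ Z} (hf : IsFlatMono f)
    (hg : IsFlatMono g) : IsFlatMono (f ≫ g) := fun W _ => by
  have := hf W
  have := hg W
  rw [comp_whiskerRight]
  infer_instance

theorem IsFlatMono.whiskerRight {X Y : C} {f : X ⟶ Y} (hf : IsFlatMono f) (Z : C) [IsFlat Z] :
    IsFlatMono (f ▷ Z) := fun W _ => by
  have := IsFlat.tensor Z W
  have := hf (Z ⊗ W)
  have e : f ▷ Z ▷ W = (α_ X Z W).hom ≫ f ▷ (Z ⊗ W) ≫ (α_ Y Z W).inv := by simp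
  rw [e]
  infer_instance

theorem IsFlatMono.mono_whiskerLeft {X Y : C} {f : X ⟶ Y} (hf : IsFlatMono f) (Z : C) [IsFlat Z] :
    Mono (Z ◁ f) := by
  have := hf Z
  have e : Z ◁ f = (β_ Z X).hom ≫ f ▷ Z ≫ (β_ Z Y).inv := by
    rw [← BraidedCategory.braiding_naturality_right_assoc]
    simp
  rw [e]
  infer_instance

theorem IsFlatMono.whiskerLeft {X Y : C} {f : X ⟶ Y} (hf : IsFlatMono f) (Z : C) [IsFlat Z] :
    IsFlatMono (Z ◁ f) := fun W _ => by
  have := hf.whiskerRight Z W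
  have e : Z ◁ f = (β_ Z X).hom ≫ f ▷ Z ≫ (β_ Z Y).inv := by
    rw [← BraidedCategory.braiding_naturality_right_assoc]
    simp
  rw [e, comp_whiskerRight, comp_whiskerRight]
  infer_instance

theorem IsFlatMono.tensor {X Y X' Y' : C} {f : X ⟶ Y} {g : X' ⟶ Y'} (hf : IsFlatMono f)
    (hg : IsFlatMono g) [IsFlat X'] [IsFlat Y] : IsFlatMono (f ⊗ₘ g) := by
  rw [MonoidalCategory.tensorHom_def]
  exact (hf.whiskerRight X').comp (hg.whiskerLeft Y)

theorem IsFlatMono.of_retraction {X Y : C} {f : X ⟶ Y} {r : Y ⟶ X} (h : f ≫ r = 𝟙 X) :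
    IsFlatMono f := fun W _ =>
  mono_of_mono_fac (h := 𝟙 _) (show f ▷ W ≫ r ▷ W = 𝟙 _ by
    rw [← comp_whiskerRight, h, id_whiskerRight])

theorem isFlat_unit : IsFlat (𝟙_ C) where
  preserves := preservesLimitsOfShape_of_natIso (leftUnitorNatIso C).symm

theorem IsFlatMono.mono {X Y : C} {f : X ⟶ Y} (hf : IsFlatMono f) : Mono f := by
  have := isFlat_unit (C := C)
  have := hf (𝟙_ C)
  have e : f = (ρ_ X).inv ≫ f ▷ 𝟙_ C ≫ (ρ_ Y).hom := by simp
  rw [e]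
  infer_instance

end FlatMono

/-! ### Commuting with a tensor product of algebras -/

section TensorCommutant

variable {A B S S' T T' : C} [MonObj S] [MonObj S'] (i : A ⟶ S) (i' : B ⟶ S')

theorem leftMul_tensor : leftMul (i ⊗ₘ i') =
    tensorμ A B S S' ≫ (leftMul i ⊗ₘ leftMul i') := by
  rw [leftMul, MonObj.tensorObj.mul_def, tensorμ_natural_left_assoc, tensorHom_comp_tensorHom]
  rfl

theorem rightMul_tensor : rightMul (i ⊗ₘ i') =
    (β_ (A ⊗ B) (S ⊗ S')).hom ≫ tensorμ S S' A B ≫ (S ◁ i ≫ μ[S] ⊗ₘ S' ◁ i' ≫ μ[S']) := by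
  rw [rightMul, MonObj.tensorObj.mul_def, tensorμ_natural_right_assoc, tensorHom_comp_tensorHom]

/-- On the right side `A` passes `T'` and is then brought back across it; `hs` makes this double
braiding trivial, and only `A` past `T` and `B` past `T'` remain. -/
theorem tensorμ_braiding (A B T T' : C) (hs : (β_ A T').hom ≫ (β_ T' A).hom = 𝟙 _) :
    tensorμ A B T T' ≫ ((β_ A T).hom ⊗ₘ (β_ B T').hom) =
      (β_ (A ⊗ B) (T ⊗ T')).hom ≫ tensorμ T T' A B := by
  have hs' := congrArg (fun t => T ◁ t ▷ B) hs
  simp only [whiskerLeft_comp, comp_whiskerRight, id_whiskerRight, whiskerLeft_id] at hs'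
  simp only [BraidedCategory.braiding_tensor_left_hom, BraidedCategory.braiding_tensor_right_hom,
    tensorμ, MonoidalCategory.tensorHom_def]
  simp [reassoc_of% hs']

theorem leftMul_tensor_comm (j : T ⟶ S) (j' : T' ⟶ S')
    (h : A ◁ j ≫ leftMul i = A ◁ j ≫ rightMul i)
    (h' : B ◁ j' ≫ leftMul i' = B ◁ j' ≫ rightMul i')
    (hs : (β_ A T').hom ≫ (β_ T' A).hom = 𝟙 _) :
    (A ⊗ B) ◁ (j ⊗ₘ j') ≫ leftMul (i ⊗ₘ i') = (A ⊗ B) ◁ (j ⊗ₘ j') ≫ rightMul (i ⊗ₘ i') := by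
  rw [leftMul_tensor, rightMul_tensor, BraidedCategory.braiding_naturality_right_assoc,
    tensorμ_natural_right_assoc, tensorμ_natural_left_assoc, ← reassoc_of% tensorμ_braiding A B T T' hs,
    tensorHom_comp_tensorHom, tensorHom_comp_tensorHom, tensorHom_comp_tensorHom, h, h', rightMul,
    rightMul, BraidedCategory.braiding_naturality_right_assoc,
    BraidedCategory.braiding_naturality_right_assoc]

variable [MonObj A] [MonObj B] [IsMonHom i] [IsMonHom i'] 

/-- Restrict the hypothesis along `b ↦ 1 ⊗ b`. Here `B` passes `S` once on either side, so no
symmetry of the braiding is needed. -/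
theorem comm_right_of_comm_tensor {X : C} (x : X ⟶ S ⊗ S')
    (h : (A ⊗ B) ◁ x ≫ leftMul (i ⊗ₘ i') = (A ⊗ B) ◁ x ≫ rightMul (i ⊗ₘ i')) :
    B ◁ x ≫ (α_ B S S').inv ≫ (β_ B S).hom ▷ S' ≫ (α_ S B S').hom ≫ S ◁ leftMul i' =
      B ◁ x ≫ (α_ B S S').inv ≫ (β_ B S).hom ▷ S' ≫ (α_ S B S').hom ≫ S ◁ rightMul i' := by
  have e₁ : ((λ_ B).inv ≫ η[A] ▷ B) ▷ (S ⊗ S') ≫ leftMul (i ⊗ₘ i') =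
      (α_ B S S').inv ≫ (β_ B S).hom ▷ S' ≫ (α_ S B S').hom ≫ S ◁ leftMul i' := by
    have a := tensorμ_natural_left η[A] (𝟙 B) S S'
    simp only [tensorHom_id, id_whiskerRight] at a
    have b : η[A] ▷ S ▷ (B ⊗ S') ≫ (leftMul i ⊗ₘ leftMul i') =
        (λ_ S).hom ▷ (B ⊗ S') ≫ S ◁ leftMul i' := by
      rw [← tensorHom_id, tensorHom_comp_tensorHom, one_leftMul_act, Category.id_comp,
        MonoidalCategory.tensorHom_def]
    rw [leftMul_tensor, comp_whiskerRight, Category.assoc, reassoc_of% a, b]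
    simp only [tensorμ]
    monoidal
  have e₂ : ((λ_ B).inv ≫ η[A] ▷ B) ▷ (S ⊗ S') ≫ rightMul (i ⊗ₘ i') =
      (α_ B S S').inv ≫ (β_ B S).hom ▷ S' ≫ (α_ S B S').hom ≫ S ◁ rightMul i' := by
    have a := tensorμ_natural_right S S' η[A] (𝟙 B)
    simp only [tensorHom_id, whiskerLeft_id] at a
    have b : (S ◁ η[A]) ▷ (S' ⊗ B) ≫ (S ◁ i ≫ μ[S] ⊗ₘ S' ◁ i' ≫ μ[S']) =
        (ρ_ S).hom ▷ (S' ⊗ B) ≫ S ◁ (S' ◁ i' ≫ μ[S']) := by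
      rw [← tensorHom_id, tensorHom_comp_tensorHom, ← whiskerLeft_comp_assoc, IsMonHom.one_hom,
        MonObj.mul_one, Category.id_comp, MonoidalCategory.tensorHom_def]
    rw [rightMul_tensor, BraidedCategory.braiding_naturality_left_assoc, whiskerLeft_comp,
      Category.assoc, reassoc_of% a, b, BraidedCategory.braiding_tensor_right_hom,
      rightMul]
    simp only [tensorμ, braiding_tensorUnit_right]
    monoidal
  rw [← e₁, ← e₂, whisker_exchange_assoc, whisker_exchange_assoc, h]

/-- Restrict along `a ↦ a ⊗ 1`. Now `A` passes the second factor and comes back. Symmetry is assumed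
for `T'` only, which is why the morphism must already factor through `S ⊗ T'`. -/
theorem comm_left_of_comm_tensor {X : C} (y : X ⟶ S ⊗ T') (j' : T' ⟶ S') [Mono (S ◁ j')]
    (h : (A ⊗ B) ◁ (y ≫ S ◁ j') ≫ leftMul (i ⊗ₘ i') =
      (A ⊗ B) ◁ (y ≫ S ◁ j') ≫ rightMul (i ⊗ₘ i'))
    (hs : (β_ A T').hom ≫ (β_ T' A).hom = 𝟙 _) :
    A ◁ y ≫ (α_ A S T').inv ≫ leftMul i ▷ T' = A ◁ y ≫ (α_ A S T').inv ≫ rightMul i ▷ T' := by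
  have e₁ : ((ρ_ A).inv ≫ A ◁ η[B]) ▷ (S ⊗ S') ≫ leftMul (i ⊗ₘ i') =
      (α_ A S S').inv ≫ leftMul i ▷ S' := by
    have a := tensorμ_natural_left (𝟙 A) η[B] S S'
    simp only [id_tensorHom, id_whiskerRight] at a
    have b : (A ⊗ S) ◁ η[B] ▷ S' ≫ (leftMul i ⊗ₘ leftMul i') =
        (A ⊗ S) ◁ (λ_ S').hom ≫ leftMul i ▷ S' := by
      rw [← id_tensorHom, tensorHom_comp_tensorHom, one_leftMul_act, Category.id_comp,
        MonoidalCategory.tensorHom_def']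
    rw [leftMul_tensor, comp_whiskerRight, Category.assoc, reassoc_of% a, b]
    simp only [tensorμ, braiding_tensorUnit_left]
    monoidal
  have e₂ : ((ρ_ A).inv ≫ A ◁ η[B]) ▷ (S ⊗ S') ≫ rightMul (i ⊗ₘ i') =
      (β_ A (S ⊗ S')).hom ≫ (α_ S S' A).hom ≫ S ◁ (β_ S' A).hom ≫ (α_ S A S').inv ≫
        (S ◁ i ≫ μ[S]) ▷ S' := by
    have a := tensorμ_natural_right S S' (𝟙 A) η[B]
    simp only [id_tensorHom, whiskerLeft_id] at a
    have b : (S ⊗ A) ◁ S' ◁ η[B] ≫ (S ◁ i ≫ μ[S] ⊗ₘ S' ◁ i' ≫ μ[S']) =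
        (S ⊗ A) ◁ (ρ_ S').hom ≫ (S ◁ i ≫ μ[S]) ▷ S' := by
      rw [← id_tensorHom, tensorHom_comp_tensorHom, ← whiskerLeft_comp_assoc, IsMonHom.one_hom,
        MonObj.mul_one, Category.id_comp, MonoidalCategory.tensorHom_def']
    rw [rightMul_tensor, BraidedCategory.braiding_naturality_left_assoc, whiskerLeft_comp,
      Category.assoc, reassoc_of% a, b]
    simp only [tensorμ]
    monoidal
  have h' := congrArg (fun t => ((ρ_ A).inv ≫ A ◁ η[B]) ▷ X ≫ t) h
  simp only [← whisker_exchange_assoc, e₁, e₂] at h'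
  have e₃ : A ◁ S ◁ j' ≫ (β_ A (S ⊗ S')).hom ≫ (α_ S S' A).hom ≫ S ◁ (β_ S' A).hom ≫
      (α_ S A S').inv ≫ (S ◁ i ≫ μ[S]) ▷ S' = (α_ A S T').inv ≫ rightMul i ▷ T' ≫ S ◁ j' := by
    rw [BraidedCategory.braiding_naturality_right_assoc, associator_naturality_middle_assoc,
      ← whiskerLeft_comp_assoc, BraidedCategory.braiding_naturality_left, whiskerLeft_comp,
      Category.assoc, associator_inv_naturality_right_assoc, whisker_exchange,
      BraidedCategory.braiding_tensor_right_hom]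
    simp only [Category.assoc, Iso.inv_hom_id_assoc]
    rw [← whiskerLeft_comp_assoc, hs, rightMul]
    simp
  rw [← cancel_mono (S ◁ j')]
  simp only [whiskerLeft_comp, Category.assoc, e₃] at h' ⊢
  rw [← h', ← whisker_exchange, associator_inv_naturality_right_assoc]

end TensorCommutant

/-! ### Cotensor conditions under tensor products and extension by coefficients -/

section Cotensor

variable {H : C} [BimonObj H] [HLinearBraiding H]

theorem comulSplit_condition (A B : C) :
    comulSplit H A B ≫ (A ◁ Δ[H] ≫ (α_ A H H).inv) ▷ (B ⊗ H) =
      comulSplit H A B ≫ (A ⊗ H) ◁ ((B ◁ Δ[H] ≫ (α_ B H H).inv) ≫ (β_ (B ⊗ H) H).hom) ≫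
        (α_ (A ⊗ H) H (B ⊗ H)).inv := by
  have h := congrArg (fun t => (A ⊗ B) ◁ t) (ComonObj.comul_assoc H)
  simp only [whiskerLeft_comp] at h
  have e₁ : tensorμ A B H H ≫ (A ◁ Δ[H]) ▷ (B ⊗ H) =
      (A ⊗ B) ◁ Δ[H] ▷ H ≫ tensorμ A B (H ⊗ H) H := by
    have := tensorμ_natural_right A B Δ[H] (𝟙 H)
    simp only [tensorHom_id, whiskerLeft_id] at this
    exact this.symm
  have e₂ : tensorμ A B H H ≫ (A ⊗ H) ◁ B ◁ Δ[H] =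
      (A ⊗ B) ◁ H ◁ Δ[H] ≫ tensorμ A B H (H ⊗ H) := by
    have := tensorμ_natural_right A B (𝟙 H) Δ[H]
    simp only [id_tensorHom, whiskerLeft_id] at this
    exact this.symm
  rw [whiskerLeft_leftCoact_comul]
  simp only [comulSplit, comp_whiskerRight, Category.assoc]
  rw [reassoc_of% e₁, ← associator_inv_naturality_right_assoc, reassoc_of% e₂, reassoc_of% h]
  simp only [tensorμ, BraidedCategory.braiding_tensor_right_hom]
  monoidal

/-- The tensor product of two morphisms of comodule algebras. -/
@[reducible]
def tensorComodAlgHom {S S' T T' : ComodAlg H} (f : T ⟶ S) (g : T' ⟶ S') :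
    tensorComodAlg T T' ⟶ tensorComodAlg S S' where
  hom := f.hom ⊗ₘ g.hom
  colinear := by
    have e : T'.coact ≫ g.hom ▷ H = g.hom ≫ S'.coact := g.colinear
    simp only [MonoidalCategory.tensorHom_def, Category.assoc, comp_whiskerRight]
    rw [← whiskerLeft_comp_assoc, ← e, whiskerLeft_comp, Category.assoc, ← whisker_exchange_assoc]
    monoidal

theorem tensor_coact {S S' T T' : ComodAlg H} (f : T ⟶ S) (g : T' ⟶ S') :
    (f.hom ⊗ₘ g.hom) ≫ S.coact ▷ S'.X = T.coact ▷ T'.X ≫ (f.hom ▷ H ⊗ₘ g.hom) := by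
  rw [← tensorHom_id, ← tensorHom_id, tensorHom_comp_tensorHom, tensorHom_comp_tensorHom,
    f.colinear, Category.comp_id, Category.id_comp]

theorem tensor_leftCoact {S S' T T' : ComodAlg H} (f : T ⟶ S) (g : T' ⟶ S') :
    (f.hom ⊗ₘ g.hom) ≫ S.X ◁ leftCoact S' ≫ (α_ S.X H S'.X).inv =
      (T.X ◁ leftCoact T' ≫ (α_ T.X H T'.X).inv) ≫ (f.hom ▷ H ⊗ₘ g.hom) := by
  have e : g.hom ≫ leftCoact S' = leftCoact T' ≫ H ◁ g.hom := by
    rw [leftCoact, leftCoact, Category.assoc, ← BraidedCategory.braiding_naturality_left,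
      reassoc_of% g.colinear]
  rw [← id_tensorHom S.X, tensorHom_comp_tensorHom_assoc, Category.comp_id, e, ← tensorHom_id,
    Category.assoc, ← associator_inv_naturality, ← id_tensorHom T.X,
    tensorHom_comp_tensorHom_assoc, Category.id_comp, id_tensorHom]

end Cotensor

section TensorDecomposition

variable {H : C} [BimonObj H] [HLinearBraiding H] {S S' T T' : ComodAlg H} {A B : C}
  (t : A ⊗ T.X ⟶ S.X) (t' : B ⊗ T'.X ⟶ S'.X)

/-- Together with `tensorμ_leftCoact`, this turns the two arrows defining the cotensor product of
`S` and `S'` into `A ⊗ B` tensored with those of `T` and `T'`, followed by the same morphism in both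
cases. -/
theorem tensorμ_coact (ht : t ≫ S.coact = A ◁ T.coact ≫ (α_ A T.X H).inv ≫ t ▷ H) :
    (tensorμ A B T.X T'.X ≫ (t ⊗ₘ t')) ≫ S.coact ▷ S'.X =
      (A ⊗ B) ◁ T.coact ▷ T'.X ≫ tensorμ A B (T.X ⊗ H) T'.X ≫
        ((α_ A T.X H).inv ≫ t ▷ H ⊗ₘ t') := by
  rw [← tensorHom_id, ← tensorHom_id T.coact, tensorμ_natural_right_assoc, Category.assoc,
    tensorHom_comp_tensorHom, tensorHom_comp_tensorHom, ht, Category.comp_id, whiskerLeft_id,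
    Category.id_comp]

theorem tensorμ_leftCoact (ht' : t' ≫ S'.coact = B ◁ T'.coact ≫ (α_ B T'.X H).inv ≫ t' ▷ H) :
    (tensorμ A B T.X T'.X ≫ (t ⊗ₘ t')) ≫ S.X ◁ leftCoact S' ≫ (α_ S.X H S'.X).inv =
      (A ⊗ B) ◁ (T.X ◁ leftCoact T' ≫ (α_ T.X H T'.X).inv) ≫ tensorμ A B (T.X ⊗ H) T'.X ≫
        ((α_ A T.X H).inv ≫ t ▷ H ⊗ₘ t') := by
  have e₁ : t' ≫ leftCoact S' = B ◁ leftCoact T' ≫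
      (α_ B H T'.X).inv ≫ (β_ B H).hom ▷ T'.X ≫ (α_ H B T'.X).hom ≫ H ◁ t' := by
    rw [leftCoact, leftCoact, reassoc_of% ht', BraidedCategory.braiding_naturality_left,
      BraidedCategory.braiding_tensor_left_hom]
    simp
  have e₂ : tensorμ A B T.X T'.X ≫ (A ⊗ T.X) ◁ B ◁ leftCoact T' =
      (A ⊗ B) ◁ T.X ◁ leftCoact T' ≫ tensorμ A B T.X (H ⊗ T'.X) := by
    have := tensorμ_natural_right A B (𝟙 T.X) (leftCoact T')
    simp only [id_tensorHom, whiskerLeft_id] at this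
    exact this.symm
  have e₃ : (t ⊗ₘ t') ≫ S.X ◁ leftCoact S' = (A ⊗ T.X) ◁ B ◁ leftCoact T' ≫
      (A ⊗ T.X) ◁ ((α_ B H T'.X).inv ≫ (β_ B H).hom ▷ T'.X ≫ (α_ H B T'.X).hom) ≫
        (t ⊗ₘ (H ◁ t')) := by
    rw [MonoidalCategory.tensorHom_def, Category.assoc, ← whiskerLeft_comp, e₁,
      MonoidalCategory.tensorHom_def t (H ◁ t'), whisker_exchange_assoc, whisker_exchange_assoc]
    simp only [whiskerLeft_comp, Category.assoc]
  have e₄ : (t ⊗ₘ (H ◁ t')) ≫ (α_ S.X H S'.X).inv =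
      (α_ (A ⊗ T.X) H (B ⊗ T'.X)).inv ≫ (t ▷ H ⊗ₘ t') := by
    rw [← id_tensorHom, associator_inv_naturality, tensorHom_id]
  have e₅ : ((α_ A T.X H).inv ≫ t ▷ H ⊗ₘ t') =
      (α_ A T.X H).inv ▷ (B ⊗ T'.X) ≫ (t ▷ H ⊗ₘ t') := by
    rw [← tensorHom_id (α_ A T.X H).inv, tensorHom_comp_tensorHom, Category.id_comp]
  rw [Category.assoc, reassoc_of% e₃, reassoc_of% e₂, e₄, e₅]
  simp only [tensorμ, BraidedCategory.braiding_tensor_right_hom]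
  monoidal

end TensorDecomposition

section

variable {A M N : C} [MonObj M] [MonObj N] (i : A ⟶ M) (f : M ⟶ N) [IsMonHom f]

theorem leftMul_comp : A ◁ f ≫ leftMul (i ≫ f) = leftMul i ≫ f := by
  rw [leftMul, leftMul, Category.assoc, IsMonHom.mul_hom, comp_whiskerRight, Category.assoc,
    whisker_exchange_assoc, MonoidalCategory.tensorHom_def', Category.assoc]

theorem rightMul_comp : A ◁ f ≫ rightMul (i ≫ f) = rightMul i ≫ f := by
  rw [rightMul, rightMul, BraidedCategory.braiding_naturality_right_assoc, Category.assoc,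
    Category.assoc, IsMonHom.mul_hom, whiskerLeft_comp, Category.assoc,
    MonoidalCategory.tensorHom_def, Category.assoc, ← whisker_exchange_assoc]

end

section

variable [HasEqualizers C] {H : C} [BimonObj H] [IsFlat H] [HLinearBraiding H]
  {S S' T T' : ComodAlg H} {A B : C} [IsFlat (A ⊗ B)]

/-- If `S = A ⊗ T` and `S' = B ⊗ T'` as comodules, then the cotensor product of `S` and `S'` is
the tensor product of `A ⊗ B` and the cotensor product of `T` and `T'`. -/
theorem isIso_of_cotensor (t : A ⊗ T.X ⟶ S.X) (t' : B ⊗ T'.X ⟶ S'.X) [IsIso t] [IsIso t']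
    (ht : t ≫ S.coact = A ◁ T.coact ≫ (α_ A T.X H).inv ≫ t ▷ H)
    (ht' : t' ≫ S'.coact = B ◁ T'.coact ≫ (α_ B T'.X H).inv ≫ t' ▷ H)
    {U : C} (φ : U ⟶ S.X ⊗ S'.X) [Mono φ]
    (hφ : φ ≫ S.coact ▷ S'.X = φ ≫ S.X ◁ leftCoact S' ≫ (α_ S.X H S'.X).inv)
    (θ : (A ⊗ B) ⊗ (cotensor T T').X ⟶ U)
    (hθ : θ ≫ φ = (A ⊗ B) ◁ (cotensorHom T T').hom ≫ tensorμ A B T.X T'.X ≫ (t ⊗ₘ t')) :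
    IsIso θ := by
  have hμ (X Y : C) : IsIso (tensorμ A B X Y) :=
    ⟨tensorδ A B X Y, tensorμ_tensorδ A B X Y, tensorδ_tensorμ A B X Y⟩
  let Ω := tensorμ A B T.X T'.X ≫ (t ⊗ₘ t')
  have hΩ₁ := tensorμ_coact (B := B) t t' ht
  have hΩ₂ := tensorμ_leftCoact (A := A) t t' ht'
  have : IsIso Ω := inferInstanceAs (IsIso (_ ≫ _))
  have := mono_whiskerLeft_cotensorHom T T' (A ⊗ B)
  -- Flatness of `A ⊗ B` makes `(A ⊗ B) ⊗ (T □ T')` an equalizer; through it `φ ≫ inv Ω` factors,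
  -- and the factorization is the inverse of `θ`.
  obtain ⟨w, hw⟩ := whiskerLeft_cotensorHom_fac T T' (A ⊗ B) (φ ≫ inv Ω) (by
    rw [← cancel_mono (tensorμ A B (T.X ⊗ H) T'.X ≫ ((α_ A T.X H).inv ≫ t ▷ H ⊗ₘ t')),
      Category.assoc, ← hΩ₁, Category.assoc (φ ≫ inv Ω), ← hΩ₂]
    change (φ ≫ inv Ω) ≫ Ω ≫ _ = (φ ≫ inv Ω) ≫ Ω ≫ _
    simpa using hφ)
  refine ⟨w, ?_, ?_⟩
  · rw [← cancel_mono ((A ⊗ B) ◁ (cotensorHom T T').hom), Category.assoc, hw, ← Category.assoc, hθ]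
    change (_ ≫ Ω) ≫ inv Ω = _
    simp
  · rw [← cancel_mono φ, Category.assoc, hθ, reassoc_of% hw]
    change φ ≫ inv Ω ≫ Ω = _
    simp

end

/-! ### The Galois object of an `H`-Azumaya algebra -/

section SmashCommutant

variable [MonoidalClosed C] [HasEqualizers C] {H : C} [IsFlat H]

section

variable [BimonObj H] [HLinearBraiding H] (A : Mod C H) [MonObj A] (hA : IsFinite A.X)

/-- The inclusion of `(A # H)^A` into `A # H`. -/
noncomputable def smashCommutantHom : smashCommutant A hA ⟶ smash A :=
  commutantHom (smash A) hA (smashIncl A) (smashIncl_coact A)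

theorem smashCommutantHom_comm : A.X ◁ (smashCommutantHom A hA).hom ≫ leftMul (smashIncl A) =
    A.X ◁ (smashCommutantHom A hA).hom ≫ rightMul (smashIncl A) :=
  commutantHom_comm (smash A) hA (smashIncl A) (smashIncl_coact A)

theorem isFlatMono_smashCommutantHom : IsFlatMono (smashCommutantHom A hA).hom := fun Z _ =>
  mono_commutantHom_whiskerRight (smash A) hA (smashIncl A) (smashIncl_coact A) Z

theorem smashCommutantHom_fac {X : C} (x : X ⟶ (smash A).X)
    (h : A.X ◁ x ≫ leftMul (smashIncl A) = A.X ◁ x ≫ rightMul (smashIncl A)) :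
    ∃ y, y ≫ (smashCommutantHom A hA).hom = x :=
  commutantHom_fac (smash A) hA (smashIncl A) (smashIncl_coact A) x h

theorem smashCommutantHom_whiskerRight_fac (Z : C) [IsFlat Z] {X : C} (x : X ⟶ (smash A).X ⊗ Z)
    (h : A.X ◁ x ≫ (α_ A.X (smash A).X Z).inv ≫ leftMul (smashIncl A) ▷ Z =
      A.X ◁ x ≫ (α_ A.X (smash A).X Z).inv ≫ rightMul (smashIncl A) ▷ Z) :
    ∃ y, y ≫ (smashCommutantHom A hA).hom ▷ Z = x :=
  commutantHom_whiskerRight_fac (smash A) hA (smashIncl A) (smashIncl_coact A) Z x h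

theorem smashCommutantHom_whiskerLeft_fac (Z : C) [IsFlat Z] {X : C} (x : X ⟶ Z ⊗ (smash A).X)
    (h : A.X ◁ x ≫ (α_ A.X Z (smash A).X).inv ≫ (β_ A.X Z).hom ▷ (smash A).X ≫
        (α_ Z A.X (smash A).X).hom ≫ Z ◁ leftMul (smashIncl A) =
      A.X ◁ x ≫ (α_ A.X Z (smash A).X).inv ≫ (β_ A.X Z).hom ▷ (smash A).X ≫
        (α_ Z A.X (smash A).X).hom ≫ Z ◁ rightMul (smashIncl A)) :
    ∃ y, y ≫ Z ◁ (smashCommutantHom A hA).hom = x :=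
  commutantHom_whiskerLeft_fac (smash A) hA (smashIncl A) (smashIncl_coact A) Z x h

/-- `A` is coinvariant, so the decomposition of `A # H` is colinear for the coaction on the
commutant alone, as `isIso_of_cotensor` requires. -/
theorem leftMul_smashCommutantHom_coact :
    (A.X ◁ (smashCommutantHom A hA).hom ≫ leftMul (smashIncl A)) ≫ (smash A).coact =
      A.X ◁ (smashCommutant A hA).coact ≫ (α_ A.X (smashCommutant A hA).X H).inv ≫
        (A.X ◁ (smashCommutantHom A hA).hom ≫ leftMul (smashIncl A)) ▷ H := by
  rw [Category.assoc, leftMul_coact (smash A) _ (smashIncl_coact A), ← whiskerLeft_comp_assoc,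
    ← (smashCommutantHom A hA).colinear, comp_whiskerRight, whiskerLeft_comp, Category.assoc,
    associator_inv_naturality_middle_assoc]

end

variable [HasCoequalizers C]

theorem IsAzumayaAlg.isFlat [BimonObj H] [HLinearBraiding H] {A : Mod C H} [MonObj A]
    (hA : IsAzumayaAlg A) : IsFlat A.X := by
  obtain ⟨P, ⟨p⟩⟩ := hA.isFinite
  exact isFlat_of_exactPairing P A.X

theorem isIso_smashCommutant [BimonObj H] [HLinearBraiding H] (A : Mod C H) [MonObj A]
    (hA : IsAzumayaAlg A) :
    IsIso (A.X ◁ (smashCommutantHom A hA.isFinite).hom ≫ leftMul (smashIncl A)) := by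
  obtain ⟨-, P, p, h⟩ := hA.underlying
  have := (isFlatMono_smashCommutantHom A hA.isFinite).mono
  exact isIso_of_commutant P (smashIncl A) _ (smashCommutantHom_comm A hA.isFinite)
    (fun x hx => smashCommutantHom_fac A hA.isFinite x hx)

theorem isGaloisObj_smashCommutant [HopfObj H] [HLinearBraiding H] (A : Mod C H) [MonObj A]
    (hA : IsAzumayaAlg A) : IsGaloisObj (smashCommutant A hA.isFinite) := by
  have := hA.isFlat
  have := hA.underlying.1
  have := isIso_smashCommutant A hA
  exact isGaloisObj_of_smash A (smashCommutantHom A hA.isFinite)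

end SmashCommutant

/-! ### Comparison inside the tensor product of the smash products -/

section Main

variable [MonoidalClosed C] [HasEqualizers C] [HasCoequalizers C] {H : C} [HopfObj H] [IsFlat H]
  [HLinearBraiding H] {A B : Mod C H} [MonObj A] [MonObj B] (hA : IsAzumayaAlg A)
  (hB : IsAzumayaAlg B)

/-- The embedding of the cotensor product of `(A # H)^A` and `(B # H)^B` into
`(A # H) ⊗ (B # H)`. -/
noncomputable def cotensorIncl :
    cotensor (smashCommutant A hA.isFinite) (smashCommutant B hB.isFinite) ⟶
      tensorComodAlg (smash A) (smash B) :=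
  cotensorHom _ _ ≫
    tensorComodAlgHom (smashCommutantHom A hA.isFinite) (smashCommutantHom B hB.isFinite)

/-- The embedding of `((A ⊗ B) # H)^{A ⊗ B}` into `(A # H) ⊗ (B # H)`. -/
noncomputable def commutantIncl :
    smashCommutant (A ⊗ B) (hA.isFinite_tensor hB) ⟶ tensorComodAlg (smash A) (smash B) :=
  smashCommutantHom (A ⊗ B) (hA.isFinite_tensor hB) ≫ smashSplitHom A B

theorem isFlat_smash {A : Mod C H} [MonObj A] (hA : IsAzumayaAlg A) : IsFlat (smash A).X :=
  have := hA.isFlat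
  IsFlat.tensor A.X H

/-- An equalizer has no reason to be flat; flatness comes from the Galois property. -/
theorem isFlat_smashCommutant {A : Mod C H} [MonObj A] (hA : IsAzumayaAlg A) :
    IsFlat (smashCommutant A hA.isFinite).X :=
  (isGaloisObj_smashCommutant A hA).faithfullyFlat.toIsFlat

theorem isFlatMono_tensor_smashCommutantHom :
    IsFlatMono ((smashCommutantHom A hA.isFinite).hom ⊗ₘ (smashCommutantHom B hB.isFinite).hom) :=
  have := isFlat_smash hA
  have := isFlat_smashCommutant hB
  (isFlatMono_smashCommutantHom A _).tensor (isFlatMono_smashCommutantHom B _)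

theorem isFlatMono_cotensorIncl : IsFlatMono (cotensorIncl hA hB).hom :=
  IsFlatMono.comp (fun Z _ => mono_cotensorHom_whiskerRight _ _ Z)
    (isFlatMono_tensor_smashCommutantHom hA hB)

theorem isFlatMono_commutantIncl : IsFlatMono (commutantIncl hA hB).hom :=
  (isFlatMono_smashCommutantHom (A ⊗ B) _).comp
    (IsFlatMono.of_retraction (comulSplit_counitMerge A.X B.X))

/-- The cotensor product of the commutants lies in the cotensor product of the smash products. -/
theorem cotensorIncl_condition :
    (cotensorIncl hA hB).hom ≫ (smash A).coact ▷ (smash B).X =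
      (cotensorIncl hA hB).hom ≫ (smash A).X ◁ leftCoact (smash B) ≫
        (α_ (smash A).X H (smash B).X).inv := by
  change (_ ≫ (_ ⊗ₘ _)) ≫ _ = (_ ≫ (_ ⊗ₘ _)) ≫ _
  rw [Category.assoc, Category.assoc, tensor_coact, tensor_leftCoact,
    reassoc_of% cotensorHom_condition]
  simp only [Category.assoc]

theorem smashSplitHom_condition (A B : Mod C H) [MonObj A] [MonObj B] :
    (smashSplitHom A B).hom ≫ (smash A).coact ▷ (smash B).X =
      (smashSplitHom A B).hom ≫ (smash A).X ◁ leftCoact (smash B) ≫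
        (α_ (smash A).X H (smash B).X).inv :=
  comulSplit_condition A.X B.X

theorem leftMul_smashSplit {X : C} (x : X ⟶ (smash (A ⊗ B)).X) :
    ((A ⊗ B).X ◁ x ≫ leftMul (smashIncl (A ⊗ B))) ≫ (smashSplitHom A B).hom =
      (A.X ⊗ B.X) ◁ (x ≫ (smashSplitHom A B).hom) ≫ leftMul (smashIncl A ⊗ₘ smashIncl B) := by
  rw [Category.assoc, ← leftMul_comp, smashIncl_smashSplit, ← whiskerLeft_comp_assoc]
  rfl

theorem rightMul_smashSplit {X : C} (x : X ⟶ (smash (A ⊗ B)).X) :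
    ((A ⊗ B).X ◁ x ≫ rightMul (smashIncl (A ⊗ B))) ≫ (smashSplitHom A B).hom =
      (A.X ⊗ B.X) ◁ (x ≫ (smashSplitHom A B).hom) ≫ rightMul (smashIncl A ⊗ₘ smashIncl B) := by
  rw [Category.assoc, ← rightMul_comp, smashIncl_smashSplit, ← whiskerLeft_comp_assoc]
  rfl

/-- The cotensor product of the commutants is contained in the commutant of `A ⊗ B`. -/
theorem cotensorIncl_fac
    (hs : ∀ X : C, (β_ X (smashCommutant B hB.isFinite).X).hom ≫
      (β_ (smashCommutant B hB.isFinite).X X).hom = 𝟙 _) :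
    ∃ v, v ≫ (commutantIncl hA hB).hom = (cotensorIncl hA hB).hom := by
  obtain ⟨k, hk⟩ := smashSplitHom_fac A B (cotensorIncl hA hB).hom (cotensorIncl_condition hA hB)
  have hc := leftMul_tensor_comm (smashIncl A) (smashIncl B) _ _
    (smashCommutantHom_comm A hA.isFinite) (smashCommutantHom_comm B hB.isFinite) (hs A.X)
  obtain ⟨v, hv⟩ := smashCommutantHom_fac (A ⊗ B) (hA.isFinite_tensor hB) k (by
    rw [← cancel_mono (smashSplitHom A B).hom, leftMul_smashSplit, rightMul_smashSplit, hk]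
    change (A.X ⊗ B.X) ◁ (_ ≫ (_ ⊗ₘ _)) ≫ _ = (A.X ⊗ B.X) ◁ (_ ≫ (_ ⊗ₘ _)) ≫ _
    rw [whiskerLeft_comp, Category.assoc, hc, Category.assoc])
  exact ⟨v, by
    change v ≫ _ ≫ _ = _
    rw [reassoc_of% hv, hk]⟩

/-- The commutant of `A ⊗ B` is contained in the cotensor product of the commutants. -/
theorem commutantIncl_fac
    (hs : ∀ X : C, (β_ X (smashCommutant B hB.isFinite).X).hom ≫
      (β_ (smashCommutant B hB.isFinite).X X).hom = 𝟙 _) :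
    ∃ u, u ≫ (cotensorIncl hA hB).hom = (commutantIncl hA hB).hom := by
  have := isFlat_smash hA
  have := isFlat_smashCommutant hB
  have hx : (A.X ⊗ B.X) ◁ (commutantIncl hA hB).hom ≫ leftMul (smashIncl A ⊗ₘ smashIncl B) =
      (A.X ⊗ B.X) ◁ (commutantIncl hA hB).hom ≫ rightMul (smashIncl A ⊗ₘ smashIncl B) := by
    have h := smashCommutantHom_comm (A ⊗ B) (hA.isFinite_tensor hB)
    have h' := congrArg (fun t => t ≫ (smashSplitHom A B).hom) h
    simp only at h'
    rw [leftMul_smashSplit, rightMul_smashSplit] at h'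
    exact h'
  -- The second factor comes first: only after it lies in `(B # H)^B` is the symmetry `hs` available
  -- for the factor of `A`.
  obtain ⟨y, hy⟩ := smashCommutantHom_whiskerLeft_fac B hB.isFinite (smash A).X (commutantIncl hA hB).hom
    (comm_right_of_comm_tensor (smashIncl A) (smashIncl B) _ hx)
  have hm : Mono ((smash A).X ◁ (smashCommutantHom B hB.isFinite).hom) :=
    (isFlatMono_smashCommutantHom B _).mono_whiskerLeft _
  rw [← hy] at hx
  obtain ⟨z, hz⟩ := smashCommutantHom_whiskerRight_fac A hA.isFinite
    (smashCommutant B hB.isFinite).X y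
    (comm_left_of_comm_tensor (smashIncl A) (smashIncl B) y _ hx (hs A.X))
  have hzw : z ≫ ((smashCommutantHom A hA.isFinite).hom ⊗ₘ (smashCommutantHom B hB.isFinite).hom) =
      (commutantIncl hA hB).hom := by
    rw [← hy, ← hz, MonoidalCategory.tensorHom_def, Category.assoc]
  -- This monomorphism lets the cotensor condition for `z` be tested in the smash products, where it
  -- holds by `smashSplitHom_condition`.
  have hmono : Mono ((smashCommutantHom A hA.isFinite).hom ▷ H ⊗ₘ
      (smashCommutantHom B hB.isFinite).hom) :=
    have := IsFlat.tensor (smash A).X H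
    (((isFlatMono_smashCommutantHom A _).whiskerRight H).tensor
      (isFlatMono_smashCommutantHom B _)).mono
  obtain ⟨u, hu⟩ := cotensorHom_fac _ _ z (by
    rw [← cancel_mono ((smashCommutantHom A hA.isFinite).hom ▷ H ⊗ₘ
      (smashCommutantHom B hB.isFinite).hom), Category.assoc, Category.assoc, ← tensor_coact,
      ← tensor_leftCoact, reassoc_of% hzw, reassoc_of% hzw]
    change (_ ≫ _) ≫ _ = (_ ≫ _) ≫ _
    rw [Category.assoc, Category.assoc, smashSplitHom_condition])
  exact ⟨u, by
    change u ≫ _ ≫ _ = _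
    rw [reassoc_of% hu, hzw]⟩

/-- The two comodule algebras are isomorphic, compatibly with the embeddings. -/
theorem commutant_iso_cotensor
    (hs : ∀ X : C, (β_ X (smashCommutant B hB.isFinite).X).hom ≫
      (β_ (smashCommutant B hB.isFinite).X X).hom = 𝟙 _) :
    ∃ e : smashCommutant (A ⊗ B) (hA.isFinite_tensor hB) ≅
        cotensor (smashCommutant A hA.isFinite) (smashCommutant B hB.isFinite),
      e.hom.hom ≫ (cotensorIncl hA hB).hom = (commutantIncl hA hB).hom := by
  obtain ⟨u, hu⟩ := commutantIncl_fac hA hB hs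
  obtain ⟨v, hv⟩ := cotensorIncl_fac hA hB hs
  have := (isFlatMono_cotensorIncl hA hB).mono
  have := (isFlatMono_commutantIncl hA hB).mono
  have := isFlatMono_cotensorIncl hA hB H
  have := isFlatMono_commutantIncl hA hB H
  obtain ⟨e, rfl⟩ := nonempty_iso_of_mono (commutantIncl hA hB) (cotensorIncl hA hB) u hu v hv
  exact ⟨e, hu⟩

/-- If `k` embeds the cotensor product of the commutants into `(A ⊗ B) # H`, then
`(A ⊗ B) # H` is the tensor product of `A ⊗ B` and the image of `k`. -/
theorem isIso_leftMul_cotensor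
    (k : cotensor (smashCommutant A hA.isFinite) (smashCommutant B hB.isFinite) ⟶ smash (A ⊗ B))
    (hk : k.hom ≫ (smashSplitHom A B).hom = (cotensorIncl hA hB).hom) :
    IsIso ((A ⊗ B).X ◁ k.hom ≫ leftMul (smashIncl (A ⊗ B))) := by
  have := hA.isFlat
  have := hB.isFlat
  have := IsFlat.tensor A.X B.X
  have := isIso_smashCommutant A hA
  have := isIso_smashCommutant B hB
  refine isIso_of_cotensor (A.X ◁ (smashCommutantHom A hA.isFinite).hom ≫ leftMul (smashIncl A))
    (B.X ◁ (smashCommutantHom B hB.isFinite).hom ≫ leftMul (smashIncl B))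
    (leftMul_smashCommutantHom_coact A hA.isFinite) (leftMul_smashCommutantHom_coact B hB.isFinite)
    (smashSplitHom A B).hom (smashSplitHom_condition A B) _ ?_
  refine (leftMul_smashSplit k.hom).trans ?_
  rw [hk, leftMul_tensor]
  change (A.X ⊗ B.X) ◁ (_ ≫ (_ ⊗ₘ _)) ≫ _ = _
  rw [whiskerLeft_comp, Category.assoc, tensorμ_natural_right_assoc, tensorHom_comp_tensorHom]

end Main

end BraidedHopf

theorem mainTheorem4
    {C : Type u} [Category.{v} C] [MonoidalCategory C] [BraidedCategory C] [MonoidalClosed C]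
    [HasEqualizers C] [HasCoequalizers C]
    (H : C) [HopfObj H] [IsFlat H] [HLinearBraiding H]
    (hsymm : ∀ T : ComodAlg H, IsGaloisObj T → ∀ X : C, (β_ T.X X).hom = (β_ X T.X).inv)
    (A B : Mod C H) [MonObj A] [MonObj B] (hA : IsAzumayaAlg A) (hB : IsAzumayaAlg B) :
    IsGaloisObj (smashCommutant (A ⊗ B) (hA.isFinite_tensor hB)) ∧
      IsGaloisObj (cotensor (smashCommutant A hA.isFinite) (smashCommutant B hB.isFinite)) ∧
      Nonempty (smashCommutant (A ⊗ B) (hA.isFinite_tensor hB) ≅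
        cotensor (smashCommutant A hA.isFinite) (smashCommutant B hB.isFinite)) := by
  -- The symmetry assumption applies because `(B # H)^B` has been shown to be Galois beforehand.
  have hs (X : C) : (β_ X (smashCommutant B hB.isFinite).X).hom ≫
      (β_ (smashCommutant B hB.isFinite).X X).hom = 𝟙 _ := by
    rw [hsymm _ (isGaloisObj_smashCommutant B hB) X, Iso.hom_inv_id]
  have := hA.isFlat
  have := hB.isFlat
  have := hA.underlying.1
  have := hB.underlying.1
  have : IsFlat (A ⊗ B).X := IsFlat.tensor A.X B.X
  have : IsConservative (A ⊗ B).X := IsConservative.tensor A.X B.X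
  obtain ⟨e, he⟩ := commutant_iso_cotensor hA hB hs
  have h₁ : e.hom.hom ≫ e.inv.hom = 𝟙 _ := congrArg ComodAlg.Hom.hom e.hom_inv_id
  have h₂ : e.inv.hom ≫ e.hom.hom = 𝟙 _ := congrArg ComodAlg.Hom.hom e.inv_hom_id
  have : IsIso e.hom.hom := ⟨e.inv.hom, h₁, h₂⟩
  let j := smashCommutantHom (A ⊗ B) (hA.isFinite_tensor hB)
  -- The decomposition of `(A ⊗ B) # H` is obtained for the cotensor product and then carried along
  -- `e` to the commutant, which avoids the Azumaya property for `A ⊗ B`.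
  have hk : IsIso ((A ⊗ B).X ◁ (e.inv ≫ j).hom ≫ leftMul (smashIncl (A ⊗ B))) := by
    apply isIso_leftMul_cotensor hA hB
    change (e.inv.hom ≫ j.hom) ≫ _ = _
    have he' : e.hom.hom ≫ (cotensorIncl hA hB).hom = j.hom ≫ (smashSplitHom A B).hom := he
    rw [Category.assoc, ← he', reassoc_of% h₂]
  have hj : IsIso ((A ⊗ B).X ◁ j.hom ≫ leftMul (smashIncl (A ⊗ B))) := by
    have h : j.hom = e.hom.hom ≫ (e.inv ≫ j).hom := by
      change _ = e.hom.hom ≫ e.inv.hom ≫ j.hom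
      rw [reassoc_of% h₁]
    rw [h, whiskerLeft_comp, Category.assoc]
    infer_instance
  exact ⟨isGaloisObj_of_smash (A ⊗ B) j, isGaloisObj_of_smash (A ⊗ B) (e.inv ≫ j), ⟨e⟩⟩
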